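/- Let $d\ge 1$ and let $\mathcal A=\bigotimes_{\mathbb Z}M_d(\mathbb C)$ be the infinite tensor product C*-algebra (the UHF algebra of the spin chain). For $Q\in M_d(\mathbb C)$ let $Q^{(j)}$ be the copy of $Q$ at the site $j\in\mathbb Z$; for $\Lambda\subseteq\mathbb Z$ let $\mathcal A_\Lambda$ be the C*-subalgebra generated by the $Q^{(j)}$ with $j\in\Lambda$; let $\mathcal A_{loc}=\bigcup_{|\Lambda|<\infty}\mathcal A_\Lambda$ be the set of strictly local elements; and let $\tau_j$ be the translation with $\tau_j(Q^{(k)})=Q^{(j+k)}$. For $0<\theta<1$ let $F_\theta$ be the set of all $Q\in\mathcal A$ with $\sum_{n\ge 0}\|Q\|^{(n)}\theta^{-n}<\infty$, where $\|Q\|^{(0)}=\|Q\|$ and $\|Q\|^{(n)}=\inf\{\|Q-R\| : R\in\mathcal A_{[-n,n]}\}$ for $n\ge 1$. Let $\varphi$ be a translation-invariant state of $\mathcal A$. Put $$Q_{\langle N\rangle}=\frac1{\sqrt{2N+1}}\sum_{|j|\le N}(\tau_j(Q)-\varphi(Q)1),\quad t(Q,R)=\lim_{N\to\infty}\varphi(Q_{\langle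 N\rangle}R_{\langle N\rangle}),\quad s(Q,R)=-i\sum_{k\in\mathbb Z}\varphi([\tau_k(Q),R]).$$ **(i)** Suppose there are positive constants $M(j)$ with $\sum_{j\ge1}jM(j)<\infty$ and a constant $K$ such that $$|\varphi(Q_1\tau_j(Q_2))-\varphi(Q_1)\varphi(Q_2)|\le K\,M(j)\,\|Q_1\|\,\|Q_2\|$$ for all $Q_1\in\mathcal A_{(-\infty,-1]}$, $Q_2\in\mathcal A_{[0,\infty)}$ and integers $j>0$. Then for every self-adjoint $Q\in\mathcal A_{loc}$ the limit $t(Q,Q)$ exists and $$\lim_{N\to\infty}\varphi(e^{iTQ_{\langle N\rangle}})=e^{-\frac{T^2}{2}t(Q,Q)}\qquad\text{for all }T\in\mathbb R .$$ Moreover, for all $r$ and all self-adjoint $Q(1),\dots,Q(r)\in\mathcal A_{loc}$, the limits $t(Q(k),Q(l))$ and $t(\sum_kQ(k),\sum_kQ(k))$ exist, the series $s(Q(k),Q(l))$ converge absolutely, and $$\lim_{N\to\infty}\varphi\bigl(e^{iQ(1)_{\langle N\rangle}}e^{iQ(2)_{\langle N\rangle}}\cdots e^{iQ(r)_{\langle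 N\rangle}}\bigr)=\exp\Bigl(-\tfrac12\,t\bigl(\textstyle\sum_kQ(k),\sum_kQ(k)\bigr)\Bigr)\exp\Bigl(-\tfrac i2\sum_{k<l}s(Q(k),Q(l))\Bigr).\qquad(*)$$ **(ii)** Suppose there are constants $K,m>0$ such that $$|\varphi(Q_1\tau_j(Q_2))-\varphi(Q_1)\varphi(Q_2)|\le K e^{-mj}\,\|Q_1\|\,\|Q_2\|$$ for all $Q_1\in\mathcal A_{(-\infty,-1]}$, $Q_2\in\mathcal A_{[0,\infty)}$ and integers $j>0$. Then, for every $0<\theta<1$, every $r$ and all self-adjoint $Q(1),\dots,Q(r)\in F_\theta$, the limits $t(Q(k),Q(l))$ and $t(\sum_kQ(k),\sum_kQ(k))$ exist, the series $s(Q(k),Q(l))$ converge absolutely, and $(*)$ holds. -/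

import Mathlib

noncomputable section

namespace SpinChain

open scoped ComplexOrder InnerProductSpace

/-! ### The UHF algebra of the chain

The algebra `⨂_{ℤ} M_d(ℂ)` (C*-completion) is realised as a concrete C*-algebra: the norm closed
unital *-algebra generated by the one-site matrices acting on the Hilbert space `ℓ²` over the set
of all configurations `ℤ → Fin d`.  The matrix `Q` at the site `j` acts on the coordinate `j` only.
The one-site maps are unital *-homomorphisms of `M_d(ℂ)` with commuting ranges (for distinct
sites); since finite tensor products of full matrix algebras are simple, the C*-algebra they
generate is the infinite C*-tensor product, up to isomorphism. -/

/-- Configurations of a basis label in `{0, …, d-1}` at every site. -/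
abbrev Config (d : ℕ) : Type := ℤ → Fin d

/-- The Hilbert space `ℓ²(Config d)`. -/
abbrev Hilb (d : ℕ) : Type := lp (fun _ : Config d => ℂ) 2

/-- A square summable function stays so after a permutation of the configurations. -/
theorem memℓp_comp_equiv {d : ℕ} (e : Config d ≃ Config d) (f : Hilb d) :
    Memℓp (fun ω => (f : Config d → ℂ) (e ω)) 2 := by
  have h := (lp.memℓp f).summable (by norm_num)
  exact memℓp_gen ((Equiv.summable_iff e).mpr h)

/-- The unitary operator `(U f)(ω) = f (e ω)` of a permutation `e` of the configurations. -/
def permIsometry {d : ℕ} (e : Config d ≃ Config d) : Hilb d ≃ₗᵢ[ℂ] Hilb d where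
  toFun f := ⟨fun ω => (f : Config d → ℂ) (e ω), memℓp_comp_equiv e f⟩
  invFun f := ⟨fun ω => (f : Config d → ℂ) (e.symm ω), memℓp_comp_equiv e.symm f⟩
  left_inv f := by
    apply lp.ext; funext ω
    change (f : Config d → ℂ) (e (e.symm ω)) = _
    simp
  right_inv f := by
    apply lp.ext; funext ω
    change (f : Config d → ℂ) (e.symm (e ω)) = _
    simp
  map_add' _ _ := rfl
  map_smul' _ _ := rfl
  norm_map' f := by
    have h2 : (0 : ℝ) < (2 : ENNReal).toReal := by norm_num
    rw [lp.norm_eq_tsum_rpow h2, lp.norm_eq_tsum_rpow h2]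
    congr 1
    exact Equiv.tsum_eq e (fun ω => ‖(f : Config d → ℂ) ω‖ ^ (2 : ENNReal).toReal)

@[simp] theorem permIsometry_apply {d : ℕ} (e : Config d ≃ Config d) (f : Hilb d) (ω : Config d) :
    (permIsometry e f : Config d → ℂ) ω = (f : Config d → ℂ) (e ω) := rfl

@[simp] theorem permIsometry_symm_apply {d : ℕ} (e : Config d ≃ Config d) (f : Hilb d)
    (ω : Config d) :
    ((permIsometry e).symm f : Config d → ℂ) ω = (f : Config d → ℂ) (e.symm ω) := rfl

/-- The permutation of the configurations that adds `c` (modulo `d`) at the site `j`. -/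
def rotate {d : ℕ} [NeZero d] (j : ℤ) (c : Fin d) : Config d ≃ Config d where
  toFun ω := Function.update ω j (ω j + c)
  invFun ω := Function.update ω j (ω j - c)
  left_inv ω := by simp
  right_inv ω := by simp

theorem memℓp_mul {d : ℕ} (j : ℤ) (q : Fin d → ℂ) (f : Hilb d) :
    Memℓp (fun ω : Config d => q (ω j) * (f : Config d → ℂ) ω) 2 := by
  have h : Memℓp (fun ω : Config d => (∑ a, ‖q a‖) * ‖(f : Config d → ℂ) ω‖) 2 :=
    (memℓp_norm_iff.mpr (lp.memℓp f)).const_mul (∑ a, ‖q a‖)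
  refine h.mono fun ω => ?_
  rw [norm_mul]
  exact mul_le_mul_of_nonneg_right
    (Finset.single_le_sum (f := fun a => ‖q a‖) (fun _ _ => norm_nonneg _) (Finset.mem_univ _))
    (norm_nonneg _)

/-- A sum over the value of the spin at `j` is a sum over the rotations at `j`. -/
theorem sum_update_eq {d : ℕ} [NeZero d] (j : ℤ) (g : Fin d → Config d → ℂ) (ω : Config d) :
    ∑ a, g a (Function.update ω j a) = ∑ c, g (ω j + c) (rotate j c ω) :=
  (Equiv.sum_comp (Equiv.addLeft (ω j)) fun a => g a (Function.update ω j a)).symm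

theorem memℓp_site {d : ℕ} [NeZero d] (j : ℤ) (Q : Matrix (Fin d) (Fin d) ℂ) (f : Hilb d) :
    Memℓp (fun ω : Config d => ∑ a, Q (ω j) a * (f : Config d → ℂ) (Function.update ω j a)) 2 := by
  have h : ∀ c ∈ (Finset.univ : Finset (Fin d)), Memℓp (fun ω : Config d =>
      Q (ω j) (ω j + c) * (f : Config d → ℂ) (rotate j c ω)) 2 := fun c _ =>
    memℓp_mul j (fun b => Q b (b + c)) (permIsometry (rotate j c) f)
  have h' := Memℓp.finsetSum Finset.univ h
  convert h' using 2 with ω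
  exact sum_update_eq j (fun a ω' => Q (ω j) a * (f : Config d → ℂ) ω') ω

/-- The linear map `(Q^{(j)} f)(ω) = ∑ₐ Q_{ω_j, a} f(ω with ω_j replaced by a)`. -/
def siteLin {d : ℕ} [NeZero d] (j : ℤ) (Q : Matrix (Fin d) (Fin d) ℂ) : Hilb d →ₗ[ℂ] Hilb d where
  toFun f := ⟨fun ω => ∑ a, Q (ω j) a * (f : Config d → ℂ) (Function.update ω j a),
    memℓp_site j Q f⟩
  map_add' f g := by
    apply lp.ext; funext ω
    change ∑ a, Q (ω j) a * ((f : Config d → ℂ) _ + (g : Config d → ℂ) _) =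
      (∑ a, Q (ω j) a * (f : Config d → ℂ) _) + ∑ a, Q (ω j) a * (g : Config d → ℂ) _
    simp only [mul_add, Finset.sum_add_distrib]
  map_smul' z f := by
    apply lp.ext; funext ω
    change ∑ a, Q (ω j) a * (z * (f : Config d → ℂ) _) =
      z * ∑ a, Q (ω j) a * (f : Config d → ℂ) _
    rw [Finset.mul_sum]
    exact Finset.sum_congr rfl fun a _ => by ring

theorem siteLin_apply {d : ℕ} [NeZero d] (j : ℤ) (Q : Matrix (Fin d) (Fin d) ℂ) (f : Hilb d)
    (ω : Config d) : (siteLin j Q f : Config d → ℂ) ω =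
      ∑ a, Q (ω j) a * (f : Config d → ℂ) (Function.update ω j a) := rfl

theorem continuous_eval {d : ℕ} (ω : Config d) :
    Continuous fun f : Hilb d => (f : Config d → ℂ) ω :=
  (lp.evalCLM ℂ (fun _ : Config d => ℂ) (p := 2) ω).continuous

theorem continuous_siteLin {d : ℕ} [NeZero d] (j : ℤ) (Q : Matrix (Fin d) (Fin d) ℂ) :
    Continuous (siteLin j Q) := by
  refine LinearMap.continuous_of_seq_closed_graph _ fun u x y hu hy => ?_
  apply lp.ext; funext ω
  have h1 := ((continuous_eval ω).tendsto y).comp hy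
  refine tendsto_nhds_unique h1 ?_
  rw [siteLin_apply]
  exact tendsto_finsetSum _ fun a _ => (((continuous_eval _).tendsto x).comp hu).const_mul _

/-- The operator `Q^{(j)}`: the matrix `Q` at the site `j`, the identity at all other sites. -/
def siteOp {d : ℕ} [NeZero d] (j : ℤ) (Q : Matrix (Fin d) (Fin d) ℂ) : Hilb d →L[ℂ] Hilb d :=
  ⟨siteLin j Q, continuous_siteLin j Q⟩

theorem siteOp_apply {d : ℕ} [NeZero d] (j : ℤ) (Q : Matrix (Fin d) (Fin d) ℂ) (f : Hilb d)
    (ω : Config d) : (siteOp j Q f : Config d → ℂ) ω =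
      ∑ a, Q (ω j) a * (f : Config d → ℂ) (Function.update ω j a) := rfl

theorem siteOp_one {d : ℕ} [NeZero d] (j : ℤ) :
    siteOp j (1 : Matrix (Fin d) (Fin d) ℂ) = 1 := by
  ext f ω
  simp [siteOp_apply, Matrix.one_apply]

theorem siteOp_mul {d : ℕ} [NeZero d] (j : ℤ) (Q R : Matrix (Fin d) (Fin d) ℂ) :
    siteOp j (Q * R) = siteOp j Q * siteOp j R := by
  ext f ω
  simp only [mul_apply_eq_comp, siteOp_apply, Matrix.mul_apply, Finset.sum_mul,
    Finset.mul_sum, Function.update_self, Function.update_idem]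
  rw [Finset.sum_comm]
  simp only [mul_assoc]

/-- Matrices at distinct sites commute. -/
theorem siteOp_comm {d : ℕ} [NeZero d] {j k : ℤ} (hjk : j ≠ k) (Q R : Matrix (Fin d) (Fin d) ℂ) :
    siteOp j Q * siteOp k R = siteOp k R * siteOp j Q := by
  ext f ω
  simp only [mul_apply_eq_comp, siteOp_apply, Finset.mul_sum]
  rw [Finset.sum_comm]
  refine Finset.sum_congr rfl fun a _ => Finset.sum_congr rfl fun b _ => ?_
  rw [Function.update_of_ne hjk.symm, Function.update_of_ne hjk, Function.update_comm hjk]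
  ring

theorem siteOp_star {d : ℕ} [NeZero d] (j : ℤ) (Q : Matrix (Fin d) (Fin d) ℂ) :
    siteOp j (star Q) = star (siteOp j Q) := by
  rw [ContinuousLinearMap.star_eq_adjoint, ContinuousLinearMap.eq_adjoint_iff]
  intro f g
  have key : ∀ c : Fin d,
      HasSum (fun ω => (starRingEnd ℂ) ((f : Config d → ℂ) ω) *
        (Q (ω j) (ω j + c) * (g : Config d → ℂ) (rotate j c ω)))
      ⟪f, (⟨_, memℓp_mul j (fun b => Q b (b + c)) (permIsometry (rotate j c) g)⟩ : Hilb d)⟫_ℂ := by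
    intro c
    have := lp.hasSum_inner (𝕜 := ℂ) f
      (⟨_, memℓp_mul j (fun b => Q b (b + c)) (permIsometry (rotate j c) g)⟩ : Hilb d)
    simpa [RCLike.inner_apply, mul_comm] using this
  have hR := hasSum_sum fun c (_ : c ∈ (Finset.univ : Finset (Fin d))) => key c
  have hR' := lp.hasSum_inner (𝕜 := ℂ) f (siteOp j Q g)
  have hL' := lp.hasSum_inner (𝕜 := ℂ) (siteOp j (star Q) f) g
  have hL := hasSum_sum fun c (_ : c ∈ (Finset.univ : Finset (Fin d))) =>
    (Equiv.hasSum_iff (rotate j (-c))).mpr (key c)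
  have e1 : ⟪f, siteOp j Q g⟫_ℂ = ∑ c, ⟪f, (⟨_, memℓp_mul j (fun b => Q b (b + c))
      (permIsometry (rotate j c) g)⟩ : Hilb d)⟫_ℂ := by
    refine hR'.unique (hR.congr_fun ?_)
    intro ω
    rw [RCLike.inner_apply', siteOp_apply, Finset.mul_sum]
    exact sum_update_eq j
      (fun a ω' => (starRingEnd ℂ) ((f : Config d → ℂ) ω) * (Q (ω j) a * (g : Config d → ℂ) ω')) ω
  rw [e1]
  refine hL'.unique (hL.congr_fun ?_)
  intro ω
  rw [RCLike.inner_apply', siteOp_apply, map_sum, Finset.sum_mul]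
  rw [sum_update_eq j (fun a ω' => (starRingEnd ℂ) (star Q (ω j) a * (f : Config d → ℂ) ω') *
    (g : Config d → ℂ) ω) ω]
  rw [← Equiv.sum_comp (Equiv.neg (Fin d))]
  refine Finset.sum_congr rfl fun c _ => ?_
  simp [rotate, Matrix.star_apply]
  ring

/-- The concrete C*-algebra generated by the matrices at all sites. -/
def uhfSubalgebra (d : ℕ) [NeZero d] : StarSubalgebra ℂ (Hilb d →L[ℂ] Hilb d) :=
  (StarAlgebra.adjoin ℂ
    {T | ∃ (j : ℤ) (Q : Matrix (Fin d) (Fin d) ℂ), T = siteOp j Q}).topologicalClosure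

/-- The UHF algebra `𝒜 = ⨂_ℤ M_d(ℂ)`. -/
def UHF (d : ℕ) [NeZero d] : Type := ↥(uhfSubalgebra d)

instance (d : ℕ) [NeZero d] : IsClosed (uhfSubalgebra d : Set (Hilb d →L[ℂ] Hilb d)) :=
  StarSubalgebra.isClosed_topologicalClosure _

instance (d : ℕ) [NeZero d] : CStarAlgebra (UHF d) :=
  inferInstanceAs (CStarAlgebra ↥(uhfSubalgebra d))

/-- The inclusion of the UHF algebra into the bounded operators on `ℓ²(Config d)`. -/
def UHF.incl (d : ℕ) [NeZero d] : UHF d →⋆ₐ[ℂ] (Hilb d →L[ℂ] Hilb d) :=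
  (uhfSubalgebra d).subtype

theorem siteOp_mem {d : ℕ} [NeZero d] (j : ℤ) (Q : Matrix (Fin d) (Fin d) ℂ) :
    siteOp j Q ∈ uhfSubalgebra d :=
  StarSubalgebra.le_topologicalClosure _ (StarAlgebra.subset_adjoin ℂ _ ⟨j, Q, rfl⟩)

/-- The embedding `Q ↦ Q^{(j)}` of the matrix algebra at the site `j`. -/
def site {d : ℕ} [NeZero d] (j : ℤ) : Matrix (Fin d) (Fin d) ℂ →⋆ₐ[ℂ] UHF d where
  toFun Q := ⟨siteOp j Q, siteOp_mem j Q⟩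
  map_one' := Subtype.ext (siteOp_one j)
  map_mul' Q R := Subtype.ext (siteOp_mul j Q R)
  map_zero' := by
    apply Subtype.ext
    change siteOp j 0 = 0
    ext f ω
    simp [siteOp_apply]
  map_add' Q R := by
    apply Subtype.ext
    change siteOp j (Q + R) = siteOp j Q + siteOp j R
    ext f ω
    simp [siteOp_apply, add_mul, Finset.sum_add_distrib]
  commutes' z := by
    apply Subtype.ext
    change siteOp j (algebraMap ℂ _ z) = algebraMap ℂ (Hilb d →L[ℂ] Hilb d) z
    ext f ω
    simp [siteOp_apply, Algebra.algebraMap_eq_smul_one, Matrix.one_apply]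
  map_star' Q := Subtype.ext (siteOp_star j Q)

/-- `𝒜_Λ`: the C*-subalgebra generated by the matrices at the sites of `Λ ⊆ ℤ`. -/
def localAlg (d : ℕ) [NeZero d] (Λ : Set ℤ) : StarSubalgebra ℂ (UHF d) :=
  (StarAlgebra.adjoin ℂ
    {T | ∃ j ∈ Λ, ∃ Q : Matrix (Fin d) (Fin d) ℂ, T = site j Q}).topologicalClosure

/-- `Q` is strictly local: it lies in `𝒜_loc = ⋃ 𝒜_Λ` over the finite sets `Λ ⊆ ℤ`. -/
def IsStrictlyLocal {d : ℕ} [NeZero d] (Q : UHF d) : Prop :=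
  ∃ Λ : Set ℤ, Λ.Finite ∧ Q ∈ localAlg d Λ

/-! ### Lattice translations -/

/-- The permutation `ω ↦ ω(· + j)` of the configurations. -/
def shiftConfig (d : ℕ) (j : ℤ) : Config d ≃ Config d where
  toFun ω := fun k => ω (k + j)
  invFun ω := fun k => ω (k - j)
  left_inv ω := by simp
  right_inv ω := by simp

/-- Conjugation by the unitary that implements the shift, on all bounded operators. -/
def shiftAut (d : ℕ) (j : ℤ) :
    (Hilb d →L[ℂ] Hilb d) ≃⋆ₐ[ℂ] (Hilb d →L[ℂ] Hilb d) :=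
  (permIsometry (shiftConfig d j)).conjStarAlgEquiv

theorem shiftAut_apply {d : ℕ} (j : ℤ) (T : Hilb d →L[ℂ] Hilb d) (f : Hilb d) :
    shiftAut d j T f = permIsometry (shiftConfig d j)
      (T ((permIsometry (shiftConfig d j)).symm f)) := rfl

theorem shiftAut_siteOp {d : ℕ} [NeZero d] (j k : ℤ) (Q : Matrix (Fin d) (Fin d) ℂ) :
    shiftAut d j (siteOp k Q) = siteOp (j + k) Q := by
  ext f ω
  rw [shiftAut_apply, permIsometry_apply, siteOp_apply, siteOp_apply]
  refine Finset.sum_congr rfl fun a _ => ?_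
  rw [permIsometry_symm_apply]
  have h : (shiftConfig d j).symm (Function.update (shiftConfig d j ω) k a) =
      Function.update ω (j + k) a := by
    funext i
    by_cases hi : i = j + k
    · subst hi; simp [shiftConfig]
    · have : i - j ≠ k := fun h => hi (by omega)
      simp [shiftConfig, Function.update_of_ne hi, Function.update_of_ne this]
  rw [h]
  simp [shiftConfig, add_comm]

theorem continuous_shiftAut (d : ℕ) (j : ℤ) : Continuous (shiftAut d j) := by
  change Continuous fun T : Hilb d →L[ℂ] Hilb d =>
    ((permIsometry (shiftConfig d j)).toContinuousLinearEquiv : Hilb d →L[ℂ] Hilb d) ∘L (T ∘L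
      ((permIsometry (shiftConfig d j)).symm.toContinuousLinearEquiv : Hilb d →L[ℂ] Hilb d))
  fun_prop

theorem shiftAut_mem {d : ℕ} [NeZero d] (j : ℤ) {T : Hilb d →L[ℂ] Hilb d}
    (hT : T ∈ uhfSubalgebra d) : shiftAut d j T ∈ uhfSubalgebra d := by
  have hcl : IsClosed ((uhfSubalgebra d).comap (shiftAut d j).toStarAlgHom :
      Set (Hilb d →L[ℂ] Hilb d)) :=
    (StarSubalgebra.isClosed_topologicalClosure _).preimage (continuous_shiftAut d j)
  refine StarSubalgebra.topologicalClosure_minimal (StarAlgebra.adjoin_le ?_) hcl hT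
  rintro _ ⟨k, Q, rfl⟩
  change shiftAut d j (siteOp k Q) ∈ uhfSubalgebra d
  rw [shiftAut_siteOp]
  exact siteOp_mem _ _

/-- The lattice translation `τ_j` (`j` steps to the right) of the UHF algebra. -/
def translate {d : ℕ} [NeZero d] (j : ℤ) : UHF d →⋆ₐ[ℂ] UHF d :=
  StarAlgHom.codRestrict ((shiftAut d j).toStarAlgHom.comp (UHF.incl d)) (uhfSubalgebra d)
    fun T => shiftAut_mem j T.2

theorem translate_site {d : ℕ} [NeZero d] (j k : ℤ) (Q : Matrix (Fin d) (Fin d) ℂ) :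
    translate j (site k Q) = site (j + k) Q :=
  Subtype.ext (shiftAut_siteOp j k Q)

/-! ### Exponentially localized observables -/

/-- `‖Q‖^{(n)}`: the distance of `Q` from `𝒜_{[-n,n]}` for `n > 0`, and `‖Q‖` for `n = 0`. -/
def tailNorm {d : ℕ} [NeZero d] (n : ℕ) (Q : UHF d) : ℝ :=
  if n = 0 then ‖Q‖
  else sInf {x : ℝ | ∃ R ∈ localAlg d (Set.Icc (-(n : ℤ)) n), x = ‖Q - R‖}

/-- `Q ∈ F_θ`: the series `∑ₙ ‖Q‖^{(n)} θ^{-n}` of nonnegative terms is finite. -/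
def IsExpLocalized {d : ℕ} [NeZero d] (θ : ℝ) (Q : UHF d) : Prop :=
  Summable fun n : ℕ => tailNorm n Q * (θ ^ n)⁻¹

/-! ### States and clustering -/

/-- A state: a positive linear functional with `φ(1) = 1`. -/
structure IsState {d : ℕ} [NeZero d] (φ : UHF d →ₗ[ℂ] ℂ) : Prop where
  nonneg : ∀ Q : UHF d, 0 ≤ φ (star Q * Q)
  map_one : φ 1 = 1

def IsTranslationInvariant {d : ℕ} [NeZero d] (φ : UHF d →ₗ[ℂ] ℂ) : Prop :=
  ∀ (j : ℤ) (Q : UHF d), φ (translate j Q) = φ Q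

/-- `|φ(Q₁ τ_j(Q₂)) - φ(Q₁) φ(Q₂)| ≤ ρ(j) ‖Q₁‖ ‖Q₂‖` for `Q₁` in the left half-line algebra
`𝒜_{(-∞,-1]}`, `Q₂` in the right half-line algebra `𝒜_{[0,∞)}` and every `j > 0`. -/
def HalfLineClustering {d : ℕ} [NeZero d] (φ : UHF d →ₗ[ℂ] ℂ) (ρ : ℕ → ℝ) : Prop :=
  ∀ j : ℕ, 0 < j → ∀ Q₁ ∈ localAlg d (Set.Iic (-1)), ∀ Q₂ ∈ localAlg d (Set.Ici 0),
    ‖φ (Q₁ * translate (j : ℤ) Q₂) - φ Q₁ * φ Q₂‖ ≤ ρ j * ‖Q₁‖ * ‖Q₂‖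

/-! ### Fluctuations -/

/-- The local fluctuation `Q_{<N>} = (2N+1)^{-1/2} ∑_{|j| ≤ N} (τ_j(Q) - φ(Q))`. -/
def fluct {d : ℕ} [NeZero d] (φ : UHF d →ₗ[ℂ] ℂ) (N : ℕ) (Q : UHF d) : UHF d :=
  ((1 / Real.sqrt (2 * N + 1) : ℝ) : ℂ) •
    ∑ j ∈ Finset.Icc (-(N : ℤ)) N, (translate j Q - algebraMap ℂ (UHF d) (φ Q))

/-- `t(Q,R) = lim_N φ(Q_{<N>} R_{<N>})`. -/
def tForm {d : ℕ} [NeZero d] (φ : UHF d →ₗ[ℂ] ℂ) (Q R : UHF d) : ℂ :=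
  Filter.limUnder Filter.atTop fun N : ℕ => φ (fluct φ N Q * fluct φ N R)

/-- `t(Q,R)` is well defined: the limit exists. -/
def TFormExists {d : ℕ} [NeZero d] (φ : UHF d →ₗ[ℂ] ℂ) (Q R : UHF d) : Prop :=
  ∃ z : ℂ, Filter.Tendsto (fun N : ℕ => φ (fluct φ N Q * fluct φ N R)) Filter.atTop (nhds z)

/-- The term `φ([τ_k(Q), R])`. -/
def commTerm {d : ℕ} [NeZero d] (φ : UHF d →ₗ[ℂ] ℂ) (Q R : UHF d) (k : ℤ) : ℂ :=
  φ (translate k Q * R - R * translate k Q)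

/-- `s(Q,R) = -i ∑_{k ∈ ℤ} φ([τ_k(Q), R])`, a real number for self-adjoint `Q`, `R`. -/
def sForm {d : ℕ} [NeZero d] (φ : UHF d →ₗ[ℂ] ℂ) (Q R : UHF d) : ℂ :=
  -Complex.I * ∑' k : ℤ, commTerm φ Q R k

/-- The central limit theorem holds for `Q` and `φ`: the variance `t(Q,Q)` exists and
`lim_N φ(exp(i T Q_{<N>})) = exp(-(T²/2) t(Q,Q))` for every real `T`. -/
def CLTHolds {d : ℕ} [NeZero d] (φ : UHF d →ₗ[ℂ] ℂ) (Q : UHF d) : Prop :=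
  TFormExists φ Q Q ∧ ∀ T : ℝ,
    Filter.Tendsto (fun N : ℕ => φ (NormedSpace.exp ((Complex.I * T) • fluct φ N Q)))
      Filter.atTop (nhds (Complex.exp (-((T : ℂ) ^ 2 / 2) * tForm φ Q Q)))

/-- Convergence of the correlation functions of the family `Q(1), …, Q(r)`: the forms `t` and `s`
are well defined on the family and
`lim_N φ(e^{i Q(1)_{<N>}} ⋯ e^{i Q(r)_{<N>}})
  = exp(-½ t(∑ₖ Q(k), ∑ₖ Q(k))) exp(-(i/2) ∑_{k<l} s(Q(k), Q(l)))`. -/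
def CorrelationsConverge {d : ℕ} [NeZero d] (φ : UHF d →ₗ[ℂ] ℂ) {r : ℕ} (Q : Fin r → UHF d) :
    Prop :=
  (∀ k l, TFormExists φ (Q k) (Q l)) ∧ TFormExists φ (∑ k, Q k) (∑ k, Q k) ∧
  (∀ k l, Summable (commTerm φ (Q k) (Q l))) ∧
  Filter.Tendsto
    (fun N : ℕ => φ (List.ofFn fun k => NormedSpace.exp (Complex.I • fluct φ N (Q k))).prod)
    Filter.atTop
    (nhds (Complex.exp (-(1 / 2) * tForm φ (∑ k, Q k) (∑ k, Q k)) *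
      Complex.exp (-(Complex.I / 2) * ∑ l, ∑ k ∈ Finset.Iio l, sForm φ (Q k) (Q l))))

end SpinChain

end

open SpinChain

noncomputable section

namespace SpinChain

open scoped ComplexOrder InnerProductSpace
open Filter Topology

/-! The proof combines Stein's method for a noncommuting field with a Baker–Campbell–Hausdorff
argument. Errors are measured in the GNS seminorm `stateNorm`, which dominates `|φ(a)|`, is
unchanged by left multiplication with a unitary, and grows under right multiplication by at most the
norm of a commutator.

The two factors `1/√(2N+1)` in a product of fluctuations cancel one sum over sites. Hence seminorms
of fluctuations and norms of their commutators are bounded, uniformly in `N`, by sums over `ℤ` of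
correlations and of commutators. Both sums are dominated for elements approximable by `𝒜_{[-m,m]}`
with a summable rate (`IsApproximable`). Strictly local elements and elements of `F_θ` are of this
kind, and exponential decay has a finite first moment, so both parts of the theorem follow from
`IntervalClustering.correlationsConverge`.

For one centred local `Q` and `X = Q_{⟨N⟩}`, put `f(t) = φ(e^{itX})`, so that `f' = iφ(X e^{itX})`.
At each site `j` the terms of `X` within distance `l` of `j` are split off. The exponential of the
rest factors into a left and a right unitary, and the exponential of the near part is expanded to
first order. By clustering the zeroth order nearly vanishes, while the first order gives covariances
times `f(t)`. Thus `f' ≈ -tσf` with `σ` the variance at finite volume, and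
`norm_sub_exp_le_of_hasDerivAt` yields the Gaussian. The window must satisfy `l² ≪ √N` and `√N ρ(l)
≪ 1`. This is possible since `l²ρ(l) → 0` (`IntervalClustering.tendsto_sq_mul`), a consequence of
monotonicity and the finite first moment. Duhamel's formula extends the result from local to
approximable elements.

For products, the commutator of two fluctuations of local elements is an average over sites. By the
law of large numbers it is close to its expectation `c`, and it nearly commutes with every
fluctuation. So `e^{iX}e^{iY}` is close to `e^{-c/2}e^{i(X+Y)}`
(`IsNormalizedPositive.stateNorm_expI_mul_expI_sub_le`), where `c` tends to `i s`. Induction on the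
number of factors reduces the correlation function to the central limit theorem for the sum. -/

/-! ### The exponentials `e^{iX}` -/

section Exponential

variable {A : Type*} [CStarAlgebra A]

/-- The exponential `e^{iX}`. -/
def expI (X : A) : A := NormedSpace.exp (Complex.I • X)

theorem expI_zero : expI (0 : A) = 1 := by simp [expI, NormedSpace.exp_zero]

theorem expI_mem_unitary {X : A} (hX : IsSelfAdjoint X) : expI X ∈ unitary A :=
  (selfAdjoint.expUnitary (⟨X, hX⟩ : selfAdjoint A)).2

theorem isSelfAdjoint_ofReal_smul (t : ℝ) {X : A} (hX : IsSelfAdjoint X) :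
    IsSelfAdjoint ((t : ℂ) • X) :=
  IsSelfAdjoint.smul (by simp [IsSelfAdjoint]) hX

theorem expI_add_of_commute {X Y : A} (h : Commute X Y) : expI (X + Y) = expI X * expI Y := by
  let +nondep : NormedAlgebra ℚ A := .restrictScalars ℚ ℂ A
  rw [expI, smul_add]
  exact NormedSpace.exp_add_of_commute ((h.smul_left _).smul_right _)

theorem expI_neg_mul (X : A) : expI (-X) * expI X = 1 := by
  rw [← expI_add_of_commute (Commute.refl X).neg_left]; simp [expI_zero]

theorem expI_mul_neg (X : A) : expI X * expI (-X) = 1 := by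
  rw [← expI_add_of_commute (Commute.refl X).neg_right]; simp [expI_zero]

theorem hasDerivAt_expI_smul (X : A) (t : ℝ) :
    HasDerivAt (fun t : ℝ => expI ((t : ℂ) • X)) (Complex.I • (expI ((t : ℂ) • X) * X)) t := by
  have h := hasDerivAt_exp_smul_const (𝕂 := ℝ) (Complex.I • X) t
  simp only [← Complex.coe_smul] at h
  simp only [expI, smul_comm Complex.I, ← mul_smul_comm]
  exact h

theorem hasDerivAt_expI_smul' (X : A) (t : ℝ) :
    HasDerivAt (fun t : ℝ => expI ((t : ℂ) • X)) (Complex.I • (X * expI ((t : ℂ) • X))) t := by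
  have h := hasDerivAt_expI_smul X t
  have hc : Commute X (expI ((t : ℂ) • X)) :=
    (((Commute.refl X).smul_right (t : ℂ)).smul_right Complex.I).exp_right
  rwa [hc.eq]

theorem hasDerivAt_expI_neg_smul (X : A) (t : ℝ) :
    HasDerivAt (fun t : ℝ => expI (-((t : ℂ) • X)))
      (-(Complex.I • (expI (-((t : ℂ) • X)) * X))) t := by
  have h := hasDerivAt_expI_smul (-X) t
  simpa only [smul_neg, mul_neg] using h

theorem norm_mul_unitary {U : A} (hU : U ∈ unitary A) (a : A) : ‖a * U‖ = ‖a‖ :=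
  CStarRing.norm_mul_coe_unitary a ⟨U, hU⟩

theorem norm_unitary_mul {U : A} (hU : U ∈ unitary A) (a : A) : ‖U * a‖ = ‖a‖ :=
  CStarRing.norm_coe_unitary_mul ⟨U, hU⟩ a

/-- The mean value inequality on `[0,1]`. -/
theorem norm_sub_le_of_hasDerivAt {E : Type*} [NormedAddCommGroup E] [NormedSpace ℝ E]
    {F F' : ℝ → E} {C : ℝ} (hF : ∀ t, HasDerivAt F (F' t) t)
    (hC : ∀ t, 0 ≤ t → t ≤ 1 → ‖F' t‖ ≤ C) : ‖F 1 - F 0‖ ≤ C :=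
  norm_image_sub_le_of_norm_deriv_le_segment_01' (fun t _ => (hF t).hasDerivWithinAt)
    fun t ht => hC t ht.1 ht.2.le

/-- Along `t ↦ e^{-itY} X e^{itY}` the derivative is `i` times a unitary conjugate of `[X,Y]`, so
its norm is constant. The path leads from `X` to its conjugate by `e^{iY}`. -/
theorem norm_comm_expI_le (X : A) {Y : A} (hY : IsSelfAdjoint Y) :
    ‖X * expI Y - expI Y * X‖ ≤ ‖X * Y - Y * X‖ := by
  have hd : ∀ t : ℝ, HasDerivAt (fun t : ℝ => expI (-((t : ℂ) • Y)) * X * expI ((t : ℂ) • Y))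
      (Complex.I • (expI (-((t : ℂ) • Y)) * (X * Y - Y * X) * expI ((t : ℂ) • Y))) t := by
    intro t
    refine (((hasDerivAt_expI_neg_smul Y t).mul_const X).mul
      (hasDerivAt_expI_smul' Y t)).congr_deriv ?_
    simp only [mul_sub, sub_mul, smul_sub, neg_mul, smul_mul_assoc, mul_smul_comm, mul_assoc]
    abel
  have h := norm_sub_le_of_hasDerivAt (C := ‖X * Y - Y * X‖) hd fun t _ _ => by
    have ht := isSelfAdjoint_ofReal_smul t hY
    rw [norm_smul, Complex.norm_I, one_mul, norm_mul_unitary (expI_mem_unitary ht),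
      norm_unitary_mul (expI_mem_unitary ht.neg)]
  simp only [Complex.ofReal_one, Complex.ofReal_zero, one_smul, zero_smul, neg_zero, expI_zero,
    one_mul, mul_one] at h
  have e : expI (-Y) * (X * expI Y - expI Y * X) = expI (-Y) * X * expI Y - X := by
    rw [mul_sub, ← mul_assoc, ← mul_assoc, expI_neg_mul, one_mul]
  rw [← norm_unitary_mul (expI_mem_unitary hY.neg), e]
  exact h

theorem norm_comm_expI_smul_le (X : A) {Y : A} (hY : IsSelfAdjoint Y) {t : ℝ} (h0 : 0 ≤ t)
    (h1 : t ≤ 1) : ‖X * expI ((t : ℂ) • Y) - expI ((t : ℂ) • Y) * X‖ ≤ ‖X * Y - Y * X‖ := by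
  refine (norm_comm_expI_le X (isSelfAdjoint_ofReal_smul t hY)).trans ?_
  rw [mul_smul_comm, smul_mul_assoc, ← smul_sub, norm_smul, Complex.norm_real, Real.norm_eq_abs,
    abs_of_nonneg h0]
  exact mul_le_of_le_one_left (norm_nonneg _) h1

/-- `e^{i(Y+Z)}` is close to `e^{iY} e^{iZ}` if the commutator `[Y,Z]` is small. -/
theorem norm_expI_add_sub_le {Y Z : A} (hY : IsSelfAdjoint Y) (hZ : IsSelfAdjoint Z) :
    ‖expI (Y + Z) - expI Y * expI Z‖ ≤ ‖Z * Y - Y * Z‖ := by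
  have hd : ∀ t : ℝ, HasDerivAt
      (fun t : ℝ => expI (-((t : ℂ) • (Y + Z))) * expI ((t : ℂ) • Y) * expI ((t : ℂ) • Z))
      (Complex.I • (expI (-((t : ℂ) • (Y + Z))) *
        (expI ((t : ℂ) • Y) * Z - Z * expI ((t : ℂ) • Y)) * expI ((t : ℂ) • Z))) t := by
    intro t
    refine (((hasDerivAt_expI_neg_smul (Y + Z) t).mul (hasDerivAt_expI_smul' Y t)).mul
      (hasDerivAt_expI_smul' Z t)).congr_deriv ?_
    simp only [Pi.mul_apply, mul_sub, sub_mul, smul_sub, neg_mul, smul_mul_assoc, mul_smul_comm, mul_assoc,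
      add_mul, mul_add, smul_add]
    abel
  have h := norm_sub_le_of_hasDerivAt (C := ‖Z * Y - Y * Z‖) hd fun t h0 h1 => by
    rw [norm_smul, Complex.norm_I, one_mul,
      norm_mul_unitary (expI_mem_unitary (isSelfAdjoint_ofReal_smul t hZ)),
      norm_unitary_mul (expI_mem_unitary (isSelfAdjoint_ofReal_smul t (hY.add hZ)).neg),
      norm_sub_rev]
    exact norm_comm_expI_smul_le Z hY h0 h1
  simp only [Complex.ofReal_one, Complex.ofReal_zero, one_smul, zero_smul, neg_zero, expI_zero,
    mul_one] at h
  have e : expI (-(Y + Z)) * (expI Y * expI Z - expI (Y + Z)) =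
      expI (-(Y + Z)) * expI Y * expI Z - 1 := by rw [mul_sub, expI_neg_mul, mul_assoc]
  rw [norm_sub_rev, ← norm_unitary_mul (expI_mem_unitary (hY.add hZ).neg), e]
  exact h

theorem norm_expI_sub_one_le {Y : A} (hY : IsSelfAdjoint Y) : ‖expI Y - 1‖ ≤ ‖Y‖ := by
  have h := norm_sub_le_of_hasDerivAt (C := ‖Y‖) (hasDerivAt_expI_smul Y) fun t _ _ => by
    rw [norm_smul, Complex.norm_I, one_mul,
      norm_unitary_mul (expI_mem_unitary (isSelfAdjoint_ofReal_smul t hY))]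
  simpa only [Complex.ofReal_one, Complex.ofReal_zero, one_smul, zero_smul, expI_zero] using h

/-- Second order Taylor remainder. The derivative of the remainder along `tY` is controlled by the
first order bound; the factor `1/2` that integrating in `t` would give is not needed. -/
theorem norm_expI_sub_one_sub_le {Y : A} (hY : IsSelfAdjoint Y) :
    ‖expI Y - 1 - Complex.I • Y‖ ≤ ‖Y‖ ^ 2 := by
  have hd : ∀ t : ℝ, HasDerivAt (fun t : ℝ => expI ((t : ℂ) • Y) - (t : ℂ) • Complex.I • Y)
      (Complex.I • ((expI ((t : ℂ) • Y) - 1) * Y)) t := by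
    intro t
    refine ((hasDerivAt_expI_smul Y t).sub
      (Complex.ofRealCLM.hasDerivAt.smul_const (Complex.I • Y))).congr_deriv ?_
    simp [sub_mul, smul_sub]
  have h := norm_sub_le_of_hasDerivAt (C := ‖Y‖ ^ 2) hd fun t h0 h1 => by
    rw [norm_smul, Complex.norm_I, one_mul, sq]
    refine (norm_mul_le _ _).trans (mul_le_mul_of_nonneg_right ?_ (norm_nonneg _))
    refine (norm_expI_sub_one_le (isSelfAdjoint_ofReal_smul t hY)).trans ?_
    rw [norm_smul, Complex.norm_real, Real.norm_eq_abs, abs_of_nonneg h0]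
    exact mul_le_of_le_one_left (norm_nonneg _) h1
  simp only [Complex.ofReal_one, Complex.ofReal_zero, one_smul, zero_smul, expI_zero,
    sub_zero] at h
  rwa [sub_right_comm] at h

end Exponential

/-! ### The seminorm of a state -/

section StateNorm

variable {A : Type*} [CStarAlgebra A]

/-- A positive linear functional with value `1` at the unit. -/
structure IsNormalizedPositive (φ : A →ₗ[ℂ] ℂ) : Prop where
  nonneg : ∀ a : A, 0 ≤ φ (star a * a)
  map_one : φ 1 = 1

/-- The GNS seminorm `√φ(a* a)`. -/
def stateNorm (φ : A →ₗ[ℂ] ℂ) (a : A) : ℝ := √(φ (star a * a)).re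

variable {φ : A →ₗ[ℂ] ℂ}

theorem stateNorm_nonneg (φ : A →ₗ[ℂ] ℂ) (a : A) : 0 ≤ stateNorm φ a := Real.sqrt_nonneg _

/-- The spectral order is introduced only within proofs, to make the pre-GNS inner product, with its
Cauchy–Schwarz and triangle inequalities, available for `stateNorm`. -/
theorem exists_positiveLinearMap (hφ : IsNormalizedPositive φ) :
    letI := CStarAlgebra.spectralOrder A
    letI := CStarAlgebra.spectralOrderedRing A
    ∃ f : A →ₚ[ℂ] ℂ, ∀ a, f a = φ a := by
  let := CStarAlgebra.spectralOrder A
  let := CStarAlgebra.spectralOrderedRing A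
  refine ⟨PositiveLinearMap.mk₀ φ fun a ha => ?_, fun a => rfl⟩
  obtain ⟨b, rfl⟩ := CStarAlgebra.nonneg_iff_eq_star_mul_self.mp ha
  exact hφ.nonneg b

namespace IsNormalizedPositive

theorem stateNorm_sq (hφ : IsNormalizedPositive φ) (a : A) :
    ((stateNorm φ a ^ 2 : ℝ) : ℂ) = φ (star a * a) := by
  have h := hφ.nonneg a
  rw [stateNorm, Real.sq_sqrt (Complex.nonneg_iff.mp h).1]
  exact Complex.ext rfl (Complex.nonneg_iff.mp h).2

theorem apply_star (hφ : IsNormalizedPositive φ) (a : A) : φ (star a) = star (φ a) := by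
  let := CStarAlgebra.spectralOrder A
  let := CStarAlgebra.spectralOrderedRing A
  obtain ⟨f, hf⟩ := exists_positiveLinearMap hφ
  rw [← hf, ← hf]
  exact StarHomClass.map_star f a

theorem stateNorm_add_le (hφ : IsNormalizedPositive φ) (a b : A) :
    stateNorm φ (a + b) ≤ stateNorm φ a + stateNorm φ b := by
  let := CStarAlgebra.spectralOrder A
  let := CStarAlgebra.spectralOrderedRing A
  obtain ⟨f, hf⟩ := exists_positiveLinearMap hφ
  have key : ∀ a, stateNorm φ a = ‖f.toPreGNS a‖ := fun a => by
    rw [f.preGNS_norm_def, stateNorm, hf]; rfl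
  rw [key, key, key, map_add]
  exact norm_add_le _ _

theorem norm_map_star_mul_le (hφ : IsNormalizedPositive φ) (a b : A) :
    ‖φ (star a * b)‖ ≤ stateNorm φ a * stateNorm φ b := by
  let := CStarAlgebra.spectralOrder A
  let := CStarAlgebra.spectralOrderedRing A
  obtain ⟨f, hf⟩ := exists_positiveLinearMap hφ
  have key : ∀ a, stateNorm φ a = ‖f.toPreGNS a‖ := fun a => by
    rw [f.preGNS_norm_def, stateNorm, hf]; rfl
  rw [key, key, ← hf]
  exact norm_inner_le_norm (𝕜 := ℂ) (f.toPreGNS a) (f.toPreGNS b)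

theorem stateNorm_one (hφ : IsNormalizedPositive φ) : stateNorm φ 1 = 1 := by
  simp [stateNorm, hφ.map_one]

theorem norm_map_le_stateNorm (hφ : IsNormalizedPositive φ) (a : A) :
    ‖φ a‖ ≤ stateNorm φ a := by
  simpa [hφ.stateNorm_one] using hφ.norm_map_star_mul_le 1 a

theorem nontrivial (hφ : IsNormalizedPositive φ) : Nontrivial A :=
  ⟨1, 0, fun h => by have := hφ.map_one; rw [h, _root_.map_zero] at this; exact zero_ne_one this⟩

theorem norm_map_le (hφ : IsNormalizedPositive φ) (a : A) : ‖φ a‖ ≤ ‖a‖ := by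
  let := CStarAlgebra.spectralOrder A
  let := CStarAlgebra.spectralOrderedRing A
  have := hφ.nontrivial
  obtain ⟨f, hf⟩ := exists_positiveLinearMap hφ
  have h1 := hφ.norm_map_le_stateNorm a
  have h2 := f.norm_apply_le_of_nonneg (star a * a) (star_mul_self_nonneg a)
  rw [hf, hf, hφ.map_one, norm_one, one_mul, CStarRing.norm_star_mul_self, ← hφ.stateNorm_sq,
    Complex.norm_real, Real.norm_eq_abs, abs_of_nonneg (sq_nonneg _)] at h2
  exact h1.trans (abs_le_of_sq_le_sq' (by nlinarith) (norm_nonneg _)).2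

theorem stateNorm_le_norm (hφ : IsNormalizedPositive φ) (a : A) : stateNorm φ a ≤ ‖a‖ := by
  have h := hφ.norm_map_le (star a * a)
  rw [← hφ.stateNorm_sq, CStarRing.norm_star_mul_self, Complex.norm_real, Real.norm_eq_abs,
    abs_of_nonneg (sq_nonneg _)] at h
  exact (abs_le_of_sq_le_sq' (by nlinarith) (norm_nonneg _)).2

end IsNormalizedPositive

theorem stateNorm_smul (φ : A →ₗ[ℂ] ℂ) (z : ℂ) (a : A) :
    stateNorm φ (z • a) = ‖z‖ * stateNorm φ a := by
  have : star (z • a) * (z • a) = ((‖z‖ ^ 2 : ℝ) : ℂ) • (star a * a) := by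
    rw [star_smul, smul_mul_smul_comm]
    congr 1
    rw [Complex.star_def, ← Complex.normSq_eq_conj_mul_self, Complex.normSq_eq_norm_sq]
  rw [stateNorm, this, map_smul, smul_eq_mul, Complex.re_ofReal_mul, Real.sqrt_mul (sq_nonneg _),
    Real.sqrt_sq (norm_nonneg _)]
  rfl

theorem stateNorm_neg (φ : A →ₗ[ℂ] ℂ) (a : A) : stateNorm φ (-a) = stateNorm φ a := by
  simp [stateNorm]

theorem stateNorm_sub_rev (φ : A →ₗ[ℂ] ℂ) (a b : A) :
    stateNorm φ (a - b) = stateNorm φ (b - a) := by rw [← stateNorm_neg, neg_sub]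

/-- `(Ua)*(Ua) = a*a`. There is no such identity for right multiplication, which is why commutators
enter all later estimates. -/
theorem stateNorm_unitary_mul (φ : A →ₗ[ℂ] ℂ) {U : A} (hU : U ∈ unitary A) (a : A) :
    stateNorm φ (U * a) = stateNorm φ a := by
  rw [stateNorm, star_mul, mul_assoc, ← mul_assoc (star U), Unitary.star_mul_self_of_mem hU,
    one_mul]
  rfl

/-- Moving a unitary from the right to the left costs the norm of the commutator. -/
theorem IsNormalizedPositive.stateNorm_mul_unitary_le (hφ : IsNormalizedPositive φ) {U : A}
    (hU : U ∈ unitary A) (a : A) : stateNorm φ (a * U) ≤ stateNorm φ a + ‖a * U - U * a‖ := by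
  have h := hφ.stateNorm_add_le (U * a) (a * U - U * a)
  rw [add_sub_cancel, stateNorm_unitary_mul φ hU] at h
  exact h.trans (add_le_add_right (hφ.stateNorm_le_norm _) _)

/-- The mean value inequality on `[0,1]` for the seminorm of a state. -/
theorem IsNormalizedPositive.stateNorm_sub_le_of_hasDerivAt (hφ : IsNormalizedPositive φ)
    {F F' : ℝ → A} {C : ℝ} (hF : ∀ t, HasDerivAt F (F' t) t)
    (hC : ∀ t, 0 ≤ t → t ≤ 1 → stateNorm φ (F' t) ≤ C) : stateNorm φ (F 1 - F 0) ≤ C := by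
  set b := F 1 - F 0 with hb
  have hC0 : 0 ≤ C := (stateNorm_nonneg φ _).trans (hC 0 le_rfl zero_le_one)
  let L : A →L[ℝ] ℂ := (LinearMap.mkContinuous φ 1 fun a => by
    simpa using hφ.norm_map_le a).restrictScalars ℝ
  -- `stateNorm` is not the norm of `A`, so the scalar mean value inequality is applied after
  -- pairing with `b = F 1 - F 0`. Cauchy–Schwarz gives `‖b‖_φ² ≤ ‖b‖_φ C`.
  have hd : ∀ t, HasDerivAt (fun t => φ (star b * F t)) (φ (star b * F' t)) t := fun t =>
    L.hasFDerivAt.comp_hasDerivAt t ((hF t).const_mul (star b))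
  have h := norm_sub_le_of_hasDerivAt (C := stateNorm φ b * C) hd fun t h0 h1 =>
    (hφ.norm_map_star_mul_le b (F' t)).trans
      (mul_le_mul_of_nonneg_left (hC t h0 h1) (stateNorm_nonneg φ b))
  rw [← map_sub, ← mul_sub, ← hb, ← hφ.stateNorm_sq, Complex.norm_real, Real.norm_eq_abs,
    abs_of_nonneg (sq_nonneg _)] at h
  by_contra hlt
  push Not at hlt
  nlinarith [stateNorm_nonneg φ b]

/-- Duhamel's estimate for the expectations of two exponentials. -/
theorem IsNormalizedPositive.norm_map_expI_sub_le (hφ : IsNormalizedPositive φ) {X Y : A}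
    (hX : IsSelfAdjoint X) (hY : IsSelfAdjoint Y) :
    ‖φ (expI X) - φ (expI Y)‖ ≤ stateNorm φ (X - Y) + ‖(X - Y) * Y - Y * (X - Y)‖ := by
  have hd : ∀ t : ℝ, HasDerivAt (fun t : ℝ => expI (-((t : ℂ) • X)) * expI ((t : ℂ) • Y))
      (-Complex.I • (expI (-((t : ℂ) • X)) * ((X - Y) * expI ((t : ℂ) • Y)))) t := by
    intro t
    refine ((hasDerivAt_expI_neg_smul X t).mul (hasDerivAt_expI_smul' Y t)).congr_deriv ?_
    simp only [mul_sub, sub_mul, smul_sub, neg_mul, smul_mul_assoc, mul_smul_comm, mul_assoc,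
      neg_smul]
    abel
  -- The unitary on the left of the derivative drops out of the seminorm; the one on the right is
  -- moved past `X - Y` at the price of `[X - Y, Y]`.
  have h := hφ.stateNorm_sub_le_of_hasDerivAt
      (C := stateNorm φ (X - Y) + ‖(X - Y) * Y - Y * (X - Y)‖) hd fun t h0 h1 => by
    rw [stateNorm_smul, norm_neg, Complex.norm_I, one_mul, stateNorm_unitary_mul φ
      (expI_mem_unitary (isSelfAdjoint_ofReal_smul t hX).neg)]
    exact (hφ.stateNorm_mul_unitary_le (expI_mem_unitary (isSelfAdjoint_ofReal_smul t hY)) _).trans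
      (add_le_add_right (norm_comm_expI_smul_le _ hY h0 h1) _)
  simp only [Complex.ofReal_one, Complex.ofReal_zero, one_smul, zero_smul, neg_zero, expI_zero,
    mul_one] at h
  have e : expI X * (expI (-X) * expI Y - 1) = expI Y - expI X := by
    rw [mul_sub, ← mul_assoc, expI_mul_neg, one_mul, mul_one]
  rw [← stateNorm_unitary_mul φ (expI_mem_unitary hX), e] at h
  rw [← map_sub, ← neg_sub (expI Y), map_neg, norm_neg]
  exact (hφ.norm_map_le_stateNorm _).trans h

/-- First order expansion of `[e^{isX}, Y]`. With `C = [X,Y]`, the derivative of `e^{itX} Y e^{-itX}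
- itC` is `i(e^{itX} C e^{-itX} - C)`, whose norm is that of `[C, e^{itX}]`. -/
theorem norm_expI_mul_sub_le (X Y : A) {η : ℝ} (hX : IsSelfAdjoint X)
    (h : ∀ t : ℝ, 0 ≤ t → t ≤ 1 →
      ‖(X * Y - Y * X) * expI ((t : ℂ) • X) - expI ((t : ℂ) • X) * (X * Y - Y * X)‖ ≤ η)
    {s : ℝ} (h0 : 0 ≤ s) (h1 : s ≤ 1) :
    ‖expI ((s : ℂ) • X) * Y - Y * expI ((s : ℂ) • X) -
      (s : ℂ) • Complex.I • ((X * Y - Y * X) * expI ((s : ℂ) • X))‖ ≤ η := by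
  have hη : 0 ≤ η := (norm_nonneg _).trans (h 0 le_rfl zero_le_one)
  set C := X * Y - Y * X with hC
  have hd : ∀ t : ℝ, HasDerivAt
      (fun t : ℝ => expI ((t : ℂ) • X) * Y * expI (-((t : ℂ) • X)) - (t : ℂ) • Complex.I • C)
      (Complex.I • (expI ((t : ℂ) • X) * C * expI (-((t : ℂ) • X)) - C)) t := by
    intro t
    have hc : Commute (expI (-((t : ℂ) • X))) X :=
      ((((Commute.refl X).smul_right (t : ℂ)).neg_right).smul_right Complex.I).exp_right.symm
    refine ((((hasDerivAt_expI_smul X t).mul_const Y).mul (hasDerivAt_expI_neg_smul X t)).sub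
      (Complex.ofRealCLM.hasDerivAt.smul_const (Complex.I • C))).congr_deriv ?_
    simp only [hc.eq, hC, mul_sub, sub_mul, smul_sub, smul_mul_assoc, mul_smul_comm, mul_assoc,
      mul_neg, Complex.ofRealCLM_apply, Complex.ofReal_one, one_smul]
    abel
  have hb : ∀ t : ℝ, t ∈ Set.Ico (0 : ℝ) s →
      ‖Complex.I • (expI ((t : ℂ) • X) * C * expI (-((t : ℂ) • X)) - C)‖ ≤ η := by
    intro t ht
    have hs := isSelfAdjoint_ofReal_smul t hX
    have e : (expI ((t : ℂ) • X) * C * expI (-((t : ℂ) • X)) - C) * expI ((t : ℂ) • X) =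
        -(C * expI ((t : ℂ) • X) - expI ((t : ℂ) • X) * C) := by
      rw [sub_mul, mul_assoc, expI_neg_mul, mul_one, neg_sub]
    rw [norm_smul, Complex.norm_I, one_mul, ← norm_mul_unitary (expI_mem_unitary hs), e, norm_neg]
    exact h t ht.1 (ht.2.le.trans h1)
  have key := norm_image_sub_le_of_norm_deriv_le_segment' (a := (0 : ℝ)) (b := s)
    (fun t _ => (hd t).hasDerivWithinAt) hb s ⟨h0, le_rfl⟩
  have hs := isSelfAdjoint_ofReal_smul s hX
  have e : expI ((s : ℂ) • X) * Y - Y * expI ((s : ℂ) • X) -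
      (s : ℂ) • Complex.I • (C * expI ((s : ℂ) • X)) =
      (expI ((s : ℂ) • X) * Y * expI (-((s : ℂ) • X)) - (s : ℂ) • Complex.I • C - Y) *
        expI ((s : ℂ) • X) := by
    rw [sub_mul _ Y, sub_mul _ ((s : ℂ) • Complex.I • C), mul_assoc (_ * Y), expI_neg_mul, mul_one,
      smul_mul_assoc, smul_mul_assoc]
    abel
  rw [e, norm_mul_unitary (expI_mem_unitary hs)]
  simp only [Complex.ofReal_zero, zero_smul, neg_zero, expI_zero, mul_one, one_mul,
    sub_zero] at key
  exact key.trans (mul_le_of_le_one_right hη h1)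

/-- `e^{iX} e^{iY}` is close to `e^{-c/2} e^{i(X+Y)}` in the seminorm of a state if the commutator
`[X,Y]` is close to `c` in this seminorm and nearly commutes with the exponentials. -/
theorem IsNormalizedPositive.stateNorm_expI_mul_expI_sub_le (hφ : IsNormalizedPositive φ)
    {X Y : A} (hX : IsSelfAdjoint X) (hY : IsSelfAdjoint Y) {c : ℂ} (hc : c.re = 0) {η : ℝ}
    (h1 : ∀ t : ℝ, 0 ≤ t → t ≤ 1 →
      ‖(X * Y - Y * X) * expI ((t : ℂ) • X) - expI ((t : ℂ) • X) * (X * Y - Y * X)‖ ≤ η)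
    (h2 : ∀ t : ℝ, 0 ≤ t → t ≤ 1 →
      ‖(X * Y - Y * X) * expI ((t : ℂ) • Y) - expI ((t : ℂ) • Y) * (X * Y - Y * X)‖ ≤ η) :
    stateNorm φ (expI X * expI Y - Complex.exp (-c / 2) • expI (X + Y)) ≤
      stateNorm φ (X * Y - Y * X - algebraMap ℂ A c) + 3 * η := by
  set C := X * Y - Y * X with hC
  have hη : 0 ≤ η := (norm_nonneg _).trans (h1 0 le_rfl zero_le_one)
  set P : ℝ → A := fun t => expI (-((t : ℂ) • (X + Y))) with hP
  set V : ℝ → A := fun t => expI ((t : ℂ) • X) with hV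
  set W : ℝ → A := fun t => expI ((t : ℂ) • Y) with hW
  set R : ℝ → A := fun t => V t * Y - Y * V t - (t : ℂ) • Complex.I • (C * V t) with hR
  set g : ℝ → ℂ := fun t => Complex.exp (c / 2 * (t : ℂ) ^ 2) with hg
  have hgn : ∀ t, ‖g t‖ = 1 := fun t => by
    rw [hg]; simp only
    rw [Complex.norm_exp, ← Complex.ofReal_pow, Complex.re_mul_ofReal]
    simp [hc]
  have hgd : ∀ t : ℝ, HasDerivAt g (g t * (c * t)) t := fun t => by
    have h := ((Complex.ofRealCLM.hasDerivAt (x := t)).pow 2).const_mul (c / 2)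
    refine h.cexp.congr_deriv ?_
    simp only [hg, Complex.ofRealCLM_apply, Pi.pow_apply, Complex.ofReal_one]
    push_cast
    ring
  -- Differentiating `P V W` leaves `iP[V,Y]W`, and `[V,Y] = R + itCV`. The integrating factor `g`
  -- turns the resulting `-tC` into `-t(C - c)`. As `c` is imaginary, `g` has modulus one.
  have hd : ∀ t : ℝ, HasDerivAt (fun t : ℝ => g t • (P t * V t * W t))
      (g t • (-(t : ℂ) • (P t * ((C - algebraMap ℂ A c) * (V t * W t))) +
        Complex.I • (P t * (R t * W t)))) t := by
    intro t
    refine ((hgd t).smul (((hasDerivAt_expI_neg_smul (X + Y) t).mul (hasDerivAt_expI_smul' X t)).mul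
      (hasDerivAt_expI_smul' Y t))).congr_deriv ?_
    simp only [hP, hV, hW, hR, Pi.mul_apply, Algebra.algebraMap_eq_smul_one]
    rw [mul_smul, ← smul_add]
    congr 1
    simp only [mul_sub, sub_mul, smul_sub, neg_mul, smul_mul_assoc, mul_smul_comm, mul_assoc,
      add_mul, mul_add, smul_add, neg_smul, one_mul, smul_comm Complex.I (t : ℂ),
      smul_smul Complex.I Complex.I, Complex.I_mul_I, smul_neg]
    module
  have hVu : ∀ t, V t ∈ unitary A := fun t => expI_mem_unitary (isSelfAdjoint_ofReal_smul t hX)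
  have hWu : ∀ t, W t ∈ unitary A := fun t => expI_mem_unitary (isSelfAdjoint_ofReal_smul t hY)
  have hPu : ∀ t, P t ∈ unitary A := fun t =>
    expI_mem_unitary (isSelfAdjoint_ofReal_smul t (hX.add hY)).neg
  have h := hφ.stateNorm_sub_le_of_hasDerivAt
      (C := stateNorm φ (C - algebraMap ℂ A c) + 3 * η) hd fun t h0 ht1 => by
    rw [stateNorm_smul, hgn, one_mul]
    refine (hφ.stateNorm_add_le _ _).trans ?_
    rw [stateNorm_smul, stateNorm_smul, Complex.norm_I, one_mul, stateNorm_unitary_mul φ (hPu t),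
      stateNorm_unitary_mul φ (hPu t), norm_neg, Complex.norm_real, Real.norm_eq_abs,
      abs_of_nonneg h0]
    have e1 : stateNorm φ (R t * W t) ≤ η := by
      refine (hφ.stateNorm_le_norm _).trans ?_
      rw [norm_mul_unitary (hWu t)]
      exact norm_expI_mul_sub_le X Y hX h1 h0 ht1
    -- Of the total `3η`, two come from moving `C` past `V` and `W`, and one from the remainder `R`.
    have e2 : ‖(C - algebraMap ℂ A c) * (V t * W t) - V t * W t * (C - algebraMap ℂ A c)‖ ≤
        η + η := by
      have : (C - algebraMap ℂ A c) * (V t * W t) - V t * W t * (C - algebraMap ℂ A c) =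
          (C * V t - V t * C) * W t + V t * (C * W t - W t * C) := by
        rw [sub_mul, mul_sub, Algebra.commutes c (V t * W t)]
        noncomm_ring
      rw [this]
      refine (norm_add_le _ _).trans ?_
      rw [norm_mul_unitary (hWu t), norm_unitary_mul (hVu t)]
      exact add_le_add (h1 t h0 ht1) (h2 t h0 ht1)
    have e3 := hφ.stateNorm_mul_unitary_le (mul_mem (hVu t) (hWu t)) (C - algebraMap ℂ A c)
    have e4 := mul_le_of_le_one_left
      (stateNorm_nonneg φ ((C - algebraMap ℂ A c) * (V t * W t))) ht1
    linarith
  simp only [hP, hV, hW, hg, Complex.ofReal_one, Complex.ofReal_zero, one_smul, zero_smul,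
    neg_zero, expI_zero, mul_one, one_pow, ne_eq, OfNat.ofNat_ne_zero, not_false_eq_true, zero_pow,
    mul_zero, Complex.exp_zero] at h
  have e : Complex.exp (-c / 2) • (expI (X + Y) *
      (Complex.exp (c / 2) • (expI (-(X + Y)) * expI X * expI Y) - 1)) =
      expI X * expI Y - Complex.exp (-c / 2) • expI (X + Y) := by
    rw [mul_sub, mul_one, mul_smul_comm, smul_sub, smul_smul, ← Complex.exp_add, mul_assoc,
      ← mul_assoc, expI_mul_neg, one_mul, show -c / 2 + c / 2 = 0 by ring, Complex.exp_zero,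
      one_smul]
  rw [← e, stateNorm_smul, stateNorm_unitary_mul φ (expI_mem_unitary (hX.add hY)),
    Complex.norm_exp, show (-c / 2).re = 0 by simp [hc], Real.exp_zero, one_mul]
  exact h

end StateNorm

/-- A function on `[0,1]` that nearly solves `f' = -σ t f` is close to a Gaussian. -/
theorem norm_sub_exp_le_of_hasDerivAt {f f' : ℝ → ℂ} {σ ε : ℝ} (hσ : 0 ≤ σ)
    (hf : ∀ t, HasDerivAt f (f' t) t) (h0 : f 0 = 1)
    (h : ∀ t : ℝ, 0 ≤ t → t ≤ 1 → ‖f' t + t * σ * f t‖ ≤ ε) :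
    ‖f 1 - Complex.exp (-(1 / 2) * σ)‖ ≤ ε := by
  have hε : 0 ≤ ε := (norm_nonneg _).trans (h 0 le_rfl zero_le_one)
  have hgd : ∀ t : ℝ, HasDerivAt (fun t : ℝ => Complex.exp (σ / 2 * (t : ℂ) ^ 2))
      (Complex.exp (σ / 2 * (t : ℂ) ^ 2) * (σ * t)) t := fun t => by
    have h := ((Complex.ofRealCLM.hasDerivAt (x := t)).pow 2).const_mul ((σ : ℂ) / 2)
    refine h.cexp.congr_deriv ?_
    simp only [Complex.ofRealCLM_apply, Pi.pow_apply, Complex.ofReal_one]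
    push_cast
    ring
  have hd : ∀ t : ℝ, HasDerivAt (fun t : ℝ => Complex.exp (σ / 2 * (t : ℂ) ^ 2) * f t)
      (Complex.exp (σ / 2 * (t : ℂ) ^ 2) * (f' t + t * σ * f t)) t := fun t => by
    refine ((hgd t).mul (hf t)).congr_deriv ?_
    ring
  -- The integrating factor grows to `e^{σ/2}`, and the final multiplication by `e^{-σ/2}` cancels
  -- this exactly. The bound is therefore uniform in the variance.
  have key := norm_sub_le_of_hasDerivAt (C := Real.exp (σ / 2) * ε) hd fun t ht0 ht1 => by
    rw [norm_mul, Complex.norm_exp]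
    refine mul_le_mul (Real.exp_le_exp.mpr ?_) (h t ht0 ht1) (norm_nonneg _) (Real.exp_pos _).le
    rw [show (σ : ℂ) / 2 * (t : ℂ) ^ 2 = ((σ / 2 * t ^ 2 : ℝ) : ℂ) by push_cast; rfl,
      Complex.ofReal_re]
    exact mul_le_of_le_one_right (by positivity) (pow_le_one₀ ht0 ht1)
  simp only [Complex.ofReal_one, Complex.ofReal_zero, one_pow, mul_one, ne_eq, OfNat.ofNat_ne_zero,
    not_false_eq_true, zero_pow, mul_zero, Complex.exp_zero, h0] at key
  have e : f 1 - Complex.exp (-(1 / 2) * σ) =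
      Complex.exp (-(1 / 2) * σ) * (Complex.exp (σ / 2) * f 1 - 1) := by
    rw [mul_sub, ← mul_assoc, ← Complex.exp_add]
    ring_nf
    simp
  have e2 : ‖Complex.exp (-(1 / 2) * σ)‖ = Real.exp (-(σ / 2)) := by
    rw [Complex.norm_exp]
    congr 1
    simp
    ring
  rw [e, norm_mul, e2]
  refine (mul_le_mul_of_nonneg_left key (Real.exp_pos _).le).trans (le_of_eq ?_)
  rw [← mul_assoc, ← Real.exp_add]
  simp

/-! ### Local algebras -/

section LocalAlgebra

variable {d : ℕ} [NeZero d]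

theorem IsState.isNormalizedPositive {φ : UHF d →ₗ[ℂ] ℂ} (hφ : IsState φ) :
    IsNormalizedPositive φ := ⟨hφ.nonneg, hφ.map_one⟩

theorem isClosed_localAlg (Λ : Set ℤ) : IsClosed (localAlg d Λ : Set (UHF d)) :=
  StarSubalgebra.isClosed_topologicalClosure _

theorem site_mem_localAlg {Λ : Set ℤ} {j : ℤ} (hj : j ∈ Λ) (Q : Matrix (Fin d) (Fin d) ℂ) :
    site j Q ∈ localAlg d Λ :=
  StarSubalgebra.le_topologicalClosure _ (StarAlgebra.subset_adjoin ℂ _ ⟨j, hj, Q, rfl⟩)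

/-- The induction principle for local algebras: a closed *-subalgebra need only be tested on the
one-site matrices. -/
theorem localAlg_le {Λ : Set ℤ} {S : StarSubalgebra ℂ (UHF d)} (hS : IsClosed (S : Set (UHF d)))
    (h : ∀ j ∈ Λ, ∀ Q : Matrix (Fin d) (Fin d) ℂ, site j Q ∈ S) : localAlg d Λ ≤ S := by
  refine StarSubalgebra.topologicalClosure_minimal (StarAlgebra.adjoin_le ?_) hS
  rintro _ ⟨j, hj, Q, rfl⟩
  exact h j hj Q

theorem localAlg_mono {Λ Λ' : Set ℤ} (h : Λ ⊆ Λ') : localAlg d Λ ≤ localAlg d Λ' :=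
  localAlg_le (isClosed_localAlg _) fun _ hj Q => site_mem_localAlg (h hj) Q

theorem expI_mem_localAlg {Λ : Set ℤ} {X : UHF d} (hX : X ∈ localAlg d Λ) :
    expI X ∈ localAlg d Λ := by
  rw [expI, NormedSpace.exp_eq_tsum ℂ]
  exact tsum_mem (isClosed_localAlg Λ)
    fun n => SMulMemClass.smul_mem _ (pow_mem (SMulMemClass.smul_mem _ hX) n)

/-- Centralizers are closed *-subalgebras, so commutation passes from the generators to the closure,
first in the left factor and then in the right one. -/
theorem commute_of_mem_localAlg {Λ Λ' : Set ℤ} (h : Disjoint Λ Λ') {a b : UHF d}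
    (ha : a ∈ localAlg d Λ) (hb : b ∈ localAlg d Λ') : Commute a b := by
  have hcl : ∀ S : Set (UHF d),
      IsClosed (StarSubalgebra.centralizer ℂ S : Set (UHF d)) := fun S => by
    rw [StarSubalgebra.coe_centralizer]
    exact Set.isClosed_centralizer _
  have h1 : localAlg d Λ ≤ StarSubalgebra.centralizer ℂ
      {T | ∃ k ∈ Λ', ∃ R : Matrix (Fin d) (Fin d) ℂ, T = site k R} := by
    refine localAlg_le (hcl _) fun j hj Q => ?_
    have key : ∀ k ∈ Λ', ∀ R : Matrix (Fin d) (Fin d) ℂ, site k R * site j Q =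
        (site j Q * site k R : UHF d) := fun k hk R =>
      Subtype.ext (siteOp_comm (fun e => h.ne_of_mem hj hk e.symm) R Q)
    rw [StarSubalgebra.mem_centralizer_iff]
    rintro _ ⟨k, hk, R, rfl⟩
    refine ⟨key k hk R, ?_⟩
    rw [← map_star]
    exact key k hk _
  have h2 : localAlg d Λ' ≤ StarSubalgebra.centralizer ℂ {a} := by
    refine localAlg_le (hcl _) fun k hk R => ?_
    rw [StarSubalgebra.mem_centralizer_iff]
    rintro _ rfl
    have hc : ∀ x ∈ localAlg d Λ, x * site k R = site k R * x := fun x hx =>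
      ((StarSubalgebra.mem_centralizer_iff ℂ).mp (h1 hx) _ ⟨k, hk, R, rfl⟩).1.symm
    exact ⟨hc _ ha, hc _ (star_mem ha)⟩
  exact ((StarSubalgebra.mem_centralizer_iff ℂ).mp (h2 hb) a rfl).1

theorem translate_mem_localAlg {Λ Λ' : Set ℤ} {j : ℤ} (h : ∀ k ∈ Λ, j + k ∈ Λ') {a : UHF d}
    (ha : a ∈ localAlg d Λ) : translate j a ∈ localAlg d Λ' := by
  have hc : Continuous (translate j : UHF d →⋆ₐ[ℂ] UHF d) :=
    AddMonoidHomClass.continuous_of_bound _ 1 fun a => by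
      simpa using NonUnitalStarAlgHom.norm_apply_le (translate j : UHF d →⋆ₐ[ℂ] UHF d) a
  have : localAlg d Λ ≤ (localAlg d Λ').comap (translate j) := by
    refine localAlg_le ((isClosed_localAlg Λ').preimage hc) fun k hk Q => ?_
    rw [StarSubalgebra.mem_comap, translate_site]
    exact site_mem_localAlg (h k hk) Q
  exact this ha

theorem translate_translate (j k : ℤ) (Q : UHF d) :
    translate j (translate k Q) = translate (j + k) Q := by
  refine Subtype.ext ?_
  change shiftAut d j (shiftAut d k Q.1) = shiftAut d (j + k) Q.1
  have h1 : ∀ ω, shiftConfig d k (shiftConfig d j ω) = shiftConfig d (j + k) ω := fun ω => by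
    funext i
    change ω (i + k + j) = ω (i + (j + k))
    congr 1
    ring
  have h2 : ∀ ω, (shiftConfig d j).symm ((shiftConfig d k).symm ω) =
      (shiftConfig d (j + k)).symm ω := fun ω => by
    funext i
    change ω (i - j - k) = ω (i - (j + k))
    congr 1
    ring
  ext f ω
  have h3 : (permIsometry (shiftConfig d k)).symm ((permIsometry (shiftConfig d j)).symm f) =
      (permIsometry (shiftConfig d (j + k))).symm f := by
    ext ω'
    simp only [permIsometry_symm_apply, h2]
  simp only [shiftAut_apply, permIsometry_apply, h1, h3]

theorem translate_zero (Q : UHF d) : translate 0 Q = Q := by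
  refine Subtype.ext ?_
  change shiftAut d 0 Q.1 = Q.1
  have h1 : ∀ ω, shiftConfig d 0 ω = ω := fun ω => by
    funext i
    change ω (i + 0) = ω i
    rw [add_zero]
  have h2 : ∀ ω, (shiftConfig d 0).symm ω = ω := fun ω => by
    funext i
    change ω (i - 0) = ω i
    rw [sub_zero]
  ext f ω
  have h3 : (permIsometry (shiftConfig d 0)).symm f = f := by
    ext ω'
    simp only [permIsometry_symm_apply, h2]
  simp only [shiftAut_apply, permIsometry_apply, h1, h3]

theorem norm_translate (j : ℤ) (Q : UHF d) : ‖translate j Q‖ = ‖Q‖ := by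
  refine le_antisymm (NonUnitalStarAlgHom.norm_apply_le _ Q) ?_
  have := NonUnitalStarAlgHom.norm_apply_le (translate (-j) : UHF d →⋆ₐ[ℂ] UHF d) (translate j Q)
  rwa [translate_translate, neg_add_cancel, translate_zero] at this

theorem translate_mem_Icc {a b j : ℤ} {Q : UHF d} (hQ : Q ∈ localAlg d (Set.Icc a b)) :
    translate j Q ∈ localAlg d (Set.Icc (j + a) (j + b)) :=
  translate_mem_localAlg
    (fun _ hk => Set.mem_Icc.mpr ⟨by linarith [hk.1], by linarith [hk.2]⟩) hQ

theorem commute_Icc {a b m m' : ℤ} (h : m + m' < |a - b|) {A B : UHF d}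
    (hA : A ∈ localAlg d (Set.Icc (a - m) (a + m)))
    (hB : B ∈ localAlg d (Set.Icc (b - m') (b + m'))) : Commute A B := by
  refine commute_of_mem_localAlg (Set.disjoint_left.mpr fun i hi hi' => ?_) hA hB
  obtain ⟨h1, h2⟩ := hi
  obtain ⟨h3, h4⟩ := hi'
  rcases abs_cases (a - b) with h5 | h5 <;> linarith

end LocalAlgebra

/-! ### Clustering -/

section Clustering

variable {d : ℕ} [NeZero d]

/-- Decay `ρ(g)` of the correlations over a gap of length `g`, with `ρ` antitone and summable with
its first moment. -/
structure IntervalClustering (φ : UHF d →ₗ[ℂ] ℂ) (ρ : ℕ → ℝ) : Prop where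
  antitone : Antitone ρ
  zero : ρ 0 = 2
  nonneg : ∀ g, 0 ≤ ρ g
  summable : Summable fun g : ℕ => (g : ℝ) * ρ g
  bound : ∀ (a b : ℤ) (g : ℕ), a + g ≤ b → ∀ A ∈ localAlg d (Set.Iic a),
    ∀ B ∈ localAlg d (Set.Ici b), ‖φ (A * B) - φ A * φ B‖ ≤ ρ g * ‖A‖ * ‖B‖

/-- The running minimum of `2` and the values `ρ 1, …, ρ (g - 1)`. -/
def runningMin (ρ : ℕ → ℝ) : ℕ → ℝ
  | 0 => 2
  | 1 => 2
  | g + 2 => min (runningMin ρ (g + 1)) (ρ (g + 1))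

variable {φ : UHF d →ₗ[ℂ] ℂ}

theorem norm_cov_le_two_mul (hφ : IsNormalizedPositive φ) (A B : UHF d) :
    ‖φ (A * B) - φ A * φ B‖ ≤ 2 * ‖A‖ * ‖B‖ := by
  refine (norm_sub_le _ _).trans ?_
  rw [norm_mul]
  have h1 := (hφ.norm_map_le (A * B)).trans (norm_mul_le A B)
  have h2 := mul_le_mul (hφ.norm_map_le A) (hφ.norm_map_le B) (norm_nonneg _) (norm_nonneg _)
  linarith

/-- Enlarging a gap can only help, so the decay function may be replaced by a running minimum, which
is antitone. The value `2` is the trivial bound for a covariance. -/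
theorem HalfLineClustering.intervalClustering (hφ : IsNormalizedPositive φ)
    (hτ : IsTranslationInvariant φ) {ρ : ℕ → ℝ} (h : HalfLineClustering φ ρ)
    (h0 : ∀ j, 0 ≤ ρ j) (hs : Summable fun j : ℕ => (j : ℝ) * ρ j) :
    IntervalClustering φ (runningMin ρ) := by
  have hnn : ∀ g, 0 ≤ runningMin ρ g := by
    intro g
    induction g with
    | zero => norm_num [runningMin]
    | succ g ih =>
      cases g with
      | zero => norm_num [runningMin]
      | succ g => exact le_min ih (h0 _)
  refine ⟨antitone_nat_of_succ_le fun g => ?_, rfl, hnn, ?_, ?_⟩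
  · cases g with
    | zero => exact le_rfl
    | succ g => exact min_le_left _ _
  · rw [← summable_nat_add_iff 2]
    refine Summable.of_nonneg_of_le (fun g => mul_nonneg (by positivity) (hnn _)) (fun g => ?_)
      (((summable_nat_add_iff 1).mpr hs).mul_left 2)
    have h1 : runningMin ρ (g + 2) ≤ ρ (g + 1) := min_le_right _ _
    calc ((g + 2 : ℕ) : ℝ) * runningMin ρ (g + 2) ≤ ((g + 2 : ℕ) : ℝ) * ρ (g + 1) := by gcongr
      _ ≤ 2 * ((g + 1 : ℕ) : ℝ) * ρ (g + 1) := by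
        refine mul_le_mul_of_nonneg_right ?_ (h0 _)
        push_cast
        linarith [(Nat.cast_nonneg g : (0 : ℝ) ≤ g)]
      _ = _ := by ring
  · intro a b g
    induction g with
    | zero => exact fun _ A _ B _ => norm_cov_le_two_mul hφ A B
    | succ g ih =>
      intro hab A hA B hB
      cases g with
      | zero => exact norm_cov_le_two_mul hφ A B
      | succ g =>
        have h1 := ih (by push_cast at hab ⊢; linarith) A hA B hB
        -- The half-lines `(-∞,-1]` and `[j,∞)` have endpoints at distance `j + 1`, so a gap of `g +
        -- 2` corresponds to `j = g + 1`.
        have h2 : ‖φ (A * B) - φ A * φ B‖ ≤ ρ (g + 1) * ‖A‖ * ‖B‖ := by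
          have hA' : translate (-a - 1) A ∈ localAlg d (Set.Iic (-1)) :=
            translate_mem_localAlg (fun k hk => by
              simp only [Set.mem_Iic] at hk ⊢; linarith) hA
          have hB' : translate (-a - 1 - ((g + 1 : ℕ) : ℤ)) B ∈ localAlg d (Set.Ici 0) :=
            translate_mem_localAlg (fun k hk => by
              simp only [Set.mem_Ici] at hk ⊢; push_cast at hab ⊢; linarith) hB
          have := h (g + 1) (Nat.succ_pos g) _ hA' _ hB'
          rw [translate_translate, add_sub_cancel, ← map_mul, hτ, hτ, hτ, norm_translate,
            norm_translate] at this
          exact this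
        rw [show runningMin ρ (g + 1 + 1) = min (runningMin ρ (g + 1)) (ρ (g + 1)) from rfl]
        rcases min_choice (runningMin ρ (g + 1)) (ρ (g + 1)) with e | e <;> rw [e] <;> assumption

namespace IntervalClustering

variable {ρ : ℕ → ℝ}

theorem summable_self (h : IntervalClustering φ ρ) : Summable ρ := by
  rw [← summable_nat_add_iff 1]
  refine Summable.of_nonneg_of_le (fun g => h.nonneg _) (fun g => ?_)
    ((summable_nat_add_iff 1).mpr h.summable)
  refine le_mul_of_one_le_left (h.nonneg _) ?_
  push_cast
  linarith [(Nat.cast_nonneg g : (0 : ℝ) ≤ g)]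

/-- For antitone `ρ`, the block `∑_{g/2 ≤ i < g} i ρ(i)` is at least about `g²ρ(g)/4`, and it tends
to zero as a difference of partial sums of a convergent series. The term `gρ(g)` absorbs the
rounding in `g/2`. -/
theorem tendsto_sq_mul (h : IntervalClustering φ ρ) :
    Filter.Tendsto (fun g : ℕ => (g : ℝ) ^ 2 * ρ g) Filter.atTop (nhds 0) := by
  have h1 := h.summable.tendsto_atTop_zero
  have h2 := h.summable.hasSum.tendsto_sum_nat
  have hdiv : Filter.Tendsto (fun g : ℕ => g / 2) Filter.atTop Filter.atTop :=
    Filter.tendsto_atTop_atTop.mpr fun b => ⟨2 * b, fun g hg => by omega⟩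
  have h3 := ((h2.sub (h2.comp hdiv)).const_mul 4).add h1
  simp only [sub_self, mul_zero, add_zero, Function.comp_def] at h3
  refine squeeze_zero (fun g => mul_nonneg (sq_nonneg _) (h.nonneg g)) (fun g => ?_) h3
  rw [← Finset.sum_Ico_eq_sub _ (Nat.div_le_self g 2)]
  have h4 : ((g - g / 2 : ℕ) : ℝ) * (((g / 2 : ℕ) : ℝ) * ρ g) ≤
      ∑ i ∈ Finset.Ico (g / 2) g, (i : ℝ) * ρ i := by
    have := Finset.card_nsmul_le_sum (Finset.Ico (g / 2) g) (fun i : ℕ => (i : ℝ) * ρ i)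
      (((g / 2 : ℕ) : ℝ) * ρ g) fun i hi => by
        rw [Finset.mem_Ico] at hi
        exact mul_le_mul (by exact_mod_cast hi.1) (h.antitone hi.2.le) (h.nonneg _)
          (Nat.cast_nonneg _)
    rwa [Nat.card_Ico, nsmul_eq_mul] at this
  have h5 : (g : ℝ) / 2 ≤ ((g - g / 2 : ℕ) : ℝ) := by
    rw [div_le_iff₀ two_pos]
    exact_mod_cast (by omega : g ≤ (g - g / 2) * 2)
  have h6 : ((g : ℝ) - 1) / 2 ≤ ((g / 2 : ℕ) : ℝ) := by
    rw [div_le_iff₀ two_pos, sub_le_iff_le_add]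
    exact_mod_cast (by omega : g ≤ g / 2 * 2 + 1)
  have h7 : (g : ℝ) / 2 * (((g : ℝ) - 1) / 2) ≤ ((g - g / 2 : ℕ) : ℝ) * ((g / 2 : ℕ) : ℝ) :=
    (mul_le_mul_of_nonneg_left h6 (by positivity)).trans
      (mul_le_mul_of_nonneg_right h5 (by positivity))
  have h8 := mul_le_mul_of_nonneg_right h7 (h.nonneg g)
  linarith

/-- `IntervalClustering` requires the left element to come first. If the order is reversed, the
positive gap makes the two elements commute; with `g = 0` the trivial bound suffices. -/
theorem norm_cov_Icc_le (h : IntervalClustering φ ρ) (hφ : IsNormalizedPositive φ)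
    {a b : ℤ} {m m' g : ℕ} (hg : (g : ℤ) + m + m' ≤ |a - b| ∨ g = 0) {A B : UHF d}
    (hA : A ∈ localAlg d (Set.Icc (a - m) (a + m)))
    (hB : B ∈ localAlg d (Set.Icc (b - m') (b + m'))) :
    ‖φ (A * B) - φ A * φ B‖ ≤ ρ g * ‖A‖ * ‖B‖ := by
  rcases Nat.eq_zero_or_pos g with rfl | hg0
  · rw [h.zero]; exact norm_cov_le_two_mul hφ A B
  have hg' : (g : ℤ) + m + m' ≤ |a - b| := hg.resolve_right hg0.ne'
  rcases abs_cases (a - b) with ⟨h1, h2⟩ | ⟨h1, h2⟩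
  · have hc : Commute A B := commute_Icc (by omega) hA hB
    have := h.bound (b + m') (a - m) g (by linarith) B
      (localAlg_mono Set.Icc_subset_Iic_self hB) A (localAlg_mono Set.Icc_subset_Ici_self hA)
    rw [hc.eq, mul_comm (φ A)]
    linarith
  · exact h.bound (a + m) (b - m') g (by linarith) A
      (localAlg_mono Set.Icc_subset_Iic_self hA) B (localAlg_mono Set.Icc_subset_Ici_self hB)

end IntervalClustering

end Clustering

/-! ### Double sums over a box -/

section BoxSum

theorem sum_sub_le_tsum {g : ℤ → ℝ} (h0 : ∀ k, 0 ≤ g k) (hg : Summable g) (s : Finset ℤ) (j : ℤ) :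
    ∑ i ∈ s, g (i - j) ≤ ∑' k, g k := by
  rw [← (Equiv.subRight j).tsum_eq g]
  exact ((Equiv.subRight j).summable_iff.mpr hg).sum_le_tsum s fun _ _ => h0 _

theorem card_box (N : ℕ) : ((Finset.Icc (-(N : ℤ)) N).card : ℝ) = 2 * N + 1 := by
  rw [Int.card_Icc, show ((N : ℤ) + 1 - -N).toNat = 2 * N + 1 by omega]
  push_cast
  ring

theorem sum_box_sub_le {g : ℤ → ℝ} (h0 : ∀ k, 0 ≤ g k) (hg : Summable g) (N : ℕ) :
    ∑ i ∈ Finset.Icc (-(N : ℤ)) N, ∑ j ∈ Finset.Icc (-(N : ℤ)) N, g (i - j) ≤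
      (2 * N + 1) * ∑' k, g k := by
  rw [Finset.sum_comm, ← card_box N, ← nsmul_eq_mul]
  exact Finset.sum_le_card_nsmul _ _ _ fun j _ => sum_sub_le_tsum h0 hg _ j

/-- After division by `2N+1`, a difference `k` occurs with a weight between `1 - |k|/(2N+1)` and
`1`. Dominated convergence then gives the full sum. -/
theorem tendsto_inv_mul_sum_box_sub {c : ℤ → ℂ} (hc : Summable c) :
    Tendsto (fun N : ℕ => ((2 * N + 1 : ℝ) : ℂ)⁻¹ *
      ∑ i ∈ Finset.Icc (-(N : ℤ)) N, ∑ j ∈ Finset.Icc (-(N : ℤ)) N, c (i - j)) atTop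
      (𝓝 (∑' k, c k)) := by
  set w : ℕ → ℤ → ℝ := fun N k => (2 * N + 1 : ℝ)⁻¹ *
    ((Finset.Icc (-(N : ℤ)) N).filter fun j => k + j ∈ Finset.Icc (-(N : ℤ)) N).card with hw
  have hpos : ∀ N : ℕ, (0 : ℝ) < 2 * N + 1 := fun N => by positivity
  have hw0 : ∀ N k, 0 ≤ w N k := fun N k => by positivity
  have hw1 : ∀ N k, w N k ≤ 1 := fun N k => by
    rw [hw]
    simp only
    rw [inv_mul_le_iff₀ (hpos N), mul_one, ← card_box N]
    exact_mod_cast Finset.card_filter_le _ _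
  have hw2 : ∀ (N : ℕ) (k : ℤ), 1 - |(k : ℝ)| * (2 * N + 1 : ℝ)⁻¹ ≤ w N k := fun (N : ℕ) (k : ℤ) => by
    have h1 := Finset.card_filter_add_card_filter_not (s := Finset.Icc (-(N : ℤ)) N)
      (fun j => k + j ∈ Finset.Icc (-(N : ℤ)) N)
    have h2 : ((Finset.Icc (-(N : ℤ)) N).filter
        fun j => ¬ k + j ∈ Finset.Icc (-(N : ℤ)) N).card ≤ k.natAbs := by
      rcases le_or_gt 0 k with hk | hk
      · refine (Finset.card_le_card (t := Finset.Ioc (N - k) (N : ℤ)) fun j hj => ?_).trans ?_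
        · simp only [Finset.mem_filter, Finset.mem_Icc, Finset.mem_Ioc] at hj ⊢
          omega
        · rw [Int.card_Ioc]; omega
      · refine (Finset.card_le_card (t := Finset.Ico (-(N : ℤ)) (-N - k)) fun j hj => ?_).trans ?_
        · simp only [Finset.mem_filter, Finset.mem_Icc, Finset.mem_Ico] at hj ⊢
          omega
        · rw [Int.card_Ico]; omega
    have h3 : (2 * N + 1 : ℝ) - |(k : ℝ)| ≤ ((Finset.Icc (-(N : ℤ)) N).filter
        fun j => k + j ∈ Finset.Icc (-(N : ℤ)) N).card := by
      rw [← card_box N, ← Int.cast_abs, ← Int.natCast_natAbs, Int.cast_natCast, sub_le_iff_le_add]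
      exact_mod_cast h1.symm.le.trans (Nat.add_le_add_left h2 _)
    have h4 := mul_le_mul_of_nonneg_left h3 (inv_pos.mpr (hpos N)).le
    rwa [mul_sub, inv_mul_cancel₀ (hpos N).ne', mul_comm _ |(k : ℝ)|] at h4
  have hlim : ∀ k, Tendsto (fun N => w N k) atTop (𝓝 1) := fun k => by
    have hinv : Tendsto (fun N : ℕ => (2 * N + 1 : ℝ)⁻¹) atTop (𝓝 0) :=
      tendsto_inv_atTop_zero.comp (tendsto_atTop_add_const_right _ _
        (tendsto_natCast_atTop_atTop.const_mul_atTop two_pos))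
    have h1 := (hinv.const_mul |(k : ℝ)|).const_sub 1
    rw [mul_zero, sub_zero] at h1
    exact tendsto_of_tendsto_of_tendsto_of_le_of_le h1 tendsto_const_nhds (fun N => hw2 N k)
      fun N => hw1 N k
  have hrepr : ∀ N : ℕ, ((2 * N + 1 : ℝ) : ℂ)⁻¹ *
      ∑ i ∈ Finset.Icc (-(N : ℤ)) N, ∑ j ∈ Finset.Icc (-(N : ℤ)) N, c (i - j) =
      ∑' k, (w N k : ℂ) * c k := fun N => by
    have h1 : ∀ j : ℤ, ∑ i ∈ Finset.Icc (-(N : ℤ)) N, c (i - j) =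
        ∑' k, if k + j ∈ Finset.Icc (-(N : ℤ)) N then c k else 0 := fun j => by
      rw [← (Equiv.subRight j).tsum_eq (fun k => if k + j ∈ Finset.Icc (-(N : ℤ)) N then c k else 0)]
      simp only [Equiv.subRight_apply, sub_add_cancel]
      rw [tsum_eq_sum (s := Finset.Icc (-(N : ℤ)) N) fun i hi => if_neg hi]
      exact Finset.sum_congr rfl fun i hi => (if_pos hi).symm
    have h2 : ∀ j : ℤ, Summable fun k => if k + j ∈ Finset.Icc (-(N : ℤ)) N then c k else 0 :=
      fun j => by
        refine Summable.of_norm_bounded hc.norm fun k => ?_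
        split_ifs
        · exact le_rfl
        · simp
    rw [Finset.sum_comm]
    simp_rw [h1]
    rw [← Summable.tsum_finsetSum fun j _ => h2 j, ← tsum_mul_left]
    refine tsum_congr fun k => ?_
    rw [← Finset.sum_filter, Finset.sum_const, nsmul_eq_mul, hw]
    push_cast
    ring
  simp only [hrepr]
  have h2 : ∀ k, Tendsto (fun N => (w N k : ℂ) * c k) atTop (𝓝 (c k)) := fun k => by
    have := ((Complex.continuous_ofReal.tendsto 1).comp (hlim k)).mul_const (c k)
    simpa using this
  refine tendsto_tsum_of_dominated_convergence hc.norm h2 (Eventually.of_forall fun N k => ?_)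
  rw [norm_mul, Complex.norm_real, Real.norm_eq_abs, abs_of_nonneg (hw0 N k)]
  exact mul_le_of_le_one_left (norm_nonneg _) (hw1 N k)

/-- Each value of `f` is taken at exactly `q` natural numbers, hence at finitely many integers whose
number is bounded uniformly. -/
theorem summable_comp_natAbs_div {f : ℕ → ℝ} (hf : Summable f) {q : ℕ} (hq : 0 < q) :
    Summable fun k : ℤ => f (k.natAbs / q) := by
  have : NeZero q := ⟨hq.ne'⟩
  have h1 : Summable fun n : ℕ => f (n / q) := by
    rw [← (Nat.divModEquiv q).symm.summable_iff]
    have h2 : Summable fun p : ℕ × Fin q => f p.1 := by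
      have := (hf.norm.mul_of_nonneg (g := fun _ : Fin q => (1 : ℝ)) (Summable.of_finite)
        (fun _ => norm_nonneg _) fun _ => zero_le_one)
      exact Summable.of_norm (by simpa using this)
    refine h2.congr fun p => ?_
    simp only [Function.comp_apply, Nat.divModEquiv_symm_apply]
    rw [Nat.add_comm, Nat.add_mul_div_right _ _ hq, Nat.div_eq_of_lt p.2.is_lt, Nat.zero_add]
  refine Summable.of_nat_of_neg ?_ ?_
  · simpa using h1
  · simpa using h1

end BoxSum

/-! ### Fluctuations and correlations -/

section Fluct

variable {d : ℕ} [NeZero d] {φ : UHF d →ₗ[ℂ] ℂ}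

/-- The correlation `φ(τ_k(A) B) - φ(A) φ(B)`. -/
def cov (φ : UHF d →ₗ[ℂ] ℂ) (A B : UHF d) (k : ℤ) : ℂ := φ (translate k A * B) - φ A * φ B

/-- The fluctuation as a linear map. -/
def fluctLin (φ : UHF d →ₗ[ℂ] ℂ) (N : ℕ) : UHF d →ₗ[ℂ] UHF d where
  toFun := fluct φ N
  map_add' A B := by
    simp only [fluct, ← smul_add, ← Finset.sum_add_distrib, map_add]
    congr 1
    exact Finset.sum_congr rfl fun j _ => by abel
  map_smul' z A := by
    simp only [fluct, map_smul, RingHom.id_apply, smul_comm z, Finset.smul_sum, smul_sub]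
    refine Finset.sum_congr rfl fun j _ => ?_
    rw [smul_eq_mul, map_mul, ← Algebra.smul_def]

theorem fluct_add (N : ℕ) (A B : UHF d) : fluct φ N (A + B) = fluct φ N A + fluct φ N B :=
  map_add (fluctLin φ N) A B

theorem fluct_sub (N : ℕ) (A B : UHF d) : fluct φ N (A - B) = fluct φ N A - fluct φ N B :=
  map_sub (fluctLin φ N) A B

theorem fluct_smul (N : ℕ) (z : ℂ) (A : UHF d) : fluct φ N (z • A) = z • fluct φ N A :=
  map_smul (fluctLin φ N) z A

theorem fluct_sum {ι : Type*} (N : ℕ) (s : Finset ι) (A : ι → UHF d) :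
    fluct φ N (∑ i ∈ s, A i) = ∑ i ∈ s, fluct φ N (A i) :=
  map_sum (fluctLin φ N) A s

theorem star_fluct (hφ : IsNormalizedPositive φ) (N : ℕ) (A : UHF d) :
    star (fluct φ N A) = fluct φ N (star A) := by
  rw [fluct, fluct, star_smul, star_sum, Complex.star_def, Complex.conj_ofReal]
  refine congrArg _ (Finset.sum_congr rfl fun j _ => ?_)
  rw [star_sub, map_star, hφ.apply_star, algebraMap_star_comm]

theorem isSelfAdjoint_fluct (hφ : IsNormalizedPositive φ) (N : ℕ) {A : UHF d}
    (hA : IsSelfAdjoint A) : IsSelfAdjoint (fluct φ N A) := by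
  rw [IsSelfAdjoint, star_fluct hφ, hA.star_eq]

theorem inv_sqrt_mul_inv_sqrt (N : ℕ) :
    ((1 / Real.sqrt (2 * N + 1) : ℝ) : ℂ) * ((1 / Real.sqrt (2 * N + 1) : ℝ) : ℂ) =
      ((2 * N + 1 : ℝ) : ℂ)⁻¹ := by
  rw [← Complex.ofReal_mul, ← Complex.ofReal_inv, div_mul_div_comm, one_mul,
    Real.mul_self_sqrt (by positivity), one_div]

theorem map_fluct_mul_fluct (hφ : IsNormalizedPositive φ) (hτ : IsTranslationInvariant φ) (N : ℕ)
    (A B : UHF d) : φ (fluct φ N A * fluct φ N B) = ((2 * N + 1 : ℝ) : ℂ)⁻¹ *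
      ∑ i ∈ Finset.Icc (-(N : ℤ)) N, ∑ j ∈ Finset.Icc (-(N : ℤ)) N, cov φ A B (i - j) := by
  rw [fluct, fluct, smul_mul_smul_comm, inv_sqrt_mul_inv_sqrt, map_smul, smul_eq_mul,
    Finset.sum_mul_sum, map_sum]
  refine congrArg _ (Finset.sum_congr rfl fun i _ => ?_)
  rw [map_sum]
  refine Finset.sum_congr rfl fun j _ => ?_
  have h : translate i A * translate j B = translate j (translate (i - j) A * B) := by
    rw [map_mul, translate_translate, add_sub_cancel]
  rw [sub_mul, mul_sub, mul_sub, h, cov]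
  simp only [map_sub, Algebra.algebraMap_eq_smul_one, smul_mul_assoc, mul_smul_comm, one_mul,
    mul_one, map_smul, smul_eq_mul, hτ j, hτ i, hφ.map_one]
  ring

theorem comm_fluct (N : ℕ) (A B : UHF d) :
    fluct φ N A * fluct φ N B - fluct φ N B * fluct φ N A = ((2 * N + 1 : ℝ) : ℂ)⁻¹ •
      ∑ i ∈ Finset.Icc (-(N : ℤ)) N, ∑ j ∈ Finset.Icc (-(N : ℤ)) N,
        (translate i A * translate j B - translate j B * translate i A) := by
  rw [fluct, fluct, smul_mul_smul_comm, smul_mul_smul_comm, inv_sqrt_mul_inv_sqrt,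
    Finset.sum_mul_sum, Finset.sum_mul_sum, ← smul_sub]
  rw [Finset.sum_comm (f := fun i j => (translate i B - _) * (translate j A - _)),
    ← Finset.sum_sub_distrib]
  refine congrArg _ (Finset.sum_congr rfl fun i _ => ?_)
  rw [← Finset.sum_sub_distrib]
  refine Finset.sum_congr rfl fun j _ => ?_
  simp only [sub_mul, mul_sub, Algebra.algebraMap_eq_smul_one, smul_mul_assoc, mul_smul_comm,
    one_mul, mul_one, smul_sub]
  rw [smul_comm (φ A) (φ B)]
  abel

theorem norm_comm_translate (A B : UHF d) (i j : ℤ) :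
    ‖translate i A * translate j B - translate j B * translate i A‖ =
      ‖translate (i - j) A * B - B * translate (i - j) A‖ := by
  rw [← norm_translate j (translate (i - j) A * B - B * translate (i - j) A), map_sub, map_mul,
    map_mul, translate_translate, add_sub_cancel]

/-- The double sum over the box has at most `2N+1` times the mass of `g`, and the normalisations
cancel this factor. The bound does not depend on `N`. -/
theorem norm_comm_fluct_le (N : ℕ) (A B : UHF d) {g : ℤ → ℝ} (hg : Summable g)
    (h : ∀ k, ‖translate k A * B - B * translate k A‖ ≤ g k) :
    ‖fluct φ N A * fluct φ N B - fluct φ N B * fluct φ N A‖ ≤ ∑' k, g k := by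
  have h0 : ∀ k, 0 ≤ g k := fun k => (norm_nonneg _).trans (h k)
  have hpos : (0 : ℝ) < 2 * N + 1 := by positivity
  rw [comm_fluct, norm_smul, norm_inv, Complex.norm_real, Real.norm_eq_abs, abs_of_pos hpos,
    inv_mul_le_iff₀ hpos]
  refine le_trans ?_ (sum_box_sub_le h0 hg N)
  refine (norm_sum_le _ _).trans (Finset.sum_le_sum fun i _ => ?_)
  refine (norm_sum_le _ _).trans (Finset.sum_le_sum fun j _ => ?_)
  rw [norm_comm_translate]
  exact h _

theorem norm_map_fluct_mul_fluct_le (hφ : IsNormalizedPositive φ) (hτ : IsTranslationInvariant φ)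
    (N : ℕ) (A B : UHF d) {g : ℤ → ℝ} (hg : Summable g) (h : ∀ k, ‖cov φ A B k‖ ≤ g k) :
    ‖φ (fluct φ N A * fluct φ N B)‖ ≤ ∑' k, g k := by
  have h0 : ∀ k, 0 ≤ g k := fun k => (norm_nonneg _).trans (h k)
  have hpos : (0 : ℝ) < 2 * N + 1 := by positivity
  rw [map_fluct_mul_fluct hφ hτ, norm_mul, norm_inv, Complex.norm_real, Real.norm_eq_abs,
    abs_of_pos hpos, inv_mul_le_iff₀ hpos]
  refine le_trans ?_ (sum_box_sub_le h0 hg N)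
  refine (norm_sum_le _ _).trans (Finset.sum_le_sum fun i _ => ?_)
  exact (norm_sum_le _ _).trans (Finset.sum_le_sum fun j _ => h _)

theorem tendsto_map_fluct_mul_fluct (hφ : IsNormalizedPositive φ) (hτ : IsTranslationInvariant φ)
    {A B : UHF d} (h : Summable (cov φ A B)) :
    Tendsto (fun N => φ (fluct φ N A * fluct φ N B)) atTop (𝓝 (∑' k, cov φ A B k)) := by
  simp only [map_fluct_mul_fluct hφ hτ]
  exact tendsto_inv_mul_sum_box_sub h

/-- Translating the second product by `-k` expresses the commutator form through covariances; its
convergence is then inherited from theirs. -/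
theorem commTerm_eq (hτ : IsTranslationInvariant φ) (A B : UHF d) (k : ℤ) :
    commTerm φ A B k = cov φ A B k - cov φ B A (-k) := by
  have h : φ (B * translate k A) = φ (translate (-k) B * A) := by
    rw [← hτ (-k), map_mul, translate_translate, neg_add_cancel, translate_zero]
  rw [commTerm, cov, cov, map_sub, h]
  ring

end Fluct

/-! ### Summably approximable observables -/

section Approximable

variable {d : ℕ} [NeZero d] {φ : UHF d →ₗ[ℂ] ℂ}

/-- An antitone summable sequence. -/
structure IsRate (δ : ℕ → ℝ) : Prop where
  antitone : Antitone δ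
  summable : Summable δ

theorem IsRate.nonneg {δ : ℕ → ℝ} (h : IsRate δ) (m : ℕ) : 0 ≤ δ m :=
  h.antitone.le_of_tendsto h.summable.tendsto_atTop_zero m

theorem IsRate.add {δ δ' : ℕ → ℝ} (h : IsRate δ) (h' : IsRate δ') : IsRate (δ + δ') :=
  ⟨h.antitone.add h'.antitone, h.summable.add h'.summable⟩

/-- `Q` is within `δ m` of the algebra `𝒜_{[-m,m]}`, and `‖Q‖ ≤ δ 0`. -/
structure IsApproximable (δ : ℕ → ℝ) (Q : UHF d) : Prop where
  norm_le : ‖Q‖ ≤ δ 0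
  exists_near : ∀ m : ℕ, ∃ R ∈ localAlg d (Set.Icc (-(m : ℤ)) m), ‖Q - R‖ ≤ δ m

namespace IsApproximable

variable {δ δ' : ℕ → ℝ} {A B : UHF d}

theorem mono (h : IsApproximable δ A) (hδ : ∀ m, δ m ≤ δ' m) : IsApproximable δ' A :=
  ⟨h.norm_le.trans (hδ 0), fun m =>
    let ⟨R, h1, h2⟩ := h.exists_near m
    ⟨R, h1, h2.trans (hδ m)⟩⟩

theorem star (h : IsApproximable δ A) : IsApproximable δ (star A) := by
  refine ⟨by rw [norm_star]; exact h.norm_le, fun m => ?_⟩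
  obtain ⟨R, h1, h2⟩ := h.exists_near m
  exact ⟨Star.star R, star_mem h1, by rwa [← star_sub, norm_star]⟩

theorem add (hA : IsApproximable δ A) (hB : IsApproximable δ' B) :
    IsApproximable (δ + δ') (A + B) := by
  refine ⟨(norm_add_le _ _).trans (add_le_add hA.norm_le hB.norm_le), fun m => ?_⟩
  obtain ⟨R, h1, h2⟩ := hA.exists_near m
  obtain ⟨S, h3, h4⟩ := hB.exists_near m
  refine ⟨R + S, add_mem h1 h3, ?_⟩
  rw [add_sub_add_comm]
  exact (norm_add_le _ _).trans (add_le_add h2 h4)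

theorem exists_near_norm_le (hδ : IsRate δ) (h : IsApproximable δ A) (m : ℕ) :
    ∃ R ∈ localAlg d (Set.Icc (-(m : ℤ)) m), ‖A - R‖ ≤ δ m ∧ ‖R‖ ≤ 2 * δ 0 := by
  obtain ⟨R, h1, h2⟩ := h.exists_near m
  refine ⟨R, h1, h2, ?_⟩
  have h3 := norm_sub_le A (A - R)
  rw [sub_sub_cancel] at h3
  linarith [h.norm_le, hδ.antitone (Nat.zero_le m)]

/-- The error of a local approximation is approximable with the same rate. -/
theorem sub_near (hδ : IsRate δ) (h : IsApproximable δ A) {l : ℕ} {R : UHF d}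
    (hR : R ∈ localAlg d (Set.Icc (-(l : ℤ)) l)) (hAR : ‖A - R‖ ≤ δ l) :
    IsApproximable δ (A - R) := by
  refine ⟨hAR.trans (hδ.antitone (Nat.zero_le l)), fun m => ?_⟩
  -- Beyond radius `l` the approximant `S - R` leaves the same error as `S` leaves for `A`; below
  -- it, zero is good enough. The rate thus does not depend on `l`.
  rcases le_total l m with hlm | hml
  · obtain ⟨S, h1, h2⟩ := h.exists_near m
    refine ⟨S - R, sub_mem h1 (localAlg_mono (Set.Icc_subset_Icc ?_ ?_) hR), ?_⟩
    · omega
    · omega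
    · rwa [sub_sub_sub_cancel_right]
  · exact ⟨0, zero_mem _, by rw [sub_zero]; exact hAR.trans (hδ.antitone hml)⟩

theorem near (hδ : IsRate δ) (h : IsApproximable δ A) {l : ℕ} {R : UHF d}
    (hR : R ∈ localAlg d (Set.Icc (-(l : ℤ)) l)) (hAR : ‖A - R‖ ≤ δ l) :
    IsApproximable (δ + δ) R := by
  have h1 : R = A + -(A - R) := by abel
  have h2 := sub_near hδ h hR hAR
  have h3 : IsApproximable δ (-(A - R)) := by
    refine ⟨by rw [norm_neg]; exact h2.norm_le, fun m => ?_⟩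
    obtain ⟨S, h4, h5⟩ := h2.exists_near m
    exact ⟨-S, neg_mem h4, by rwa [← neg_add', norm_neg, ← sub_eq_add_neg]⟩
  rw [h1]
  exact h.add h3

end IsApproximable

/-- The bound for the commutators of approximable elements. -/
def commBound (δ : ℕ → ℝ) (k : ℤ) : ℝ := 6 * δ 0 * δ (k.natAbs / 4)

/-- The bound for the correlations of approximable elements. -/
def covBound (ρ δ : ℕ → ℝ) (k : ℤ) : ℝ :=
  6 * δ 0 * δ (k.natAbs / 4) + 4 * δ 0 ^ 2 * ρ (k.natAbs / 2)

theorem summable_commBound {δ : ℕ → ℝ} (hδ : IsRate δ) : Summable (commBound δ) :=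
  (summable_comp_natAbs_div hδ.summable (by norm_num)).mul_left _

theorem IntervalClustering.summable_covBound {ρ δ : ℕ → ℝ} (hρ : IntervalClustering φ ρ)
    (hδ : IsRate δ) : Summable (covBound ρ δ) :=
  ((summable_comp_natAbs_div hδ.summable (by norm_num)).mul_left _).add
    ((summable_comp_natAbs_div hρ.summable_self (by norm_num)).mul_left _)

variable {ρ δ : ℕ → ℝ} {A B : UHF d}

theorem norm_comm_le (A B : UHF d) : ‖A * B - B * A‖ ≤ 2 * ‖A‖ * ‖B‖ := by
  refine (norm_sub_le _ _).trans ?_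
  linarith [norm_mul_le A B, norm_mul_le B A, mul_comm ‖A‖ ‖B‖]

/-- Approximants of radius `|k|/4` at distance `|k| > 0` commute. The replacement errors are `2δδ₀`
and `4δδ₀`, the latter because an approximant has norm at most `2δ₀`. -/
theorem IsApproximable.norm_comm_translate_le (hδ : IsRate δ) (hA : IsApproximable δ A)
    (hB : IsApproximable δ B) (k : ℤ) :
    ‖translate k A * B - B * translate k A‖ ≤ commBound δ k := by
  have h0 := hδ.nonneg 0
  rcases eq_or_ne k 0 with rfl | hk
  · refine (norm_comm_le _ _).trans ?_
    rw [norm_translate, commBound, Int.natAbs_zero, Nat.zero_div]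
    have := mul_le_mul hA.norm_le hB.norm_le (norm_nonneg _) h0
    nlinarith [mul_self_nonneg (δ 0)]
  obtain ⟨R, hR, hR1, hR2⟩ := hA.exists_near_norm_le hδ (k.natAbs / 4)
  obtain ⟨S, hS, hS1, hS2⟩ := hB.exists_near_norm_le hδ (k.natAbs / 4)
  have hR' : translate k R ∈ localAlg d
      (Set.Icc (k - ((k.natAbs / 4 : ℕ) : ℤ)) (k + ((k.natAbs / 4 : ℕ) : ℤ))) := by
    have := translate_mem_Icc (j := k) hR
    rwa [← sub_eq_add_neg] at this
  have hS' : S ∈ localAlg d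
      (Set.Icc (0 - ((k.natAbs / 4 : ℕ) : ℤ)) (0 + ((k.natAbs / 4 : ℕ) : ℤ))) := by
    rwa [zero_sub, zero_add]
  have hc : translate k R * S - S * translate k R = 0 :=
    sub_eq_zero.mpr (commute_Icc (by rw [sub_zero, Int.abs_eq_natAbs]; omega) hR' hS').eq
  have e : translate k A * B - B * translate k A =
      (translate k (A - R) * B - B * translate k (A - R)) +
        (translate k R * (B - S) - (B - S) * translate k R) +
          (translate k R * S - S * translate k R) := by
    rw [map_sub]; noncomm_ring
  rw [e, hc, add_zero, commBound]
  refine (norm_add_le _ _).trans ((add_le_add (norm_comm_le _ _) (norm_comm_le _ _)).trans ?_)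
  rw [norm_translate, norm_translate]
  have h1 := mul_le_mul hR1 hB.norm_le (norm_nonneg _) (hδ.nonneg _)
  have h2 := mul_le_mul hR2 hS1 (norm_nonneg _) (by linarith)
  linarith

/-- The radii `|k|/4` leave a gap of at least `|k|/2` between the approximants, whose norms are at
most `2δ₀` each. The replacement errors are those of the commutator estimate. -/
theorem IntervalClustering.norm_cov_le (hρ : IntervalClustering φ ρ)
    (hφ : IsNormalizedPositive φ) (hτ : IsTranslationInvariant φ) (hδ : IsRate δ)
    (hA : IsApproximable δ A) (hB : IsApproximable δ B) (k : ℤ) :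
    ‖cov φ A B k‖ ≤ covBound ρ δ k := by
  have h0 := hδ.nonneg 0
  obtain ⟨R, hR, hR1, hR2⟩ := hA.exists_near_norm_le hδ (k.natAbs / 4)
  obtain ⟨S, hS, hS1, hS2⟩ := hB.exists_near_norm_le hδ (k.natAbs / 4)
  have hR' : translate k R ∈ localAlg d
      (Set.Icc (k - ((k.natAbs / 4 : ℕ) : ℤ)) (k + ((k.natAbs / 4 : ℕ) : ℤ))) := by
    have := translate_mem_Icc (j := k) hR
    rwa [← sub_eq_add_neg] at this
  have hS' : S ∈ localAlg d
      (Set.Icc (0 - ((k.natAbs / 4 : ℕ) : ℤ)) (0 + ((k.natAbs / 4 : ℕ) : ℤ))) := by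
    rwa [zero_sub, zero_add]
  have h3 := hρ.norm_cov_Icc_le hφ (g := k.natAbs / 2) (Or.inl (by rw [sub_zero, Int.abs_eq_natAbs]; omega)) hR' hS'
  have e : cov φ A B k =
      (φ (translate k (A - R) * B) - φ (translate k (A - R)) * φ B) +
        (φ (translate k R * (B - S)) - φ (translate k R) * φ (B - S)) +
          (φ (translate k R * S) - φ (translate k R) * φ S) := by
    simp only [cov, map_sub, sub_mul, mul_sub, hτ k]
    ring
  rw [e, covBound]
  refine (norm_add₃_le).trans ((add_le_add_three (norm_cov_le_two_mul hφ _ _)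
    (norm_cov_le_two_mul hφ _ _) h3).trans ?_)
  rw [norm_translate, norm_translate]
  have h1 := mul_le_mul hR1 hB.norm_le (norm_nonneg _) (hδ.nonneg _)
  have h2 := mul_le_mul hR2 hS1 (norm_nonneg _) (by linarith)
  have h4 := mul_le_mul_of_nonneg_left (mul_le_mul hR2 hS2 (norm_nonneg _) (by linarith))
    (hρ.nonneg (k.natAbs / 2))
  nlinarith

theorem IntervalClustering.summable_cov (hρ : IntervalClustering φ ρ)
    (hφ : IsNormalizedPositive φ) (hτ : IsTranslationInvariant φ) (hδ : IsRate δ)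
    (hA : IsApproximable δ A) (hB : IsApproximable δ B) : Summable (cov φ A B) :=
  Summable.of_norm_bounded (hρ.summable_covBound hδ) fun k => hρ.norm_cov_le hφ hτ hδ hA hB k

/-- The fluctuations of small, uniformly approximable elements are uniformly small in the seminorm
of the state. -/
theorem IntervalClustering.exists_stateNorm_fluct_le (hρ : IntervalClustering φ ρ)
    (hφ : IsNormalizedPositive φ) (hτ : IsTranslationInvariant φ) (hδ : IsRate δ)
    {E : ℕ → UHF d} (hE : ∀ l, IsApproximable δ (E l)) (h0 : Tendsto (fun l => ‖E l‖) atTop (𝓝 0)) :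
    ∃ b : ℕ → ℝ, Tendsto b atTop (𝓝 0) ∧ ∀ l N, stateNorm φ (fluct φ N (E l)) ≤ b l := by
  set b : ℕ → ℝ := fun l => ∑' k, ‖cov φ (star (E l)) (E l) k‖ with hb
  have hcov : ∀ l k, ‖cov φ (star (E l)) (E l) k‖ ≤ covBound ρ δ k := fun l k =>
    hρ.norm_cov_le hφ hτ hδ (hE l).star (hE l) k
  -- The common rate dominates all covariances independently of `l`, while each of them vanishes
  -- with `‖E l‖²`.
  have hlim : Tendsto b atTop (𝓝 (∑' _ : ℤ, (0 : ℝ))) := by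
    refine tendsto_tsum_of_dominated_convergence (hρ.summable_covBound hδ) (fun k => ?_)
      (Eventually.of_forall fun l k => by rw [norm_norm]; exact hcov l k)
    have h1 := (h0.mul h0).const_mul 2
    rw [mul_zero, mul_zero] at h1
    refine squeeze_zero (fun l => norm_nonneg _) (fun l => ?_) h1
    have h2 := norm_cov_le_two_mul hφ (translate k (star (E l))) (E l)
    rw [hτ, norm_translate, norm_star, mul_assoc] at h2
    exact h2
  rw [tsum_zero] at hlim
  refine ⟨fun l => √(b l), ?_, fun l N => ?_⟩
  · simpa using hlim.sqrt
  · refine Real.le_sqrt_of_sq_le ?_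
    have h1 := norm_map_fluct_mul_fluct_le hφ hτ N (star (E l)) (E l)
      (Summable.of_nonneg_of_le (fun k => norm_nonneg _) (hcov l) (hρ.summable_covBound hδ))
      fun k => le_rfl
    rwa [← star_fluct hφ, ← hφ.stateNorm_sq, Complex.norm_real, Real.norm_eq_abs,
      abs_of_nonneg (sq_nonneg _)] at h1

/-- The commutators of the fluctuations of small elements are uniformly small. -/
theorem exists_norm_comm_fluct_le (hδ : IsRate δ) {E F : ℕ → UHF d}
    (hE : ∀ l, IsApproximable δ (E l)) (hF : ∀ l, IsApproximable δ (F l))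
    (h0 : Tendsto (fun l => ‖E l‖) atTop (𝓝 0)) :
    ∃ b : ℕ → ℝ, Tendsto b atTop (𝓝 0) ∧ ∀ l N,
      ‖fluct φ N (E l) * fluct φ N (F l) - fluct φ N (F l) * fluct φ N (E l)‖ ≤ b l := by
  have hc : ∀ l k, ‖translate k (E l) * F l - F l * translate k (E l)‖ ≤ commBound δ k :=
    fun l k => (hE l).norm_comm_translate_le hδ (hF l) k
  refine ⟨fun l => ∑' k, ‖translate k (E l) * F l - F l * translate k (E l)‖, ?_, fun l N => ?_⟩
  · rw [← tsum_zero (α := ℝ) (β := ℤ)]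
    refine tendsto_tsum_of_dominated_convergence (summable_commBound hδ) (fun k => ?_)
      (Eventually.of_forall fun l k => by rw [norm_norm]; exact hc l k)
    have h1 := (h0.mul_const (δ 0)).const_mul 2
    rw [zero_mul, mul_zero] at h1
    refine squeeze_zero (fun l => norm_nonneg _) (fun l => (norm_comm_le _ _).trans ?_) h1
    rw [norm_translate, mul_assoc]
    exact mul_le_mul_of_nonneg_left
      (mul_le_mul_of_nonneg_left (hF l).norm_le (norm_nonneg _)) two_pos.le
  · exact norm_comm_fluct_le N (E l) (F l)
      (Summable.of_nonneg_of_le (fun k => norm_nonneg _) (hc l) (summable_commBound hδ))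
      fun k => le_rfl

/-- Self-adjoint local approximations of a self-adjoint element. -/
theorem IsApproximable.exists_selfAdjoint_near (h : IsApproximable δ A) (hA : IsSelfAdjoint A)
    (m : ℕ) : ∃ R ∈ localAlg d (Set.Icc (-(m : ℤ)) m), IsSelfAdjoint R ∧ ‖A - R‖ ≤ δ m := by
  obtain ⟨R, h1, h2⟩ := h.exists_near m
  have h3 : ‖A - Star.star R‖ ≤ δ m := by
    rwa [← norm_star, star_sub, star_star, hA.star_eq]
  refine ⟨(2 : ℂ)⁻¹ • (R + Star.star R), SMulMemClass.smul_mem _ (add_mem h1 (star_mem h1)), ?_, ?_⟩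
  · refine IsSelfAdjoint.smul ?_ (IsSelfAdjoint.add_star_self R)
    simp [IsSelfAdjoint]
  · have e : A - (2 : ℂ)⁻¹ • (R + Star.star R) = (2 : ℂ)⁻¹ • ((A - R) + (A - Star.star R)) := by
      module
    rw [e, norm_smul, norm_inv, Complex.norm_ofNat, inv_mul_le_iff₀ two_pos, two_mul]
    exact (norm_add_le _ _).trans (add_le_add h2 h3)

theorem IsExpLocalized.exists_isApproximable {θ : ℝ} (h0 : 0 < θ) (h1 : θ < 1) {Q : UHF d}
    (h : IsExpLocalized θ Q) : ∃ δ, IsRate δ ∧ IsApproximable δ Q := by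
  have hnn : ∀ n, 0 ≤ tailNorm n Q := fun n => by
    rw [tailNorm]
    split_ifs
    · exact norm_nonneg _
    · exact Real.sInf_nonneg (by rintro _ ⟨R, _, rfl⟩; exact norm_nonneg _)
  set C := ∑' n : ℕ, tailNorm n Q * (θ ^ n)⁻¹ with hC
  have hCn : ∀ n, tailNorm n Q ≤ C * θ ^ n := fun n => by
    have h2 := h.le_tsum n fun j _ => mul_nonneg (hnn j) (by positivity)
    rwa [← div_eq_mul_inv, div_le_iff₀ (by positivity)] at h2
  have hC0 : 0 ≤ C := tsum_nonneg fun n => mul_nonneg (hnn n) (by positivity)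
  -- The infimum in `tailNorm` need not be attained; the extra `θ^n` provides an element that nearly
  -- attains it.
  refine ⟨fun n => (C + 1) * θ ^ n, ⟨fun m n hmn => ?_, ?_⟩, ?_, fun m => ?_⟩
  · exact mul_le_mul_of_nonneg_left (pow_le_pow_of_le_one h0.le h1.le hmn) (by linarith)
  · exact (summable_geometric_of_lt_one h0.le h1).mul_left _
  · have := hCn 0
    simp only [tailNorm, if_true, pow_zero, mul_one] at this ⊢
    linarith
  · rcases Nat.eq_zero_or_pos m with rfl | hm
    · refine ⟨0, zero_mem _, ?_⟩
      have := hCn 0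
      simp only [tailNorm, if_true, pow_zero, mul_one, sub_zero] at this ⊢
      linarith
    · have h2 := hCn m
      rw [tailNorm, if_neg hm.ne'] at h2
      obtain ⟨_, ⟨R, hR, rfl⟩, h3⟩ := Real.lt_sInf_add_pos
        (s := {x : ℝ | ∃ R ∈ localAlg d (Set.Icc (-(m : ℤ)) m), x = ‖Q - R‖})
        ⟨‖Q - 0‖, 0, zero_mem _, rfl⟩ (pow_pos h0 m)
      exact ⟨R, hR, by linarith⟩

theorem IsStrictlyLocal.exists_mem_Icc {Q : UHF d} (h : IsStrictlyLocal Q) :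
    ∃ m : ℕ, Q ∈ localAlg d (Set.Icc (-(m : ℤ)) m) := by
  obtain ⟨Λ, hΛ, hQ⟩ := h
  obtain ⟨a, ha⟩ := hΛ.bddBelow
  obtain ⟨b, hb⟩ := hΛ.bddAbove
  refine ⟨max a.natAbs b.natAbs, localAlg_mono (fun k hk => ?_) hQ⟩
  have := ha hk
  have := hb hk
  exact ⟨by omega, by omega⟩

/-- The rate of the elements of norm at most `D` of `𝒜_{[-m,m]}`. -/
def stepRate (D : ℝ) (m n : ℕ) : ℝ := if n < m + 1 then D else 0

theorem isRate_stepRate {D : ℝ} (hD : 0 ≤ D) (m : ℕ) : IsRate (stepRate D m) := by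
  refine ⟨fun i j hij => ?_, ?_⟩
  · rw [stepRate, stepRate]
    split_ifs <;> first | omega | exact le_rfl
  · exact summable_of_hasFiniteSupport ((Set.finite_lt_nat (m + 1)).subset fun n hn => by
      by_contra hlt
      exact hn (if_neg hlt))

theorem isApproximable_stepRate {D : ℝ} {m : ℕ} {Q : UHF d}
    (h : Q ∈ localAlg d (Set.Icc (-(m : ℤ)) m)) (hQ : ‖Q‖ ≤ D) :
    IsApproximable (stepRate D m) Q := by
  refine ⟨by simpa [stepRate] using hQ, fun n => ?_⟩
  by_cases hn : n < m + 1
  · exact ⟨0, zero_mem _, by simpa [stepRate, hn] using hQ⟩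
  · exact ⟨Q, localAlg_mono (Set.Icc_subset_Icc (by omega) (by omega)) h, by simp [stepRate, hn]⟩

theorem isApproximable_of_mem_Icc {m : ℕ} {Q : UHF d}
    (h : Q ∈ localAlg d (Set.Icc (-(m : ℤ)) m)) : ∃ δ, IsRate δ ∧ IsApproximable δ Q :=
  ⟨stepRate ‖Q‖ m, isRate_stepRate (norm_nonneg Q) m, isApproximable_stepRate h le_rfl⟩

end Approximable

/-! ### The central limit theorem for local observables -/

section LocalCLT

variable {d : ℕ} [NeZero d] {φ : UHF d →ₗ[ℂ] ℂ} {ρ : ℕ → ℝ}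

theorem mul_mem_Iic {a b c : ℤ} {A B : UHF d} (hA : A ∈ localAlg d (Set.Iic a))
    (hB : B ∈ localAlg d (Set.Iic b)) (ha : a ≤ c) (hb : b ≤ c) :
    A * B ∈ localAlg d (Set.Iic c) :=
  mul_mem (localAlg_mono (Set.Iic_subset_Iic.mpr ha) hA)
    (localAlg_mono (Set.Iic_subset_Iic.mpr hb) hB)

theorem mul_mem_Ici {a b c : ℤ} {A B : UHF d} (hA : A ∈ localAlg d (Set.Ici a))
    (hB : B ∈ localAlg d (Set.Ici b)) (ha : c ≤ a) (hb : c ≤ b) :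
    A * B ∈ localAlg d (Set.Ici c) :=
  mul_mem (localAlg_mono (Set.Ici_subset_Ici.mpr ha) hA)
    (localAlg_mono (Set.Ici_subset_Ici.mpr hb) hB)

theorem commute_Iic_Icc {a u v : ℤ} (h : a < u) {A B : UHF d} (hA : A ∈ localAlg d (Set.Iic a))
    (hB : B ∈ localAlg d (Set.Icc u v)) : Commute A B :=
  commute_of_mem_localAlg (Set.disjoint_left.mpr fun i (h1 : i ≤ a) h2 => by
    linarith [h2.1]) hA hB

namespace IntervalClustering

/-- A local element decouples from a product of contractions far to the left and far to the
right. -/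
theorem norm_cov_mul_le (hρ : IntervalClustering φ ρ) (hφ : IsNormalizedPositive φ)
    {u v a b : ℤ} {g : ℕ} (hg : 0 < g) (huv : u ≤ v) (ha : a + g ≤ u) (hb : v + g ≤ b)
    {W L R : UHF d} (hW : W ∈ localAlg d (Set.Icc u v)) (hL : L ∈ localAlg d (Set.Iic a))
    (hR : R ∈ localAlg d (Set.Ici b)) (hL1 : ‖L‖ ≤ 1) (hR1 : ‖R‖ ≤ 1) :
    ‖φ (W * (L * R)) - φ W * φ (L * R)‖ ≤ 3 * ρ g * ‖W‖ := by
  have hc : Commute L W := commute_Iic_Icc (by omega) hL hW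
  have hW1 := localAlg_mono (Set.Icc_subset_Iic_self) hW
  have hW2 := localAlg_mono (Set.Icc_subset_Ici_self) hW
  have h1 := hρ.bound v b g hb _ (mul_mem_Iic hL hW1 (by omega) le_rfl) R hR
  have h2 := hρ.bound a u g ha L hL W hW2
  have h3 := hρ.bound a b g (by omega) L hL R hR
  -- Each link of the chain `φ(LWR) ≈ φ(LW)φ(R) ≈ φ(L)φ(W)φ(R) ≈ φ(W)φ(LR)` costs one `ρ g`.
  have e : φ (W * (L * R)) - φ W * φ (L * R) = (φ (L * W * R) - φ (L * W) * φ R) +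
      (φ (L * W) - φ L * φ W) * φ R + φ W * (φ L * φ R - φ (L * R)) := by
    rw [← mul_assoc, ← hc.eq]; ring
  have hρ0 := hρ.nonneg g
  have n1 : ‖φ (L * W * R) - φ (L * W) * φ R‖ ≤ ρ g * ‖W‖ := by
    refine h1.trans ?_
    have : ‖L * W‖ ≤ ‖W‖ :=
      (norm_mul_le _ _).trans (mul_le_of_le_one_left (norm_nonneg _) hL1)
    calc ρ g * ‖L * W‖ * ‖R‖ ≤ ρ g * ‖L * W‖ * 1 := by gcongr
      _ ≤ ρ g * ‖W‖ := by rw [mul_one]; gcongr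
  have n2 : ‖(φ (L * W) - φ L * φ W) * φ R‖ ≤ ρ g * ‖W‖ := by
    rw [norm_mul]
    calc _ ≤ ρ g * ‖L‖ * ‖W‖ * 1 := by
          gcongr; exact (hφ.norm_map_le R).trans hR1
      _ ≤ ρ g * 1 * ‖W‖ * 1 := by gcongr
      _ = _ := by ring
  have n3 : ‖φ W * (φ L * φ R - φ (L * R))‖ ≤ ρ g * ‖W‖ := by
    rw [norm_mul, norm_sub_rev, mul_comm]
    calc _ ≤ ρ g * ‖L‖ * ‖R‖ * ‖W‖ := by
          gcongr; exact hφ.norm_map_le W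
      _ ≤ ρ g * 1 * 1 * ‖W‖ := by gcongr
      _ = _ := by ring
  rw [e]
  refine norm_add₃_le.trans ?_
  linarith

/-- Two centred local elements at a large distance have a small correlation in the presence of
contractions that are far from the first of them. -/
theorem norm_map_mul_mul_le (hρ : IntervalClustering φ ρ) (hφ : IsNormalizedPositive φ)
    {i j a b : ℤ} {m g : ℕ} (hg : 0 < g) (ha : a + g ≤ j - m) (hb : j + m + g ≤ b)
    (hai : a ≤ i + m) (hbi : i - m ≤ b) (hij : (g : ℤ) + 2 * m ≤ |i - j|) {P S L R : UHF d}
    (hP : P ∈ localAlg d (Set.Icc (j - m) (j + m))) (hS : S ∈ localAlg d (Set.Icc (i - m) (i + m)))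
    (hP0 : φ P = 0) (hL : L ∈ localAlg d (Set.Iic a)) (hR : R ∈ localAlg d (Set.Ici b))
    (hL1 : ‖L‖ ≤ 1) (hR1 : ‖R‖ ≤ 1) :
    ‖φ (P * S * (L * R))‖ ≤ 2 * ρ g * ‖P‖ * ‖S‖ := by
  have hρ0 := hρ.nonneg g
  have hcP : Commute L P := commute_Iic_Icc (by omega) hL hP
  have hP1 := localAlg_mono (Set.Icc_subset_Iic_self) hP
  have hP2 := localAlg_mono (Set.Icc_subset_Ici_self) hP
  have hS1 := localAlg_mono (Set.Icc_subset_Iic_self) hS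
  have hS2 := localAlg_mono (Set.Icc_subset_Ici_self) hS
  -- If `S` lies to the right of `P`, it may overlap `R` but commutes with `L`: `L P` splits from `S
  -- R`, and then `L` from the centred `P`. If it lies to the left, it may overlap `L`, and the
  -- split is between `S L` and `P R`.
  rcases abs_cases (i - j) with ⟨h1, h2⟩ | ⟨h1, h2⟩
  · have hcS : Commute L S := commute_Iic_Icc (by omega) hL hS
    have e : P * S * (L * R) = L * P * (S * R) := by
      rw [mul_assoc, ← mul_assoc S, ← hcS.eq, mul_assoc L, ← mul_assoc, hcP.eq]
    have k1 := hρ.bound (j + m) (i - m) g (by omega) _ (mul_mem_Iic hL hP1 (by omega) le_rfl)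
      _ (mul_mem_Ici hS2 hR le_rfl hbi)
    have k2 := hρ.bound a (j - m) g ha L hL P hP2
    rw [hP0, mul_zero, sub_zero] at k2
    have k3 : ‖φ (L * P) * φ (S * R)‖ ≤ ρ g * ‖P‖ * ‖S‖ := by
      rw [norm_mul]
      calc _ ≤ ρ g * ‖L‖ * ‖P‖ * (‖S‖ * ‖R‖) := by
            gcongr; exact (hφ.norm_map_le _).trans (norm_mul_le _ _)
        _ ≤ ρ g * 1 * ‖P‖ * (‖S‖ * 1) := by gcongr
        _ = _ := by ring
    have k4 : ρ g * ‖L * P‖ * ‖S * R‖ ≤ ρ g * ‖P‖ * ‖S‖ := by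
      calc _ ≤ ρ g * (‖L‖ * ‖P‖) * (‖S‖ * ‖R‖) := by
            gcongr <;> exact norm_mul_le _ _
        _ ≤ ρ g * (1 * ‖P‖) * (‖S‖ * 1) := by gcongr
        _ = _ := by ring
    rw [e, show φ (L * P * (S * R)) = (φ (L * P * (S * R)) - φ (L * P) * φ (S * R)) +
      φ (L * P) * φ (S * R) by ring]
    refine (norm_add_le _ _).trans ?_
    linarith
  · have hPS : Commute S P := commute_Iic_Icc (by omega) hS1 hP
    have e : P * S * (L * R) = S * L * (P * R) := by
      rw [← hPS.eq, mul_assoc, ← mul_assoc P, ← hcP.eq]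
      simp only [mul_assoc]
    have k1 := hρ.bound (i + m) (j - m) g (by omega) _ (mul_mem_Iic hS1 hL le_rfl hai)
      _ (mul_mem_Ici hP2 hR le_rfl (by omega))
    have k2 := hρ.bound (j + m) b g hb P hP1 R hR
    rw [hP0, zero_mul, sub_zero] at k2
    have k3 : ‖φ (S * L) * φ (P * R)‖ ≤ ρ g * ‖P‖ * ‖S‖ := by
      rw [norm_mul]
      calc _ ≤ (‖S‖ * ‖L‖) * (ρ g * ‖P‖ * ‖R‖) := by
            gcongr; exact (hφ.norm_map_le _).trans (norm_mul_le _ _)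
        _ ≤ (‖S‖ * 1) * (ρ g * ‖P‖ * 1) := by gcongr
        _ = _ := by ring
    have k4 : ρ g * ‖S * L‖ * ‖P * R‖ ≤ ρ g * ‖P‖ * ‖S‖ := by
      calc _ ≤ ρ g * (‖S‖ * ‖L‖) * (‖P‖ * ‖R‖) := by
            gcongr <;> exact norm_mul_le _ _
        _ ≤ ρ g * (‖S‖ * 1) * (‖P‖ * 1) := by gcongr
        _ = _ := by ring
    rw [e, show φ (S * L * (P * R)) = (φ (S * L * (P * R)) - φ (S * L) * φ (P * R)) +
      φ (S * L) * φ (P * R) by ring]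
    refine (norm_add_le _ _).trans ?_
    linarith

/-- A pair of centred local elements inside a window decouples from a product of contractions
outside of the window. -/
theorem norm_cov_pair_le (hρ : IntervalClustering φ ρ) (hφ : IsNormalizedPositive φ)
    {i j : ℤ} {m l : ℕ} (hl : 4 * m + 2 ≤ l) (hij : |i - j| ≤ l) {P S L R : UHF d}
    (hP : P ∈ localAlg d (Set.Icc (j - m) (j + m))) (hS : S ∈ localAlg d (Set.Icc (i - m) (i + m)))
    (hP0 : φ P = 0) (hL : L ∈ localAlg d (Set.Iic (j - l - 1 + m)))
    (hR : R ∈ localAlg d (Set.Ici (j + l + 1 - m))) (hL1 : ‖L‖ ≤ 1) (hR1 : ‖R‖ ≤ 1) :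
    ‖φ (P * S * (L * R)) - φ (P * S) * φ (L * R)‖ ≤ 3 * ρ (l / 2 - 2 * m) * (‖P‖ * ‖S‖) := by
  have hρ0 := hρ.nonneg (l / 2 - 2 * m)
  -- At a distance of at least `l/2` both terms are small by themselves, with bounds `2ρ` and `ρ`.
  -- Otherwise the pair sits in a window of radius `l/2 + m`, which leaves a gap `l/2 - 2m` to the
  -- outside. The bound `4m + 2 ≤ l` makes this gap positive.
  rcases le_or_gt ((l / 2 : ℕ) : ℤ) |i - j| with h | h
  · have h1 := hρ.norm_map_mul_mul_le hφ (g := l / 2 - 2 * m) (i := i) (j := j) (m := m)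
      (a := j - l - 1 + m) (b := j + l + 1 - m) (by omega) (by omega) (by omega)
      (by have := abs_le.mp hij; omega) (by have := abs_le.mp hij; omega) (by omega)
      hP hS hP0 hL hR hL1 hR1
    have h2 := hρ.norm_cov_Icc_le hφ (g := l / 2 - 2 * m)
      (Or.inl (by rw [abs_sub_comm]; omega)) hP hS
    rw [hP0, zero_mul, sub_zero] at h2
    have h3 : ‖φ (L * R)‖ ≤ 1 := (hφ.norm_map_le _).trans
      ((norm_mul_le _ _).trans (mul_le_one₀ hL1 (norm_nonneg _) hR1))
    refine (norm_sub_le _ _).trans ?_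
    rw [norm_mul]
    have h4 := mul_le_of_le_one_right (norm_nonneg (φ (P * S))) h3
    linarith
  · have hw : P * S ∈ localAlg d (Set.Icc (j - (l / 2 : ℕ) - m) (j + (l / 2 : ℕ) + m)) := by
      have := abs_lt.mp h
      exact mul_mem (localAlg_mono (Set.Icc_subset_Icc (by omega) (by omega)) hP)
        (localAlg_mono (Set.Icc_subset_Icc (by omega) (by omega)) hS)
    refine (hρ.norm_cov_mul_le hφ (g := l / 2 - 2 * m) (by omega) (by omega) (by omega)
      (by omega) hw hL hR hL1 hR1).trans ?_
    exact mul_le_mul_of_nonneg_left (norm_mul_le _ _) (by linarith)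

end IntervalClustering

end LocalCLT

/-! ### Normalised sums of translates over finite sets of sites -/

section BlockSum

variable {d : ℕ} [NeZero d] {φ : UHF d →ₗ[ℂ] ℂ}

/-- The normalised sum of the translates by the elements of a finite set. -/
def blockSum (β : ℝ) (s : Finset ℤ) (Q : UHF d) : UHF d :=
  (β : ℂ) • ∑ i ∈ s, translate i Q

theorem fluct_eq_blockSum {Q : UHF d} (hQ : φ Q = 0) (N : ℕ) :
    fluct φ N Q = blockSum (1 / Real.sqrt (2 * N + 1)) (Finset.Icc (-(N : ℤ)) N) Q := by
  simp [fluct, blockSum, hQ]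

theorem isSelfAdjoint_blockSum (β : ℝ) (s : Finset ℤ) {Q : UHF d} (hQ : IsSelfAdjoint Q) :
    IsSelfAdjoint (blockSum β s Q) := by
  refine isSelfAdjoint_ofReal_smul β ?_
  rw [IsSelfAdjoint, star_sum]
  exact Finset.sum_congr rfl fun i _ => by rw [← map_star, hQ.star_eq]

theorem blockSum_mem {Λ : Set ℤ} (β : ℝ) {s : Finset ℤ} {Q : UHF d}
    (h : ∀ i ∈ s, translate i Q ∈ localAlg d Λ) : blockSum β s Q ∈ localAlg d Λ :=
  SMulMemClass.smul_mem _ (sum_mem h)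

theorem norm_blockSum_le {β : ℝ} (hβ : 0 ≤ β) (s : Finset ℤ) (Q : UHF d) :
    ‖blockSum β s Q‖ ≤ β * (s.card * ‖Q‖) := by
  rw [blockSum, norm_smul, Complex.norm_real, Real.norm_eq_abs, abs_of_nonneg hβ, ← nsmul_eq_mul]
  refine mul_le_mul_of_nonneg_left ((norm_sum_le _ _).trans ?_) hβ
  exact Finset.sum_le_card_nsmul _ _ _ fun i _ => (norm_translate i Q).le

/-- The sum over `s` is bounded by the whole series, so only the size of `t` enters. With `t` a
window this makes the commutator of near and far parts small. -/
theorem norm_comm_blockSum_le {β : ℝ} (s t : Finset ℤ) {Q : UHF d} {g : ℤ → ℝ}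
    (hg : Summable g) (h : ∀ k, ‖translate k Q * Q - Q * translate k Q‖ ≤ g k) :
    ‖blockSum β s Q * blockSum β t Q - blockSum β t Q * blockSum β s Q‖ ≤
      β ^ 2 * (t.card * ∑' k, g k) := by
  have h0 : ∀ k, 0 ≤ g k := fun k => (norm_nonneg _).trans (h k)
  have e : blockSum β s Q * blockSum β t Q - blockSum β t Q * blockSum β s Q =
      ((β ^ 2 : ℝ) : ℂ) • ∑ j ∈ t, ∑ i ∈ s,
        (translate i Q * translate j Q - translate j Q * translate i Q) := by
    rw [blockSum, blockSum, smul_mul_smul_comm, smul_mul_smul_comm, Finset.sum_mul_sum,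
      Finset.sum_mul_sum, ← smul_sub, Finset.sum_comm, ← Finset.sum_sub_distrib]
    simp only [Finset.sum_sub_distrib]
    push_cast
    rw [sq]
  rw [e, norm_smul, Complex.norm_real, Real.norm_eq_abs, abs_of_nonneg (sq_nonneg _),
    ← nsmul_eq_mul]
  refine mul_le_mul_of_nonneg_left ((norm_sum_le _ _).trans ?_) (sq_nonneg _)
  refine Finset.sum_le_card_nsmul _ _ _ fun j _ => ((norm_sum_le _ _).trans ?_)
  refine le_trans (Finset.sum_le_sum fun i _ => ?_) (sum_sub_le_tsum h0 hg s j)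
  rw [norm_comm_translate]
  exact h _

/-- The tail `∑_{|k| > l} g k`. -/
def tailSum (g : ℤ → ℝ) (l : ℕ) : ℝ := ∑' k : ℤ, if (l : ℤ) < |k| then g k else 0

theorem tendsto_tailSum {g : ℤ → ℝ} (hg : Summable g) : Tendsto (tailSum g) atTop (𝓝 0) := by
  rw [← tsum_zero (α := ℝ) (β := ℤ)]
  refine tendsto_tsum_of_dominated_convergence hg.norm (fun k => ?_)
    (Eventually.of_forall fun l k => ?_)
  · refine tendsto_const_nhds.congr' ?_
    filter_upwards [eventually_ge_atTop k.natAbs] with l hl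
    rw [if_neg (by rw [Int.abs_eq_natAbs]; omega)]
  · split_ifs
    · exact le_rfl
    · simp

theorem sum_far_le_tailSum {g : ℤ → ℝ} (h0 : ∀ k, 0 ≤ g k) (hg : Summable g) (s : Finset ℤ)
    (j : ℤ) (l : ℕ) : ∑ i ∈ s.filter (fun i => ¬ |i - j| ≤ l), g (i - j) ≤ tailSum g l := by
  have h1 : ∀ k, 0 ≤ if (l : ℤ) < |k| then g k else 0 := fun k => by
    split_ifs
    · exact h0 k
    · exact le_rfl
  have h2 : Summable fun k : ℤ => if (l : ℤ) < |k| then g k else 0 := by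
    refine Summable.of_nonneg_of_le h1 (fun k => ?_) hg
    split_ifs
    · exact le_rfl
    · exact h0 k
  refine le_trans (le_of_eq (Finset.sum_congr rfl fun i hi => ?_))
    (sum_sub_le_tsum h1 h2 (s.filter fun i => ¬ |i - j| ≤ l) j)
  rw [if_pos (not_le.mp (Finset.mem_filter.mp hi).2)]

end BlockSum

/-! ### Stein's estimate with a window around one site -/

section Stein

variable {d : ℕ} [NeZero d] {φ : UHF d →ₗ[ℂ] ℂ} {ρ : ℕ → ℝ}

/-- The error of the approximation of `φ(q_j e^{itX})` with a window of radius `l`. -/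
def steinError (β κ C₁ C₂ r τ : ℝ) (l : ℕ) : ℝ :=
  κ * (β ^ 2 * ((2 * l + 1) * C₁)) + κ * (β * ((2 * l + 1) * κ)) ^ 2 + 3 * r * κ +
    β * ((2 * l + 1) * (3 * r * (κ * κ))) +
    β * (C₂ * (β * ((2 * l + 1) * κ) + β ^ 2 * ((2 * l + 1) * C₁))) + β * τ

theorem card_near_le (s : Finset ℤ) (j : ℤ) (l : ℕ) :
    ((s.filter fun i => |i - j| ≤ l).card : ℝ) ≤ 2 * l + 1 := by
  have h : (s.filter fun i => |i - j| ≤ l) ⊆ Finset.Icc (j - l) (j + l) := fun i hi => by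
    have := abs_le.mp (Finset.mem_filter.mp hi).2
    rw [Finset.mem_Icc]
    omega
  have h1 := Finset.card_le_card h
  rw [Int.card_Icc] at h1
  have h2 : (s.filter fun i => |i - j| ≤ l).card ≤ 2 * l + 1 := by omega
  exact_mod_cast h2

/-- Stein's estimate at one site. -/
theorem IntervalClustering.norm_map_translate_mul_expI_sub_le (hρ : IntervalClustering φ ρ)
    (hφ : IsNormalizedPositive φ) (hτ : IsTranslationInvariant φ) {Q : UHF d}
    (hQ : IsSelfAdjoint Q) (hQ0 : φ Q = 0) {m l : ℕ} (hl : 4 * m + 2 ≤ l)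
    (hQm : Q ∈ localAlg d (Set.Icc (-(m : ℤ)) m)) {g G : ℤ → ℝ} (hg : Summable g)
    (hgQ : ∀ k, ‖translate k Q * Q - Q * translate k Q‖ ≤ g k) (hG : Summable G)
    (hGQ : ∀ k, ‖cov φ Q Q k‖ ≤ G (-k)) {β : ℝ} (hβ : 0 ≤ β) (s : Finset ℤ) (j : ℤ) {t : ℝ}
    (ht0 : 0 ≤ t) (ht1 : t ≤ 1) :
    ‖φ (translate j Q * expI ((t : ℂ) • blockSum β s Q)) -
      Complex.I * t * β * (∑ i ∈ s, φ (translate j Q * translate i Q)) *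
        φ (expI ((t : ℂ) • blockSum β s Q))‖ ≤
      steinError β ‖Q‖ (∑' k, g k) (∑' k, G k) (ρ (l / 2 - 2 * m)) (tailSum G l) l := by
  have hnt := hφ.nontrivial
  have hg0 : ∀ k, 0 ≤ g k := fun k => (norm_nonneg _).trans (hgQ k)
  have hG0 : ∀ k, 0 ≤ G k := fun k => by simpa using (norm_nonneg _).trans (hGQ (-k))
  have hC₁ : 0 ≤ ∑' k, g k := tsum_nonneg hg0
  have hC₂ : 0 ≤ ∑' k, G k := tsum_nonneg hG0
  have hr := hρ.nonneg (l / 2 - 2 * m)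
  have hmem : ∀ i : ℤ, translate i Q ∈ localAlg d (Set.Icc (i - m) (i + m)) := fun i => by
    have := translate_mem_Icc (j := i) hQm
    rwa [← sub_eq_add_neg] at this
  have hc0 : ∀ i, φ (translate i Q) = 0 := fun i => by rw [hτ, hQ0]
  have hpair : ∀ i, ‖φ (translate j Q * translate i Q)‖ ≤ G (i - j) := fun i => by
    have h1 := hGQ (j - i)
    rw [cov, hQ0, mul_zero, sub_zero, ← hτ i, map_mul, translate_translate, add_sub_cancel,
      neg_sub] at h1
    exact h1
  -- The terms outside the window are split by their side of `j`. The two sides commute, so the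
  -- exponential of the far part is a product of unitaries supported to the left and to the right.
  set near := s.filter fun i => |i - j| ≤ l with hnear
  set far := s.filter fun i => ¬ |i - j| ≤ l with hfar
  set left := far.filter fun i => i < j with hleft
  set right := far.filter fun i => ¬ i < j with hright
  set Y := blockSum β near Q with hY
  set ZL := blockSum β left Q with hZL
  set ZR := blockSum β right Q with hZR
  have hZ : blockSum β far Q = ZL + ZR := by
    rw [hZL, hZR, blockSum, blockSum, blockSum, ← smul_add,
      Finset.sum_filter_add_sum_filter_not]
  have hX : blockSum β s Q = Y + blockSum β far Q := by
    rw [hY, blockSum, blockSum, blockSum, ← smul_add, Finset.sum_filter_add_sum_filter_not]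
  have hYs : IsSelfAdjoint Y := isSelfAdjoint_blockSum _ _ hQ
  have hZs : IsSelfAdjoint (blockSum β far Q) := isSelfAdjoint_blockSum _ _ hQ
  have hZLm : ZL ∈ localAlg d (Set.Iic (j - l - 1 + m)) := blockSum_mem β fun i hi => by
    refine localAlg_mono (fun k hk => ?_) (hmem i)
    simp only [hleft, hfar, Finset.mem_filter] at hi
    have h1 := hk.2
    have h2 := hi.1.2
    rw [abs_of_neg (by omega)] at h2
    simp only [Set.mem_Iic]
    omega
  have hZRm : ZR ∈ localAlg d (Set.Ici (j + l + 1 - m)) := blockSum_mem β fun i hi => by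
    refine localAlg_mono (fun k hk => ?_) (hmem i)
    simp only [hright, hfar, Finset.mem_filter] at hi
    have h1 := hk.1
    have h2 := hi.1.2
    rw [abs_of_nonneg (by omega)] at h2
    simp only [Set.mem_Ici]
    omega
  have hcomm : Commute ZL ZR := commute_of_mem_localAlg
    (Set.disjoint_left.mpr fun k (h1 : k ≤ _) (h2 : _ ≤ k) => by omega) hZLm hZRm
  set L := expI ((t : ℂ) • ZL) with hL
  set R := expI ((t : ℂ) • ZR) with hR
  set E := expI ((t : ℂ) • Y) with hE
  set F := expI ((t : ℂ) • blockSum β s Q) with hF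
  have hLu : L ∈ unitary (UHF d) :=
    expI_mem_unitary (isSelfAdjoint_ofReal_smul t (isSelfAdjoint_blockSum _ _ hQ))
  have hRu : R ∈ unitary (UHF d) :=
    expI_mem_unitary (isSelfAdjoint_ofReal_smul t (isSelfAdjoint_blockSum _ _ hQ))
  have hFu : F ∈ unitary (UHF d) :=
    expI_mem_unitary (isSelfAdjoint_ofReal_smul t (isSelfAdjoint_blockSum _ _ hQ))
  have hLR : expI ((t : ℂ) • blockSum β far Q) = L * R := by
    rw [hZ, smul_add]
    exact expI_add_of_commute ((hcomm.smul_left _).smul_right _)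
  have hVu : L * R ∈ unitary (UHF d) := mul_mem hLu hRu
  have hLm : L ∈ localAlg d (Set.Iic (j - l - 1 + m)) :=
    expI_mem_localAlg (SMulMemClass.smul_mem _ hZLm)
  have hRm : R ∈ localAlg d (Set.Ici (j + l + 1 - m)) :=
    expI_mem_localAlg (SMulMemClass.smul_mem _ hZRm)
  have hL1 : ‖L‖ ≤ 1 := (CStarRing.norm_of_mem_unitary hLu).le
  have hR1 : ‖R‖ ≤ 1 := (CStarRing.norm_of_mem_unitary hRu).le
  have hF1 : ‖φ F‖ ≤ 1 := (hφ.norm_map_le F).trans (CStarRing.norm_of_mem_unitary hFu).le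
  have hcard := card_near_le s j l
  have hsmul : ∀ W : UHF d, ‖(t : ℂ) • W‖ ≤ ‖W‖ := fun W => by
    rw [norm_smul, Complex.norm_real, Real.norm_eq_abs, abs_of_nonneg ht0]
    exact mul_le_of_le_one_left (norm_nonneg _) ht1
  have hYn : ‖(t : ℂ) • Y‖ ≤ β * ((2 * l + 1) * ‖Q‖) :=
    (hsmul Y).trans ((norm_blockSum_le hβ near Q).trans (by gcongr))
  have hFE : ‖F - E * (L * R)‖ ≤ β ^ 2 * ((2 * l + 1) * ∑' k, g k) := by
    have h1 := norm_expI_add_sub_le (isSelfAdjoint_ofReal_smul t hYs)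
      (isSelfAdjoint_ofReal_smul t hZs)
    rw [← smul_add, ← hX, hLR] at h1
    refine h1.trans ?_
    rw [smul_mul_smul_comm, smul_mul_smul_comm, ← smul_sub, mul_smul]
    refine (hsmul _).trans ((hsmul _).trans ?_)
    exact (norm_comm_blockSum_le far near hg hgQ).trans (by gcongr)
  have hVF : ‖φ (L * R) - φ F‖ ≤
      β * ((2 * l + 1) * ‖Q‖) + β ^ 2 * ((2 * l + 1) * ∑' k, g k) := by
    rw [← map_sub]
    refine (hφ.norm_map_le _).trans ?_
    have h1 : L * R - F = -((E - 1) * (L * R)) - (F - E * (L * R)) := by noncomm_ring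
    rw [h1]
    refine (norm_sub_le _ _).trans (add_le_add ?_ hFE)
    rw [norm_neg, norm_mul_unitary hVu]
    exact (norm_expI_sub_one_le (isSelfAdjoint_ofReal_smul t hYs)).trans hYn
  set q := translate j Q with hq
  have hqn : ‖q‖ = ‖Q‖ := norm_translate j Q
  have hsum : ∑ i ∈ s, φ (q * translate i Q) =
      ∑ i ∈ near, φ (q * translate i Q) + ∑ i ∈ far, φ (q * translate i Q) :=
    (Finset.sum_filter_add_sum_filter_not _ _ _).symm
  have hYV : φ (q * ((Complex.I • (t : ℂ) • Y) * (L * R))) =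
      Complex.I * t * β * ∑ i ∈ near, φ (q * translate i Q * (L * R)) := by
    rw [hY, blockSum]
    simp only [smul_mul_assoc, mul_smul_comm, map_smul, smul_eq_mul, Finset.sum_mul,
      Finset.mul_sum, map_sum, mul_assoc]
  -- The six errors, in order: separating the exponentials of near and far part; the second order
  -- remainder of the near exponential; the zeroth order, small because `q` is centred; decoupling
  -- of pairs from the exterior; returning from `φ(LR)` to `φ(F)`; covariances beyond the window.
  have key : φ (q * F) - Complex.I * t * β * (∑ i ∈ s, φ (q * translate i Q)) * φ F =
      φ (q * (F - E * (L * R))) + φ (q * ((E - 1 - Complex.I • (t : ℂ) • Y) * (L * R))) +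
      φ (q * (L * R)) +
      Complex.I * t * β * ∑ i ∈ near, (φ (q * translate i Q * (L * R)) -
        φ (q * translate i Q) * φ (L * R)) +
      Complex.I * t * β * ((∑ i ∈ near, φ (q * translate i Q)) * (φ (L * R) - φ F)) -
      Complex.I * t * β * ((∑ i ∈ far, φ (q * translate i Q)) * φ F) := by
    rw [hsum, Finset.sum_sub_distrib, ← Finset.sum_mul]
    have h1 : φ (q * ((E - 1 - Complex.I • (t : ℂ) • Y) * (L * R))) =
        φ (q * (E * (L * R))) - φ (q * (L * R)) -
          φ (q * ((Complex.I • (t : ℂ) • Y) * (L * R))) := by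
      simp only [sub_mul, mul_sub, map_sub, one_mul]
    rw [h1, hYV, mul_sub q, map_sub]
    ring
  have hcoef : ∀ z : ℂ, ‖Complex.I * t * β * z‖ ≤ β * ‖z‖ := fun z => by
    rw [norm_mul, norm_mul, norm_mul, Complex.norm_I, one_mul, Complex.norm_real,
      Complex.norm_real, Real.norm_eq_abs, Real.norm_eq_abs, abs_of_nonneg ht0, abs_of_nonneg hβ]
    exact mul_le_mul_of_nonneg_right (mul_le_of_le_one_left hβ ht1) (norm_nonneg _)
  have b1 : ‖φ (q * (F - E * (L * R)))‖ ≤ ‖Q‖ * (β ^ 2 * ((2 * l + 1) * ∑' k, g k)) := by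
    refine (hφ.norm_map_le _).trans ((norm_mul_le _ _).trans ?_)
    rw [hqn]
    gcongr
  have b2 : ‖φ (q * ((E - 1 - Complex.I • (t : ℂ) • Y) * (L * R)))‖ ≤
      ‖Q‖ * (β * ((2 * l + 1) * ‖Q‖)) ^ 2 := by
    refine (hφ.norm_map_le _).trans ((norm_mul_le _ _).trans ?_)
    rw [hqn, norm_mul_unitary hVu]
    refine mul_le_mul_of_nonneg_left ?_ (norm_nonneg _)
    refine (norm_expI_sub_one_sub_le (isSelfAdjoint_ofReal_smul t hYs)).trans ?_
    gcongr
  have b3 : ‖φ (q * (L * R))‖ ≤ 3 * ρ (l / 2 - 2 * m) * ‖Q‖ := by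
    have h1 := hρ.norm_cov_mul_le hφ (g := l / 2 - 2 * m) (by omega) (by omega) (by omega)
      (by omega) (hmem j) hLm hRm hL1 hR1
    rwa [hc0, zero_mul, sub_zero, norm_translate] at h1
  have b4 : ‖∑ i ∈ near, (φ (q * translate i Q * (L * R)) -
      φ (q * translate i Q) * φ (L * R))‖ ≤
      (2 * l + 1) * (3 * ρ (l / 2 - 2 * m) * (‖Q‖ * ‖Q‖)) := by
    have h1 : ∀ i ∈ near, ‖φ (q * translate i Q * (L * R)) -
        φ (q * translate i Q) * φ (L * R)‖ ≤ 3 * ρ (l / 2 - 2 * m) * (‖Q‖ * ‖Q‖) := fun i hi => by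
      have h2 := hρ.norm_cov_pair_le hφ hl (Finset.mem_filter.mp hi).2 (hmem j) (hmem i) (hc0 j)
        hLm hRm hL1 hR1
      rwa [norm_translate, norm_translate] at h2
    refine (norm_sum_le _ _).trans ((Finset.sum_le_card_nsmul _ _ _ h1).trans ?_)
    rw [nsmul_eq_mul]
    gcongr
  have b5 : ‖(∑ i ∈ near, φ (q * translate i Q)) * (φ (L * R) - φ F)‖ ≤
      (∑' k, G k) * (β * ((2 * l + 1) * ‖Q‖) + β ^ 2 * ((2 * l + 1) * ∑' k, g k)) := by
    rw [norm_mul]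
    refine mul_le_mul ?_ hVF (norm_nonneg _) hC₂
    exact (norm_sum_le _ _).trans ((Finset.sum_le_sum fun i _ => hpair i).trans
      (sum_sub_le_tsum hG0 hG near j))
  have b6 : ‖(∑ i ∈ far, φ (q * translate i Q)) * φ F‖ ≤ tailSum G l := by
    rw [norm_mul]
    refine (mul_le_of_le_one_right (norm_nonneg _) hF1).trans ?_
    exact (norm_sum_le _ _).trans ((Finset.sum_le_sum fun i _ => hpair i).trans
      (sum_far_le_tailSum hG0 hG s j l))
  rw [key, steinError]
  refine (norm_sub_le _ _).trans (add_le_add ((norm_add_le _ _).trans (add_le_add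
    ((norm_add_le _ _).trans (add_le_add (norm_add₃_le.trans (add_le_add_three b1 b2 b3)) ?_))
      ?_)) ?_)
  · exact (hcoef _).trans (mul_le_mul_of_nonneg_left b4 hβ)
  · exact (hcoef _).trans (mul_le_mul_of_nonneg_left b5 hβ)
  · exact (hcoef _).trans (mul_le_mul_of_nonneg_left b6 hβ)

end Stein

/-! ### The Gaussian limit for local observables -/

section LocalLimit

variable {d : ℕ} [NeZero d] {φ : UHF d →ₗ[ℂ] ℂ} {ρ : ℕ → ℝ}

theorem IsNormalizedPositive.hasDerivAt_map_expI (hφ : IsNormalizedPositive φ) (X : UHF d)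
    (t : ℝ) : HasDerivAt (fun t : ℝ => φ (expI ((t : ℂ) • X)))
      (Complex.I * φ (X * expI ((t : ℂ) • X))) t := by
  let L : UHF d →L[ℝ] ℂ := (LinearMap.mkContinuous φ 1 fun a => by
    simpa using hφ.norm_map_le a).restrictScalars ℝ
  have h := L.hasFDerivAt.comp_hasDerivAt t (hasDerivAt_expI_smul' X t)
  refine h.congr_deriv ?_
  change φ _ = _
  rw [map_smul, smul_eq_mul]

/-- The one-site estimates, summed over the box, say that `f(t) = φ(e^{itX})` nearly solves `f' =
-tσf` with `σ = φ(X²)`. There are `2N+1` sites, each weighted by `1/√(2N+1)`, which explains the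
prefactor. -/
theorem IntervalClustering.norm_map_expI_fluct_sub_le (hρ : IntervalClustering φ ρ)
    (hφ : IsNormalizedPositive φ) (hτ : IsTranslationInvariant φ) {Q : UHF d}
    (hQ : IsSelfAdjoint Q) (hQ0 : φ Q = 0) {m l : ℕ} (hl : 4 * m + 2 ≤ l)
    (hQm : Q ∈ localAlg d (Set.Icc (-(m : ℤ)) m)) {g G : ℤ → ℝ} (hg : Summable g)
    (hgQ : ∀ k, ‖translate k Q * Q - Q * translate k Q‖ ≤ g k) (hG : Summable G)
    (hGQ : ∀ k, ‖cov φ Q Q k‖ ≤ G (-k)) (N : ℕ) :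
    ‖φ (expI (fluct φ N Q)) - Complex.exp (-(1 / 2) * (stateNorm φ (fluct φ N Q) ^ 2 : ℝ))‖ ≤
      √(2 * N + 1) * steinError (1 / √(2 * N + 1)) ‖Q‖ (∑' k, g k) (∑' k, G k)
        (ρ (l / 2 - 2 * m)) (tailSum G l) l := by
  set S := √(2 * N + 1) with hS
  have hSpos : 0 < S := Real.sqrt_pos.mpr (by positivity)
  set β := 1 / S with hβ
  have hβ0 : 0 ≤ β := by positivity
  set s := Finset.Icc (-(N : ℤ)) N with hs
  set X := fluct φ N Q with hX
  have hXs : IsSelfAdjoint X := isSelfAdjoint_fluct hφ N hQ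
  have hXb : X = blockSum β s Q := fluct_eq_blockSum hQ0 N
  set D := steinError β ‖Q‖ (∑' k, g k) (∑' k, G k) (ρ (l / 2 - 2 * m)) (tailSum G l) l with hD
  have hσ : ((stateNorm φ X ^ 2 : ℝ) : ℂ) =
      (β : ℂ) * β * ∑ j ∈ s, ∑ i ∈ s, φ (translate j Q * translate i Q) := by
    rw [hφ.stateNorm_sq, hXs.star_eq, hXb, blockSum, smul_mul_smul_comm, map_smul, smul_eq_mul,
      Finset.sum_mul_sum, map_sum]
    simp only [map_sum]
  have h := norm_sub_exp_le_of_hasDerivAt (ε := S * D) (sq_nonneg (stateNorm φ X))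
    (hφ.hasDerivAt_map_expI X) (by simp [expI_zero, hφ.map_one]) fun t ht0 ht1 => by
    have e : Complex.I * φ (X * expI ((t : ℂ) • X)) +
        t * ((stateNorm φ X ^ 2 : ℝ) : ℂ) * φ (expI ((t : ℂ) • X)) =
        Complex.I * β * ∑ j ∈ s, (φ (translate j Q * expI ((t : ℂ) • blockSum β s Q)) -
          Complex.I * t * β * (∑ i ∈ s, φ (translate j Q * translate i Q)) *
            φ (expI ((t : ℂ) • blockSum β s Q))) := by
      rw [hσ, Finset.sum_sub_distrib, ← Finset.sum_mul, ← Finset.mul_sum, hXb]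
      have e1 : φ (blockSum β s Q * expI ((t : ℂ) • blockSum β s Q)) =
          β * ∑ j ∈ s, φ (translate j Q * expI ((t : ℂ) • blockSum β s Q)) := by
        conv_lhs => rw [blockSum]
        rw [smul_mul_assoc, map_smul, smul_eq_mul, Finset.sum_mul, map_sum]
        rfl
      rw [e1]
      linear_combination ((β : ℂ) * β * t *
        (∑ j ∈ s, ∑ i ∈ s, φ (translate j Q * translate i Q)) *
          φ (expI ((t : ℂ) • blockSum β s Q))) * Complex.I_mul_I
    rw [e, norm_mul, norm_mul, Complex.norm_I, one_mul, Complex.norm_real, Real.norm_eq_abs,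
      abs_of_nonneg hβ0]
    have h1 := (norm_sum_le _ _).trans (Finset.sum_le_card_nsmul s _ D fun j _ =>
      hρ.norm_map_translate_mul_expI_sub_le hφ hτ hQ hQ0 hl hQm hg hgQ hG hGQ hβ0 s j ht0 ht1)
    rw [nsmul_eq_mul, card_box] at h1
    refine (mul_le_mul_of_nonneg_left h1 hβ0).trans (le_of_eq ?_)
    rw [← mul_assoc]
    congr 1
    rw [hβ, one_div, inv_mul_eq_iff_eq_mul₀ hSpos.ne', Real.mul_self_sqrt (by positivity)]
  simpa only [Complex.ofReal_one, one_smul] using h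

/-- The bound for the error in Stein's method after multiplication by the normalisation. -/
theorem mul_steinError_le {S κ C₁ C₂ r τ ε : ℝ} {l : ℕ} (hκ : 0 ≤ κ) (hC₁ : 0 ≤ C₁)
    (hC₂ : 0 ≤ C₂) (hr : 0 ≤ r) (hS : 1 ≤ S) (hε : ε ≤ 1)
    (h1 : (2 * (l : ℝ) + 1) ^ 2 ≤ ε * S) (h2 : S * r ≤ ε) (h3 : τ ≤ ε) :
    S * steinError (1 / S) κ C₁ C₂ r τ l ≤
      (κ * C₁ + κ ^ 3 + 3 * κ + 3 * κ ^ 2 + C₂ * κ + C₂ * C₁ + 1) * ε := by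
  have hS0 : 0 < S := by linarith
  set L : ℝ := 2 * (l : ℝ) + 1 with hL
  have hL1 : 1 ≤ L := by rw [hL]; linarith [(Nat.cast_nonneg l : (0 : ℝ) ≤ l)]
  have hLε : L / S ≤ ε := by
    rw [div_le_iff₀ hS0]; nlinarith
  have hL2 : L ^ 2 / S ≤ ε := by rwa [div_le_iff₀ hS0]
  have hLS : L ≤ S := by
    have : L ≤ ε * S := by rwa [div_le_iff₀ hS0] at hLε
    nlinarith
  have hLr : L * r ≤ ε := (mul_le_mul_of_nonneg_right hLS hr).trans h2
  have hLSS : L / S / S ≤ ε := (div_le_self (by positivity) hS).trans hLε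
  -- The critical terms are `L²/S` from the second order remainder and `S r` from the zeroth order.
  -- The others are smaller because `1 ≤ L ≤ S`, apart from the tail `τ`, which has its own bound.
  have e : S * steinError (1 / S) κ C₁ C₂ r τ l = κ * C₁ * (L / S) + κ ^ 3 * (L ^ 2 / S) +
      3 * κ * (S * r) + 3 * κ ^ 2 * (L * r) + C₂ * κ * (L / S) + C₂ * C₁ * (L / S / S) + τ := by
    rw [steinError, ← hL]
    field_simp
    ring
  rw [e]
  have a1 := mul_le_mul_of_nonneg_left hLε (mul_nonneg hκ hC₁)
  have a2 := mul_le_mul_of_nonneg_left hL2 (pow_nonneg hκ 3)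
  have a3 := mul_le_mul_of_nonneg_left h2 (mul_nonneg (by norm_num : (0 : ℝ) ≤ 3) hκ)
  have a4 := mul_le_mul_of_nonneg_left hLr (mul_nonneg (by norm_num : (0 : ℝ) ≤ 3) (sq_nonneg κ))
  have a5 := mul_le_mul_of_nonneg_left hLε (mul_nonneg hC₂ hκ)
  have a6 := mul_le_mul_of_nonneg_left hLSS (mul_nonneg hC₂ hC₁)
  linarith

theorem tendsto_sqrt_box : Tendsto (fun N : ℕ => √(2 * N + 1)) atTop atTop :=
  Real.tendsto_sqrt_atTop.comp (tendsto_atTop_add_const_right _ _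
    (tendsto_natCast_atTop_atTop.const_mul_atTop two_pos))

/-- A window that grows slowly enough. -/
theorem exists_window {ρ : ℕ → ℝ} (h0 : ∀ g, 0 ≤ ρ g)
    (hρ : Tendsto (fun g : ℕ => (g : ℝ) ^ 2 * ρ g) atTop (𝓝 0)) {T : ℕ → ℝ}
    (hT : Tendsto T atTop (𝓝 0)) (m : ℕ) {ε : ℝ} (hε : 0 < ε) :
    ∀ᶠ N : ℕ in atTop, ∃ l : ℕ, 4 * m + 2 ≤ l ∧ (2 * (l : ℝ) + 1) ^ 2 ≤ ε * √(2 * N + 1) ∧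
      √(2 * N + 1) * ρ (l / 2 - 2 * m) ≤ ε ∧ T l ≤ ε := by
  -- This is, up to constants, the largest window allowed by `(2l+1)² ≤ εS`, since `2l + 1 ≤ 3l`.
  -- Conversely `S` is then at most of order `l²/ε`, so `l²ρ(l) → 0` controls `Sρ`.
  have hl : Tendsto (fun N : ℕ => ⌊√(ε * √(2 * N + 1)) / 3⌋₊) atTop atTop :=
    tendsto_nat_floor_atTop.comp ((Real.tendsto_sqrt_atTop.comp
      (tendsto_sqrt_box.const_mul_atTop hε)).atTop_div_const (by norm_num))
  have hsub : Tendsto (fun l : ℕ => l / 2 - 2 * m) atTop atTop :=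
    tendsto_atTop_atTop.mpr fun b => ⟨2 * (b + 2 * m), fun l hl => by omega⟩
  -- With `g = l/2 - 2m` and `l` large, `√(εS) < 3(l + 1) ≤ 9g`; hence `εS ≤ 81g²`, which fixes the
  -- constant.
  have e1 : ∀ᶠ l : ℕ in atTop, ((l / 2 - 2 * m : ℕ) : ℝ) ^ 2 * ρ (l / 2 - 2 * m) < ε ^ 2 / 81 :=
    (hρ.comp hsub).eventually_lt_const (by positivity)
  filter_upwards [hl.eventually (eventually_ge_atTop (12 * m + 8)), hl.eventually e1,
    hl.eventually (hT.eventually_le_const hε)] with N n1 n2 n3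
  set S := √(2 * (N : ℝ) + 1) with hS
  have hS0 : 0 ≤ S := Real.sqrt_nonneg _
  set l := ⌊√(ε * S) / 3⌋₊ with hldef
  have k1 : (l : ℝ) ≤ √(ε * S) / 3 := Nat.floor_le (by positivity)
  have k2 : √(ε * S) / 3 < l + 1 := Nat.lt_floor_add_one _
  have k3 : √(ε * S) ^ 2 = ε * S := Real.sq_sqrt (by positivity)
  have k4 : (1 : ℝ) ≤ l := by exact_mod_cast (by omega : 1 ≤ l)
  refine ⟨l, by omega, ?_, ?_, n3⟩
  · rw [← k3]
    exact pow_le_pow_left₀ (by linarith) (by linarith) 2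
  · have k5 : (l : ℝ) + 1 ≤ 3 * ((l / 2 - 2 * m : ℕ) : ℝ) := by
      exact_mod_cast (by omega : l + 1 ≤ 3 * (l / 2 - 2 * m))
    have k6 : ε * S ≤ 81 * ((l / 2 - 2 * m : ℕ) : ℝ) ^ 2 := by
      rw [← k3, show 81 * ((l / 2 - 2 * m : ℕ) : ℝ) ^ 2 =
        (9 * ((l / 2 - 2 * m : ℕ) : ℝ)) ^ 2 by ring]
      exact pow_le_pow_left₀ (Real.sqrt_nonneg _) (by linarith) 2
    have k7 := mul_le_mul_of_nonneg_right k6 (h0 (l / 2 - 2 * m))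
    have k8 : ε * (S * ρ (l / 2 - 2 * m)) ≤ ε * ε := by nlinarith
    exact le_of_mul_le_mul_left k8 hε

theorem fluct_algebraMap (hφ : IsNormalizedPositive φ) (N : ℕ) (z : ℂ) :
    fluct φ N (algebraMap ℂ (UHF d) z) = 0 := by
  simp [fluct, Algebra.algebraMap_eq_smul_one, hφ.map_one]

/-- The Gaussian carries the finite volume variance instead of its limit, so the later approximation
step needs only to compare seminorms of fluctuations. Centring is harmless since scalars have zero
fluctuation. -/
theorem IntervalClustering.tendsto_map_expI_fluct_of_local (hρ : IntervalClustering φ ρ)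
    (hφ : IsNormalizedPositive φ) (hτ : IsTranslationInvariant φ) {Q : UHF d}
    (hQ : IsSelfAdjoint Q) {m : ℕ} (hQm : Q ∈ localAlg d (Set.Icc (-(m : ℤ)) m)) :
    Tendsto (fun N => φ (expI (fluct φ N Q)) -
      Complex.exp (-(1 / 2) * (stateNorm φ (fluct φ N Q) ^ 2 : ℝ))) atTop (𝓝 0) := by
  wlog hQ0 : φ Q = 0 generalizing Q
  · have hs : IsSelfAdjoint (algebraMap ℂ (UHF d) (φ Q)) := by
      rw [IsSelfAdjoint, ← algebraMap_star_comm, ← hφ.apply_star, hQ.star_eq]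
    have h := this (Q := Q - algebraMap ℂ (UHF d) (φ Q)) (hQ.sub hs)
      (sub_mem hQm (algebraMap_mem _ _))
      (by rw [map_sub, Algebra.algebraMap_eq_smul_one, map_smul, hφ.map_one]; simp)
    simpa only [fluct_sub, fluct_algebraMap hφ, sub_zero] using h
  obtain ⟨δ, hδ, hA⟩ := isApproximable_of_mem_Icc hQm
  have hgQ := fun k => hA.norm_comm_translate_le hδ hA k
  have hGQ : ∀ k, ‖cov φ Q Q k‖ ≤ covBound ρ δ (-k) := fun k => by
    have := hρ.norm_cov_le hφ hτ hδ hA hA k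
    rwa [covBound, ← Int.natAbs_neg] at this
  have hg := summable_commBound hδ
  have hG := hρ.summable_covBound hδ
  have hC₁ : 0 ≤ ∑' k, commBound δ k := tsum_nonneg fun k => (norm_nonneg _).trans (hgQ k)
  have hC₂ : 0 ≤ ∑' k, covBound ρ δ k := tsum_nonneg fun k => by
    simpa using (norm_nonneg _).trans (hGQ (-k))
  set M : ℝ := ‖Q‖ * (∑' k, commBound δ k) + ‖Q‖ ^ 3 + 3 * ‖Q‖ + 3 * ‖Q‖ ^ 2 +
    (∑' k, covBound ρ δ k) * ‖Q‖ + (∑' k, covBound ρ δ k) * (∑' k, commBound δ k) + 1 with hM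
  have hM0 : 0 < M := by positivity
  refine Metric.tendsto_atTop'.mpr fun ε hε => ?_
  set η := min 1 (ε / (2 * M)) with hη
  have hη0 : 0 < η := lt_min one_pos (by positivity)
  obtain ⟨N₀, hN₀⟩ := eventually_atTop.mp
    (exists_window hρ.nonneg hρ.tendsto_sq_mul (tendsto_tailSum hG) m hη0)
  refine ⟨N₀, fun N hN => ?_⟩
  obtain ⟨l, h1, h2, h3, h4⟩ := hN₀ N hN.le
  rw [dist_zero_right]
  have hS1 : 1 ≤ √(2 * (N : ℝ) + 1) := Real.one_le_sqrt.mpr (by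
    linarith [(Nat.cast_nonneg N : (0 : ℝ) ≤ N)])
  refine ((hρ.norm_map_expI_fluct_sub_le hφ hτ hQ hQ0 h1 hQm hg hgQ hG hGQ N).trans
    (mul_steinError_le (norm_nonneg _) hC₁ hC₂ (hρ.nonneg _) hS1 (min_le_left _ _) h2 h3
      h4)).trans_lt ?_
  calc M * η ≤ M * (ε / (2 * M)) := mul_le_mul_of_nonneg_left (min_le_right _ _) hM0.le
    _ = ε / 2 := by field_simp
    _ < ε := half_lt_self hε

end LocalLimit

/-! ### From local to approximable observables -/

section Extension

variable {d : ℕ} [NeZero d] {φ : UHF d →ₗ[ℂ] ℂ} {ρ δ : ℕ → ℝ} {A B : UHF d}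

/-- The derivative bound is `|z| ≤ e^{z²/2}`. Being Lipschitz in the standard deviation rather than
the variance, the Gaussian can be compared without any bound on the variance. -/
theorem abs_exp_neg_sq_sub_le (x y : ℝ) :
    |Real.exp (-(1 / 2) * x ^ 2) - Real.exp (-(1 / 2) * y ^ 2)| ≤ |x - y| := by
  have hd : ∀ z : ℝ, HasDerivAt (fun z : ℝ => Real.exp (-(1 / 2) * z ^ 2))
      (Real.exp (-(1 / 2) * z ^ 2) * -z) z := fun z => by
    refine ((((hasDerivAt_id z).pow 2).const_mul (-(1 / 2) : ℝ)).exp).congr_deriv ?_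
    simp only [Pi.pow_apply, id]
    ring
  have h := Convex.norm_image_sub_le_of_norm_hasDerivWithin_le (C := 1) (s := Set.univ)
    (fun z _ => (hd z).hasDerivWithinAt) (fun z _ => ?_) convex_univ (Set.mem_univ y)
    (Set.mem_univ x)
  · simpa using h
  · rw [norm_mul, norm_neg, Real.norm_eq_abs, Real.norm_eq_abs, Real.abs_exp, neg_mul,
      Real.exp_neg, inv_mul_le_iff₀ (Real.exp_pos _), mul_one]
    refine le_trans ?_ (Real.add_one_le_exp _)
    nlinarith [sq_nonneg (|z| - 1), sq_abs z]

/-- A sequence tends to `0` if it is bounded, up to null sequences, by arbitrarily small numbers. -/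
theorem tendsto_zero_of_le_add {x : ℕ → ℝ} {b : ℕ → ℝ} {y : ℕ → ℕ → ℝ} (hx : ∀ N, 0 ≤ x N)
    (hb : Tendsto b atTop (𝓝 0)) (hy : ∀ l, Tendsto (y l) atTop (𝓝 0))
    (h : ∀ l N, x N ≤ b l + y l N) : Tendsto x atTop (𝓝 0) := by
  refine tendsto_order.mpr ⟨fun a ha => Eventually.of_forall fun N => ha.trans_le (hx N),
    fun ε hε => ?_⟩
  obtain ⟨l, hl⟩ := (hb.eventually_lt_const (half_pos hε)).exists
  filter_upwards [(hy l).eventually_lt_const (half_pos hε)] with N hN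
  linarith [h l N]

theorem IsNormalizedPositive.abs_stateNorm_sub_le (hφ : IsNormalizedPositive φ) (a b : UHF d) :
    |stateNorm φ a - stateNorm φ b| ≤ stateNorm φ (a - b) := by
  rw [abs_sub_le_iff]
  have h1 := hφ.stateNorm_add_le (a - b) b
  have h2 := hφ.stateNorm_add_le (b - a) a
  rw [sub_add_cancel] at h1 h2
  rw [stateNorm_sub_rev] at h2
  exact ⟨by linarith, by linarith⟩

/-- Self-adjoint local approximations, together with the rates of the errors and of the
approximations. -/
theorem IsApproximable.exists_seq (hδ : IsRate δ) (hA : IsApproximable δ A)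
    (hAs : IsSelfAdjoint A) : ∃ R : ℕ → UHF d,
      (∀ l : ℕ, R l ∈ localAlg d (Set.Icc (-(l : ℤ)) l)) ∧ (∀ l, IsSelfAdjoint (R l)) ∧
      (∀ l, IsApproximable (δ + δ) (A - R l)) ∧ (∀ l, IsApproximable (δ + δ) (R l)) ∧
      Tendsto (fun l => ‖A - R l‖) atTop (𝓝 0) := by
  choose R h1 h2 h3 using hA.exists_selfAdjoint_near hAs
  refine ⟨R, h1, h2, fun l => (hA.sub_near hδ (h1 l) (h3 l)).mono fun m => ?_,
    fun l => hA.near hδ (h1 l) (h3 l),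
    squeeze_zero (fun l => norm_nonneg _) h3 hδ.summable.tendsto_atTop_zero⟩
  exact le_add_of_nonneg_right (hδ.nonneg m)

/-- The central limit theorem for approximable self-adjoint elements, with the variance at finite
volume. -/
theorem IntervalClustering.tendsto_map_expI_fluct (hρ : IntervalClustering φ ρ)
    (hφ : IsNormalizedPositive φ) (hτ : IsTranslationInvariant φ) (hδ : IsRate δ)
    (hA : IsApproximable δ A) (hAs : IsSelfAdjoint A) :
    Tendsto (fun N => φ (expI (fluct φ N A)) -
      Complex.exp (-(1 / 2) * (stateNorm φ (fluct φ N A) ^ 2 : ℝ))) atTop (𝓝 0) := by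
  obtain ⟨R, hR, hRs, hE, hRa, h0⟩ := hA.exists_seq hδ hAs
  obtain ⟨b, hb, hb'⟩ := hρ.exists_stateNorm_fluct_le hφ hτ (hδ.add hδ) hE h0
  obtain ⟨c, hc, hc'⟩ := exists_norm_comm_fluct_le (φ := φ) (hδ.add hδ) hE hRa h0
  -- One `b l` and the commutator bound `c l` come from Duhamel's estimate, the other `b l` from
  -- comparing the Gaussians.
  have hlim : Tendsto (fun l => 2 * b l + c l) atTop (𝓝 0) := by
    simpa using (hb.const_mul 2).add hc
  refine tendsto_zero_iff_norm_tendsto_zero.mpr (tendsto_zero_of_le_add (fun N => norm_nonneg _)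
    hlim (fun l => (hρ.tendsto_map_expI_fluct_of_local hφ hτ (hRs l) (hR l)).norm.trans
      (by rw [norm_zero])) fun l N => ?_)
  have e1 := hφ.norm_map_expI_sub_le (isSelfAdjoint_fluct hφ N hAs)
    (isSelfAdjoint_fluct hφ N (hRs l))
  rw [← fluct_sub] at e1
  have e2 : ‖Complex.exp (-(1 / 2) * (stateNorm φ (fluct φ N (R l)) ^ 2 : ℝ)) -
      Complex.exp (-(1 / 2) * (stateNorm φ (fluct φ N A) ^ 2 : ℝ))‖ ≤ b l := by
    have h1 := abs_exp_neg_sq_sub_le (stateNorm φ (fluct φ N (R l))) (stateNorm φ (fluct φ N A))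
    have h2 := hφ.abs_stateNorm_sub_le (fluct φ N (R l)) (fluct φ N A)
    rw [stateNorm_sub_rev, ← fluct_sub] at h2
    have h3 := (h1.trans h2).trans (hb' l N)
    rw [← Real.norm_eq_abs, ← Complex.norm_real] at h3
    push_cast at h3 ⊢
    exact h3
  have e3 : φ (expI (fluct φ N A)) -
      Complex.exp (-(1 / 2) * (stateNorm φ (fluct φ N A) ^ 2 : ℝ)) =
      (φ (expI (fluct φ N A)) - φ (expI (fluct φ N (R l)))) +
      (Complex.exp (-(1 / 2) * (stateNorm φ (fluct φ N (R l)) ^ 2 : ℝ)) -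
        Complex.exp (-(1 / 2) * (stateNorm φ (fluct φ N A) ^ 2 : ℝ))) +
      (φ (expI (fluct φ N (R l))) -
        Complex.exp (-(1 / 2) * (stateNorm φ (fluct φ N (R l)) ^ 2 : ℝ))) := by ring
  rw [e3]
  refine norm_add₃_le.trans ?_
  linarith [hb' l N, hc' l N]

end Extension

/-! ### Averages of local elements -/

section Average

variable {d : ℕ} [NeZero d] {φ : UHF d →ₗ[ℂ] ℂ} {ρ δ : ℕ → ℝ} {A B : UHF d}

/-- The average over a box of translates of a family of elements. -/
def average (N : ℕ) (e : ℤ → UHF d) : UHF d :=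
  ((2 * N + 1 : ℝ) : ℂ)⁻¹ • ∑ k ∈ Finset.Icc (-(N : ℤ)) N, translate k (e k)

/-- An average carries one more factor `1/√(2N+1)` than a fluctuation, so its commutator with a
fluctuation vanishes in the limit. -/
theorem norm_comm_average_fluct_le (hδ : IsRate δ) (N : ℕ) {e : ℤ → UHF d}
    (he : ∀ k, IsApproximable δ (e k)) (hA : IsApproximable δ A) :
    ‖average N e * fluct φ N A - fluct φ N A * average N e‖ ≤
      1 / √(2 * N + 1) * ∑' k, commBound δ k := by
  have hpos : (0 : ℝ) < 2 * N + 1 := by positivity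
  have h0 : ∀ k, 0 ≤ commBound δ k := fun k =>
    (norm_nonneg _).trans (hA.norm_comm_translate_le hδ hA k)
  have e1 : average N e * fluct φ N A - fluct φ N A * average N e =
      (((2 * N + 1 : ℝ) : ℂ)⁻¹ * ((1 / √(2 * N + 1) : ℝ) : ℂ)) •
        ∑ k ∈ Finset.Icc (-(N : ℤ)) N, ∑ j ∈ Finset.Icc (-(N : ℤ)) N,
          (translate k (e k) * translate j A - translate j A * translate k (e k)) := by
    rw [average, fluct, smul_mul_smul_comm, smul_mul_smul_comm, Finset.sum_mul_sum,
      Finset.sum_mul_sum, mul_comm (((1 / √(2 * N + 1) : ℝ) : ℂ)), ← smul_sub,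
      Finset.sum_comm (f := fun i j => (translate i A - _) * translate j (e j)),
      ← Finset.sum_sub_distrib]
    refine congrArg _ (Finset.sum_congr rfl fun i _ => ?_)
    rw [← Finset.sum_sub_distrib]
    refine Finset.sum_congr rfl fun j _ => ?_
    rw [mul_sub, sub_mul, Algebra.commutes (φ A)]
    abel
  have e2 : ‖(((2 * N + 1 : ℝ) : ℂ)⁻¹ * ((1 / √(2 * N + 1) : ℝ) : ℂ))‖ =
      1 / √(2 * N + 1) * (2 * N + 1 : ℝ)⁻¹ := by
    rw [norm_mul, norm_inv, Complex.norm_real, Complex.norm_real, Real.norm_eq_abs,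
      Real.norm_eq_abs, abs_of_pos hpos, abs_of_nonneg (by positivity), mul_comm]
  rw [e1, norm_smul, e2, mul_assoc]
  refine mul_le_mul_of_nonneg_left ?_ (by positivity)
  rw [inv_mul_le_iff₀ hpos]
  refine le_trans ?_ (sum_box_sub_le h0 (summable_commBound hδ) N)
  refine (norm_sum_le _ _).trans (Finset.sum_le_sum fun i _ => ?_)
  refine (norm_sum_le _ _).trans (Finset.sum_le_sum fun j _ => ?_)
  have h1 : translate i (e i) * translate j A - translate j A * translate i (e i) =
      translate j (translate (i - j) (e i) * A - A * translate (i - j) (e i)) := by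
    rw [map_sub, map_mul, map_mul, translate_translate, add_sub_cancel]
  rw [h1, norm_translate]
  exact (he i).norm_comm_translate_le hδ hA _

/-- The law of large numbers for averages of approximable elements. -/
theorem IntervalClustering.stateNorm_average_sub_sq_le (hρ : IntervalClustering φ ρ)
    (hφ : IsNormalizedPositive φ) (hτ : IsTranslationInvariant φ) (hδ : IsRate δ) (N : ℕ)
    {e : ℤ → UHF d} (he : ∀ k, IsApproximable δ (e k)) :
    stateNorm φ (average N e - algebraMap ℂ (UHF d) (φ (average N e))) ^ 2 ≤
      (2 * N + 1 : ℝ)⁻¹ * ∑' k, covBound ρ δ k := by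
  have hpos : (0 : ℝ) < 2 * N + 1 := by positivity
  have h0 : ∀ k, 0 ≤ covBound ρ δ k := fun k =>
    (norm_nonneg _).trans (hρ.norm_cov_le hφ hτ hδ (he 0) (he 0) k)
  set C := average N e with hC
  have e1 : φ (star (C - algebraMap ℂ (UHF d) (φ C)) * (C - algebraMap ℂ (UHF d) (φ C))) =
      φ (star C * C) - φ (star C) * φ C := by
    simp only [star_sub, sub_mul, mul_sub, map_sub, star_smul, star_one,
      Algebra.algebraMap_eq_smul_one, smul_mul_assoc, mul_smul_comm, one_mul, mul_one, map_smul,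
      smul_eq_mul, hφ.map_one, hφ.apply_star]
    ring
  have e2 : φ (star C * C) - φ (star C) * φ C =
      ((2 * N + 1 : ℝ) : ℂ)⁻¹ * (((2 * N + 1 : ℝ) : ℂ)⁻¹ *
        ∑ i ∈ Finset.Icc (-(N : ℤ)) N, ∑ j ∈ Finset.Icc (-(N : ℤ)) N,
          cov φ (star (e i)) (e j) (i - j)) := by
    have h1 : ∀ i j : ℤ, cov φ (star (e i)) (e j) (i - j) =
        φ (star (translate i (e i)) * translate j (e j)) -
          φ (star (translate i (e i))) * φ (translate j (e j)) := fun i j => by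
      rw [cov, ← map_star, hτ, hτ, ← hτ j (translate (i - j) (star (e i)) * e j), map_mul,
        translate_translate, add_sub_cancel]
    simp only [h1, Finset.sum_sub_distrib, ← Finset.sum_mul_sum]
    rw [hC, average, star_smul, star_sum, star_inv₀, Complex.star_def, Complex.conj_ofReal,
      smul_mul_smul_comm, map_smul, map_smul, map_smul, Finset.sum_mul_sum, map_sum, map_sum,
      map_sum]
    simp only [map_sum, smul_eq_mul]
    ring
  have h2 : ((stateNorm φ (C - algebraMap ℂ (UHF d) (φ C)) ^ 2 : ℝ) : ℂ) =
      ((2 * N + 1 : ℝ) : ℂ)⁻¹ * (((2 * N + 1 : ℝ) : ℂ)⁻¹ *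
        ∑ i ∈ Finset.Icc (-(N : ℤ)) N, ∑ j ∈ Finset.Icc (-(N : ℤ)) N,
          cov φ (star (e i)) (e j) (i - j)) := by
    rw [hφ.stateNorm_sq, e1, e2]
  have h3 := congrArg norm h2
  rw [Complex.norm_real, Real.norm_eq_abs, abs_of_nonneg (sq_nonneg _), norm_mul, norm_mul,
    norm_inv, Complex.norm_real, Real.norm_eq_abs, abs_of_pos hpos] at h3
  rw [h3]
  refine mul_le_mul_of_nonneg_left ?_ (by positivity)
  rw [inv_mul_le_iff₀ hpos]
  refine le_trans ?_ (sum_box_sub_le h0 (hρ.summable_covBound hδ) N)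
  refine (norm_sum_le _ _).trans (Finset.sum_le_sum fun i _ => ?_)
  refine (norm_sum_le _ _).trans (Finset.sum_le_sum fun j _ => ?_)
  exact hρ.norm_cov_le hφ hτ hδ (he i).star (he j) _

/-- The commutator of the fluctuations of two local elements is an average of local elements. -/
theorem exists_average_eq_comm_fluct {l : ℕ} (hA : A ∈ localAlg d (Set.Icc (-(l : ℤ)) l))
    (hB : B ∈ localAlg d (Set.Icc (-(l : ℤ)) l)) :
    ∃ δ', IsRate δ' ∧ ∀ N, ∃ e : ℤ → UHF d, (∀ k, IsApproximable δ' (e k)) ∧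
      fluct φ N A * fluct φ N B - fluct φ N B * fluct φ N A = average N e := by
  obtain ⟨δ, hδ, hAB⟩ : ∃ δ, IsRate δ ∧ ∀ k,
      ‖translate k A * B - B * translate k A‖ ≤ commBound δ k := by
    have h1 := isApproximable_stepRate hA (le_max_left ‖A‖ ‖B‖)
    have h2 := isApproximable_stepRate hB (le_max_right ‖A‖ ‖B‖)
    have hr := isRate_stepRate ((norm_nonneg A).trans (le_max_left ‖A‖ ‖B‖)) l
    exact ⟨_, hr, h1.norm_comm_translate_le hr h2⟩
  have h0 : ∀ k, 0 ≤ commBound δ k := fun k => (norm_nonneg _).trans (hAB k)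
  -- The element attached to `k` collects the commutators of all translates of `A` with `B` at `k`.
  -- Only `|i - k| ≤ 2l` contributes, so it is supported in `[-3l, 3l]`; it depends on `N`, but the
  -- rate does not.
  refine ⟨stepRate (∑' k, commBound δ k) (3 * l), isRate_stepRate (tsum_nonneg h0) _, fun N =>
    ⟨fun k => ∑ i ∈ Finset.Icc (-(N : ℤ)) N,
      (translate (i - k) A * B - B * translate (i - k) A), fun k => ?_, ?_⟩⟩
  · refine isApproximable_stepRate (sum_mem fun i _ => ?_) ?_
    · have hA' : translate (i - k) A ∈ localAlg d (Set.Icc (i - k - l) (i - k + l)) := by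
        have := translate_mem_Icc (j := i - k) hA
        rwa [← sub_eq_add_neg] at this
      rcases le_or_gt |i - k| (2 * l) with h | h
      · have h1 := abs_le.mp h
        have m1 : translate (i - k) A ∈
            localAlg d (Set.Icc (-((3 * l : ℕ) : ℤ)) ((3 * l : ℕ) : ℤ)) :=
          localAlg_mono (Set.Icc_subset_Icc (by push_cast; omega) (by push_cast; omega)) hA'
        have m2 : B ∈ localAlg d (Set.Icc (-((3 * l : ℕ) : ℤ)) ((3 * l : ℕ) : ℤ)) :=
          localAlg_mono (Set.Icc_subset_Icc (by push_cast; omega) (by push_cast; omega)) hB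
        exact sub_mem (mul_mem m1 m2) (mul_mem m2 m1)
      · have hB' : B ∈ localAlg d (Set.Icc (0 - (l : ℤ)) (0 + (l : ℤ))) := by
          rwa [zero_sub, zero_add]
        have hc : Commute (translate (i - k) A) B :=
          commute_Icc (by rw [sub_zero]; linarith) hA' hB'
        rw [sub_eq_zero.mpr hc.eq]
        exact zero_mem _
    · refine (norm_sum_le _ _).trans (le_trans (Finset.sum_le_sum fun i _ => hAB _) ?_)
      exact sum_sub_le_tsum h0 (summable_commBound hδ) _ k
  · rw [comm_fluct, average, Finset.sum_comm]
    refine congrArg _ (Finset.sum_congr rfl fun k _ => ?_)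
    rw [map_sum]
    refine Finset.sum_congr rfl fun i _ => ?_
    rw [map_sub, map_mul, map_mul, translate_translate, add_sub_cancel]

end Average

/-! ### Merging exponentials of fluctuations -/

section Product

variable {d : ℕ} [NeZero d] {φ : UHF d →ₗ[ℂ] ℂ} {ρ δ : ℕ → ℝ} {A B : UHF d}

/-- The commutator of two fluctuations. -/
def fluctComm (φ : UHF d →ₗ[ℂ] ℂ) (N : ℕ) (A B : UHF d) : UHF d :=
  fluct φ N A * fluct φ N B - fluct φ N B * fluct φ N A

theorem norm_comm_unitary_le {U : UHF d} (hU : U ∈ unitary (UHF d)) (C C' : UHF d) :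
    ‖C * U - U * C‖ ≤ 2 * ‖C - C'‖ + ‖C' * U - U * C'‖ := by
  have e : C * U - U * C = (C - C') * U - U * (C - C') + (C' * U - U * C') := by noncomm_ring
  rw [e]
  refine (norm_add_le _ _).trans (add_le_add ((norm_sub_le _ _).trans ?_) le_rfl)
  rw [norm_mul_unitary hU, norm_unitary_mul hU, two_mul]

theorem IsNormalizedPositive.stateNorm_sub_map_le (hφ : IsNormalizedPositive φ) (C C' : UHF d) :
    stateNorm φ (C - algebraMap ℂ (UHF d) (φ C)) ≤
      2 * ‖C - C'‖ + stateNorm φ (C' - algebraMap ℂ (UHF d) (φ C')) := by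
  have h1 : stateNorm φ (algebraMap ℂ (UHF d) (φ (C' - C))) ≤ ‖C - C'‖ := by
    rw [Algebra.algebraMap_eq_smul_one, stateNorm_smul, hφ.stateNorm_one, mul_one, norm_sub_rev]
    exact hφ.norm_map_le _
  have e : C - algebraMap ℂ (UHF d) (φ C) = (C - C') + algebraMap ℂ (UHF d) (φ (C' - C)) +
      (C' - algebraMap ℂ (UHF d) (φ C')) := by
    rw [map_sub, map_sub]; abel
  rw [e]
  have h2 := hφ.stateNorm_add_le ((C - C') + algebraMap ℂ (UHF d) (φ (C' - C)))
    (C' - algebraMap ℂ (UHF d) (φ C'))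
  have h3 := hφ.stateNorm_add_le (C - C') (algebraMap ℂ (UHF d) (φ (C' - C)))
  have h4 := hφ.stateNorm_le_norm (C - C')
  linarith

/-- The commutator of self-adjoint elements is skew-adjoint, so the scalar phases have modulus one.
-/
theorem IsNormalizedPositive.re_map_fluctComm (hφ : IsNormalizedPositive φ) (N : ℕ)
    (hA : IsSelfAdjoint A) (hB : IsSelfAdjoint B) : (φ (fluctComm φ N A B)).re = 0 := by
  have h : star (fluctComm φ N A B) = -fluctComm φ N A B := by
    rw [fluctComm, star_sub, star_mul, star_mul, (isSelfAdjoint_fluct hφ N hA).star_eq,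
      (isSelfAdjoint_fluct hφ N hB).star_eq, neg_sub]
  have h1 := hφ.apply_star (fluctComm φ N A B)
  rw [h, map_neg] at h1
  have h2 := congrArg Complex.re h1
  simp only [Complex.neg_re, Complex.star_def, Complex.conj_re] at h2
  linarith

/-- The exponentials of two fluctuations merge up to a scalar phase. -/
theorem IntervalClustering.tendsto_stateNorm_expI_mul_expI (hρ : IntervalClustering φ ρ)
    (hφ : IsNormalizedPositive φ) (hτ : IsTranslationInvariant φ) (hδ : IsRate δ)
    (hA : IsApproximable δ A) (hAs : IsSelfAdjoint A) (hB : IsApproximable δ B)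
    (hBs : IsSelfAdjoint B) :
    Tendsto (fun N => stateNorm φ (expI (fluct φ N A) * expI (fluct φ N B) -
      Complex.exp (-φ (fluctComm φ N A B) / 2) • expI (fluct φ N A + fluct φ N B)))
      atTop (𝓝 0) := by
  obtain ⟨R, hR, -, hER, hRa, hR0⟩ := hA.exists_seq hδ hAs
  obtain ⟨S, hS, -, hES, -, hS0⟩ := hB.exists_seq hδ hBs
  have hδ2 := hδ.add hδ
  have hmono : ∀ m, δ m ≤ (δ + δ) m := fun m => le_add_of_nonneg_right (hδ.nonneg m)
  obtain ⟨b, hb, hb'⟩ := exists_norm_comm_fluct_le (φ := φ) hδ2 hER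
    (fun _ => hB.mono hmono) hR0
  obtain ⟨c, hc, hc'⟩ := exists_norm_comm_fluct_le (φ := φ) hδ2 hES hRa hS0
  have hdiff : ∀ l N, ‖fluctComm φ N A B - fluctComm φ N (R l) (S l)‖ ≤ b l + c l := by
    intro l N
    have e : fluctComm φ N A B - fluctComm φ N (R l) (S l) =
        (fluct φ N (A - R l) * fluct φ N B - fluct φ N B * fluct φ N (A - R l)) -
          (fluct φ N (B - S l) * fluct φ N (R l) - fluct φ N (R l) * fluct φ N (B - S l)) := by
      rw [fluctComm, fluctComm, fluct_sub, fluct_sub]; noncomm_ring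
    rw [e]
    exact (norm_sub_le _ _).trans (add_le_add (hb' l N) (hc' l N))
  choose δ' hδ' e he hCe using fun l => exists_average_eq_comm_fluct (φ := φ) (hR l) (hS l)
  have hinv : Tendsto (fun N : ℕ => 1 / √(2 * N + 1)) atTop (𝓝 0) := by
    simpa only [one_div, Function.comp_def] using tendsto_inv_atTop_zero.comp tendsto_sqrt_box
  -- Replacing the commutator by its local version costs `2(b + c)` in the centred seminorm and `2(b
  -- + c)` in each of the three `η`. For fixed `l` the remaining errors vanish as `N → ∞`.
  have hlim : Tendsto (fun l => 8 * (b l + c l)) atTop (𝓝 0) := by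
    simpa using (hb.add hc).const_mul 8
  set K : ℕ → ℝ := fun l => ∑' k, commBound (δ + δ' l) k with hK
  have hcomm : ∀ l N {X : UHF d}, IsApproximable δ X →
      ‖fluctComm φ N (R l) (S l) * fluct φ N X - fluct φ N X * fluctComm φ N (R l) (S l)‖ ≤
        1 / √(2 * N + 1) * K l := by
    intro l N X hX
    rw [fluctComm, hCe]
    exact norm_comm_average_fluct_le (hδ.add (hδ' l)) N
      (fun k => (he l N k).mono fun m => le_add_of_nonneg_left (hδ.nonneg m))
      (hX.mono fun m => le_add_of_nonneg_right ((hδ' l).nonneg m))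
  have hlln : ∀ l N, stateNorm φ (fluctComm φ N (R l) (S l) -
      algebraMap ℂ (UHF d) (φ (fluctComm φ N (R l) (S l)))) ≤
        1 / √(2 * N + 1) * √(∑' k, covBound ρ (δ' l) k) := by
    intro l N
    have h := hρ.stateNorm_average_sub_sq_le hφ hτ (hδ' l) N (he l N)
    rw [← hCe] at h
    rw [one_div, ← Real.sqrt_inv, ← Real.sqrt_mul (by positivity)]
    exact Real.le_sqrt_of_sq_le h
  refine tendsto_zero_of_le_add (fun N => stateNorm_nonneg _ _) hlim (y := fun l N =>
    1 / √(2 * N + 1) * (√(∑' k, covBound ρ (δ' l) k) + 3 * K l)) (fun l => ?_) fun l N => ?_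
  · simpa using hinv.mul_const (√(∑' k, covBound ρ (δ' l) k) + 3 * K l)
  have hη : ∀ {X : UHF d}, IsSelfAdjoint X → IsApproximable δ X → ∀ t : ℝ, 0 ≤ t → t ≤ 1 →
      ‖fluctComm φ N A B * expI ((t : ℂ) • fluct φ N X) -
        expI ((t : ℂ) • fluct φ N X) * fluctComm φ N A B‖ ≤
        2 * (b l + c l) + 1 / √(2 * N + 1) * K l := by
    intro X hXs hX t h0 h1
    have hs := isSelfAdjoint_fluct hφ N hXs
    refine (norm_comm_unitary_le (expI_mem_unitary (isSelfAdjoint_ofReal_smul t hs)) _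
      (fluctComm φ N (R l) (S l))).trans ?_
    have h2 := norm_comm_expI_smul_le (fluctComm φ N (R l) (S l)) hs h0 h1
    linarith [hdiff l N, hcomm l N hX]
  refine (hφ.stateNorm_expI_mul_expI_sub_le (isSelfAdjoint_fluct hφ N hAs)
    (isSelfAdjoint_fluct hφ N hBs) (hφ.re_map_fluctComm N hAs hBs) (hη hAs hA)
    (hη hBs hB)).trans ?_
  have h1 := hφ.stateNorm_sub_map_le (fluctComm φ N A B) (fluctComm φ N (R l) (S l))
  refine (add_le_add h1 le_rfl).trans ?_
  rw [mul_add (1 / √(2 * (N : ℝ) + 1))]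
  linarith [hdiff l N, hlln l N]

/-- The exponentials of several fluctuations merge up to a scalar phase. -/
theorem IntervalClustering.tendsto_stateNorm_prod_expI (hρ : IntervalClustering φ ρ)
    (hφ : IsNormalizedPositive φ) (hτ : IsTranslationInvariant φ) (r : ℕ) (Q : Fin r → UHF d)
    (hQs : ∀ k, IsSelfAdjoint (Q k)) (hQ : ∀ k, ∃ δ, IsRate δ ∧ IsApproximable δ (Q k)) :
    (∃ δ, IsRate δ ∧ IsApproximable δ (∑ k, Q k)) ∧
    Tendsto (fun N => stateNorm φ ((List.ofFn fun k => expI (fluct φ N (Q k))).prod -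
      Complex.exp (-(∑ l, ∑ k ∈ Finset.Iio l, φ (fluctComm φ N (Q k) (Q l))) / 2) •
        expI (fluct φ N (∑ k, Q k)))) atTop (𝓝 0) := by
  induction r with
  | zero =>
    refine ⟨⟨0, ⟨fun _ _ _ => le_rfl, summable_zero⟩, ⟨by simp, fun m => ⟨0, zero_mem _, by simp⟩⟩⟩,
      ?_⟩
    have h0 : ∀ N, fluct φ N (0 : UHF d) = 0 := fun N => map_zero (fluctLin φ N)
    simp [h0, expI_zero, stateNorm]
  | succ r ih =>
    -- The first factor is split off, because the error of the remaining product is then multiplied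
    -- by a unitary from the left, which leaves `stateNorm` unchanged.
    obtain ⟨⟨δ', hδ', hS⟩, hlim⟩ := ih (fun k => Q k.succ) (fun k => hQs _) fun k => hQ _
    obtain ⟨δ, hδ, hA⟩ := hQ 0
    set S := ∑ k : Fin r, Q k.succ with hSdef
    have hSs : IsSelfAdjoint S := by
      rw [IsSelfAdjoint, hSdef, star_sum]
      exact Finset.sum_congr rfl fun k _ => (hQs _).star_eq
    have htot : ∑ k, Q k = Q 0 + S := Fin.sum_univ_succ Q
    refine ⟨⟨_, hδ.add hδ', htot ▸ hA.add hS⟩, ?_⟩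
    have h2 := hρ.tendsto_stateNorm_expI_mul_expI hφ hτ (hδ.add hδ')
      (hA.mono fun m => le_add_of_nonneg_right (hδ'.nonneg m)) (hQs 0)
      (hS.mono fun m => le_add_of_nonneg_left (hδ.nonneg m)) hSs
    have hsum : Tendsto _ atTop (𝓝 ((0 : ℝ) + 0)) := hlim.add h2
    rw [add_zero] at hsum
    refine squeeze_zero (fun N => stateNorm_nonneg _ _) (fun N => ?_) hsum
    set z := ∑ l : Fin r, ∑ k ∈ Finset.Iio l, φ (fluctComm φ N (Q k.succ) (Q l.succ)) with hz
    set P := (List.ofFn fun k : Fin r => expI (fluct φ N (Q k.succ))).prod with hP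
    have hU := expI_mem_unitary (isSelfAdjoint_fluct hφ N (hQs 0))
    -- By bilinearity of the commutator, the pairs containing the index `0` make up the phase of
    -- merging `Q 0` with the sum of the others.
    have hphase : ∑ l, ∑ k ∈ Finset.Iio l, φ (fluctComm φ N (Q k) (Q l)) =
        φ (fluctComm φ N (Q 0) S) + z := by
      have h3 : ∀ l : Fin r, ∑ k ∈ Finset.Iio l.succ, φ (fluctComm φ N (Q k) (Q l.succ)) =
          φ (fluctComm φ N (Q 0) (Q l.succ)) +
            ∑ k ∈ Finset.Iio l, φ (fluctComm φ N (Q k.succ) (Q l.succ)) := fun l => by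
        simp only [← Finset.filter_gt_eq_Iio, Finset.sum_filter, Fin.sum_univ_succ,
          Fin.succ_pos, if_true, Fin.succ_lt_succ_iff]
      have h4 : φ (fluctComm φ N (Q 0) S) = ∑ l : Fin r, φ (fluctComm φ N (Q 0) (Q l.succ)) := by
        simp only [fluctComm, hSdef, fluct_sum, Finset.mul_sum, Finset.sum_mul, map_sub, map_sum,
          Finset.sum_sub_distrib]
      rw [Fin.sum_univ_succ, Finset.sum_congr rfl fun l _ => h3 l, Finset.sum_add_distrib, h4, hz,
        Finset.Iio_eq_empty.mpr fun b _ => Fin.zero_le b, Finset.sum_empty, zero_add]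
    have hexp : Complex.exp (-(φ (fluctComm φ N (Q 0) S) + z) / 2) =
        Complex.exp (-z / 2) * Complex.exp (-φ (fluctComm φ N (Q 0) S) / 2) := by
      rw [← Complex.exp_add]
      congr 1
      ring
    have hz0 : z.re = 0 := by
      rw [hz]
      simp only [Complex.re_sum]
      exact Finset.sum_eq_zero fun l _ => Finset.sum_eq_zero fun k _ =>
        hφ.re_map_fluctComm N (hQs _) (hQs _)
    have hzn : ‖Complex.exp (-z / 2)‖ = 1 := by
      rw [Complex.norm_exp, show (-z / 2).re = 0 by simp [hz0], Real.exp_zero]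
    rw [htot, List.ofFn_succ, List.prod_cons, hphase, hexp, fluct_add]
    have e : expI (fluct φ N (Q 0)) * P -
        (Complex.exp (-z / 2) * Complex.exp (-φ (fluctComm φ N (Q 0) S) / 2)) •
          expI (fluct φ N (Q 0) + fluct φ N S) =
        expI (fluct φ N (Q 0)) * (P - Complex.exp (-z / 2) • expI (fluct φ N S)) +
        Complex.exp (-z / 2) • (expI (fluct φ N (Q 0)) * expI (fluct φ N S) -
          Complex.exp (-φ (fluctComm φ N (Q 0) S) / 2) •
            expI (fluct φ N (Q 0) + fluct φ N S)) := by
      rw [mul_sub, mul_smul_comm, smul_sub, smul_smul]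
      abel
    rw [e]
    refine (hφ.stateNorm_add_le _ _).trans (le_of_eq ?_)
    rw [stateNorm_unitary_mul φ hU, stateNorm_smul, hzn, one_mul]

/-- The product is replaced by a phase times the exponential of the summed fluctuation. Convergence
of covariance sums identifies the limits of the phase and of the variance with `s` and `t`. -/
theorem IntervalClustering.correlationsConverge (hρ : IntervalClustering φ ρ)
    (hφ : IsNormalizedPositive φ) (hτ : IsTranslationInvariant φ) {r : ℕ} (Q : Fin r → UHF d)
    (hQs : ∀ k, IsSelfAdjoint (Q k)) (hQ : ∀ k, ∃ δ, IsRate δ ∧ IsApproximable δ (Q k)) :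
    CorrelationsConverge φ Q := by
  have hcov : ∀ {A B : UHF d}, (∃ δ, IsRate δ ∧ IsApproximable δ A) →
      (∃ δ, IsRate δ ∧ IsApproximable δ B) → Summable (cov φ A B) := by
    rintro A B ⟨δ, hδ, hA⟩ ⟨δ', hδ', hB⟩
    exact hρ.summable_cov hφ hτ (hδ.add hδ')
      (hA.mono fun m => le_add_of_nonneg_right (hδ'.nonneg m))
      (hB.mono fun m => le_add_of_nonneg_left (hδ.nonneg m))
  obtain ⟨hS, hprod⟩ := hρ.tendsto_stateNorm_prod_expI hφ hτ r Q hQs hQ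
  have hSs : IsSelfAdjoint (∑ k, Q k) := by
    rw [IsSelfAdjoint, star_sum]
    exact Finset.sum_congr rfl fun k _ => (hQs k).star_eq
  have ht := tendsto_map_fluct_mul_fluct hφ hτ (hcov hS hS)
  have hcomm : ∀ k l, HasSum (commTerm φ (Q k) (Q l))
      (∑' i, cov φ (Q k) (Q l) i - ∑' i, cov φ (Q l) (Q k) i) := fun k l => by
    have h1 := (hcov (hQ k) (hQ l)).hasSum
    have h2 := (Equiv.neg ℤ).hasSum_iff.mpr (hcov (hQ l) (hQ k)).hasSum
    refine (h1.sub h2).congr_fun fun i => ?_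
    rw [commTerm_eq hτ]
    rfl
  have hc : ∀ k l, Tendsto (fun N => φ (fluctComm φ N (Q k) (Q l))) atTop
      (𝓝 (Complex.I * sForm φ (Q k) (Q l))) := fun k l => by
    have h1 := (tendsto_map_fluct_mul_fluct hφ hτ (hcov (hQ k) (hQ l))).sub
      (tendsto_map_fluct_mul_fluct hφ hτ (hcov (hQ l) (hQ k)))
    have e : Complex.I * sForm φ (Q k) (Q l) =
        ∑' i, cov φ (Q k) (Q l) i - ∑' i, cov φ (Q l) (Q k) i := by
      rw [sForm, (hcomm k l).tsum_eq, ← mul_assoc, mul_neg, Complex.I_mul_I, neg_neg, one_mul]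
    rw [e]
    simpa only [fluctComm, map_sub] using h1
  refine ⟨fun k l => ⟨_, tendsto_map_fluct_mul_fluct hφ hτ (hcov (hQ k) (hQ l))⟩, ⟨_, ht⟩,
    fun k l => (hcomm k l).summable, ?_⟩
  obtain ⟨δ, hδ, hSa⟩ := hS
  have h1 := hρ.tendsto_map_expI_fluct hφ hτ hδ hSa hSs
  have htform : tForm φ (∑ k, Q k) (∑ k, Q k) = ∑' i, cov φ (∑ k, Q k) (∑ k, Q k) i :=
    ht.limUnder_eq
  have h2 : Tendsto (fun N => Complex.exp (-(1 / 2) *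
      (stateNorm φ (fluct φ N (∑ k, Q k)) ^ 2 : ℝ))) atTop
      (𝓝 (Complex.exp (-(1 / 2) * tForm φ (∑ k, Q k) (∑ k, Q k)))) := by
    rw [htform]
    refine (Complex.continuous_exp.tendsto _).comp (Tendsto.const_mul _ (ht.congr fun N => ?_))
    rw [hφ.stateNorm_sq, (isSelfAdjoint_fluct hφ N hSs).star_eq]
  have h3 : Tendsto (fun N => φ (expI (fluct φ N (∑ k, Q k)))) atTop
      (𝓝 (Complex.exp (-(1 / 2) * tForm φ (∑ k, Q k) (∑ k, Q k)))) := by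
    simpa using h1.add h2
  have h4 : Tendsto (fun N => Complex.exp (-(∑ l, ∑ k ∈ Finset.Iio l,
      φ (fluctComm φ N (Q k) (Q l))) / 2)) atTop (𝓝 (Complex.exp (-(Complex.I / 2) *
        ∑ l, ∑ k ∈ Finset.Iio l, sForm φ (Q k) (Q l)))) := by
    have h5 := tendsto_finsetSum Finset.univ fun l (_ : l ∈ Finset.univ) =>
      tendsto_finsetSum (Finset.Iio l) fun k (_ : k ∈ Finset.Iio l) => hc k l
    have e : -(Complex.I / 2) * ∑ l, ∑ k ∈ Finset.Iio l, sForm φ (Q k) (Q l) =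
        -(∑ l, ∑ k ∈ Finset.Iio l, Complex.I * sForm φ (Q k) (Q l)) / 2 := by
      simp only [← Finset.mul_sum]
      ring
    rw [e]
    exact (Complex.continuous_exp.tendsto _).comp (h5.neg.div_const 2)
  have h6 : Tendsto (fun N => φ ((List.ofFn fun k => expI (fluct φ N (Q k))).prod -
      Complex.exp (-(∑ l, ∑ k ∈ Finset.Iio l, φ (fluctComm φ N (Q k) (Q l))) / 2) •
        expI (fluct φ N (∑ k, Q k)))) atTop (𝓝 0) :=
    squeeze_zero_norm (fun N => hφ.norm_map_le_stateNorm _) hprod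
  have h7 := h6.add (h4.mul h3)
  rw [zero_add, mul_comm (Complex.exp _)] at h7
  refine h7.congr fun N => ?_
  rw [map_sub, map_smul, smul_eq_mul, sub_add_cancel]
  rfl

/-- Fluctuations are linear, so `T` is absorbed into the observable, whose rate is multiplied by
`|T|`. -/
theorem IntervalClustering.cltHolds (hρ : IntervalClustering φ ρ)
    (hφ : IsNormalizedPositive φ) (hτ : IsTranslationInvariant φ) {Q : UHF d}
    (hQs : IsSelfAdjoint Q) (hQ : ∃ δ, IsRate δ ∧ IsApproximable δ Q) : CLTHolds φ Q := by
  obtain ⟨δ, hδ, hQa⟩ := hQ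
  have ht := tendsto_map_fluct_mul_fluct hφ hτ (hρ.summable_cov hφ hτ hδ hQa hQa)
  refine ⟨⟨_, ht⟩, fun T => ?_⟩
  have hTs := isSelfAdjoint_ofReal_smul T hQs
  have hTa : IsApproximable (fun m => |T| * δ m) ((T : ℂ) • Q) := by
    refine ⟨?_, fun m => ?_⟩
    · rw [norm_smul, Complex.norm_real, Real.norm_eq_abs]
      exact mul_le_mul_of_nonneg_left hQa.norm_le (abs_nonneg T)
    · obtain ⟨R, h1, h2⟩ := hQa.exists_near m
      refine ⟨(T : ℂ) • R, SMulMemClass.smul_mem _ h1, ?_⟩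
      rw [← smul_sub, norm_smul, Complex.norm_real, Real.norm_eq_abs]
      exact mul_le_mul_of_nonneg_left h2 (abs_nonneg T)
  have hTr : IsRate fun m => |T| * δ m :=
    ⟨fun i j hij => mul_le_mul_of_nonneg_left (hδ.antitone hij) (abs_nonneg T),
      hδ.summable.mul_left _⟩
  have h1 := hρ.tendsto_map_expI_fluct hφ hτ hTr hTa hTs
  have h2 : Tendsto (fun N => Complex.exp (-(1 / 2) *
      (stateNorm φ (fluct φ N ((T : ℂ) • Q)) ^ 2 : ℝ))) atTop
      (𝓝 (Complex.exp (-((T : ℂ) ^ 2 / 2) * tForm φ Q Q))) := by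
    rw [show tForm φ Q Q = ∑' i, cov φ Q Q i from ht.limUnder_eq]
    refine (Complex.continuous_exp.tendsto _).comp
      ((ht.const_mul (-((T : ℂ) ^ 2 / 2))).congr fun N => ?_)
    rw [hφ.stateNorm_sq, (isSelfAdjoint_fluct hφ N hTs).star_eq, fluct_smul, smul_mul_smul_comm,
      map_smul, smul_eq_mul]
    ring
  have h3 := h1.add h2
  rw [zero_add] at h3
  refine h3.congr fun N => ?_
  rw [sub_add_cancel, expI, fluct_smul, smul_smul]

end Product

end SpinChain

end

/-! ### The two clustering hypotheses -/

open SpinChain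

theorem theorem1p5 (d : ℕ) [NeZero d] (φ : UHF d →ₗ[ℂ] ℂ) (hφ : IsState φ)
    (hτ : IsTranslationInvariant φ) :
    ((∃ (M : ℕ → ℝ) (K : ℝ), (∀ j, 0 < j → 0 < M j) ∧ (Summable fun j : ℕ => (j : ℝ) * M j) ∧
        HalfLineClustering φ (fun j => K * M j)) →
      (∀ Q : UHF d, IsSelfAdjoint Q → IsStrictlyLocal Q → CLTHolds φ Q) ∧
      (∀ (r : ℕ) (Q : Fin r → UHF d), (∀ k, IsSelfAdjoint (Q k)) → (∀ k, IsStrictlyLocal (Q k)) →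
        CorrelationsConverge φ Q)) ∧
    ((∃ K m : ℝ, 0 < K ∧ 0 < m ∧ HalfLineClustering φ (fun j => K * Real.exp (-m * j))) →
      ∀ θ : ℝ, 0 < θ → θ < 1 → ∀ (r : ℕ) (Q : Fin r → UHF d),
        (∀ k, IsSelfAdjoint (Q k)) → (∀ k, IsExpLocalized θ (Q k)) →
        CorrelationsConverge φ Q) := by
  have hφ' := hφ.isNormalizedPositive
  refine ⟨?_, ?_⟩
  · rintro ⟨M, K, -, hM, hK⟩
    -- The sign of `K` is not prescribed, whereas the decay function has to be nonnegative.
    have hcl : HalfLineClustering φ fun j => |K * M j| := fun j hj A hA B hB =>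
      (hK j hj A hA B hB).trans (by gcongr; exact le_abs_self _)
    have hs : Summable fun j : ℕ => (j : ℝ) * |K * M j| := by
      refine ((hM.mul_left K).norm).congr fun j => ?_
      rw [Real.norm_eq_abs, mul_left_comm, abs_mul, abs_of_nonneg (Nat.cast_nonneg j)]
    have hρ := hcl.intervalClustering hφ' hτ (fun j => abs_nonneg _) hs
    have hloc : ∀ {Q : UHF d}, IsStrictlyLocal Q → ∃ δ, IsRate δ ∧ IsApproximable δ Q :=
      fun h => isApproximable_of_mem_Icc h.exists_mem_Icc.choose_spec
    exact ⟨fun Q hQs hQ => hρ.cltHolds hφ' hτ hQs (hloc hQ),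
      fun r Q hQs hQ => hρ.correlationsConverge hφ' hτ Q hQs fun k => hloc (hQ k)⟩
  · rintro ⟨K, m, hK, hm, hcl⟩ θ h0 h1 r Q hQs hQ
    have hs : Summable fun j : ℕ => (j : ℝ) * (K * Real.exp (-m * j)) := by
      have h := (Real.summable_pow_mul_exp_neg_nat_mul 1 hm).mul_left K
      refine h.congr fun j => ?_
      rw [pow_one]
      ring
    have hρ := hcl.intervalClustering hφ' hτ (fun j => by positivity) hs
    exact hρ.correlationsConverge hφ' hτ Q hQs fun k => (hQ k).exists_isApproximable h0 h1
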